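/- **Notation.** Let $d\ge 1$ be an integer, $n>0$, $\Theta\subseteq\mathbb R^d$ open and $v:\Theta\to\mathbb R$. For a symmetric positive definite matrix $H$ put $\|x\|_H=\sqrt{x^{\intercal}Hx}$, and for a symmetric tensor $T$ of order $k$ put $\|T\|_H=\sup_{\|u\|_H=1}|\langle T,u^{\otimes k}\rangle|$. When $\hat x$ is the minimizer of $v$ introduced in A1 below, write $V=nv$, $H_v=\nabla^2 v(\hat x)$, $H_V=\nabla^2V(\hat x)=nH_v$, and for $s\ge 0$ $$\mathcal U(s)=\{x\in\mathbb R^d:\ \|x-\hat x\|_{H_v}\le s\sqrt{d/n}\}.$$ **Assumption A1.** $v\in C^4(\Theta)$, and $v$ has a unique global minimizer $\hat x\in\Theta$, with $H_v\succ0$. **Assumption A2** (with an absolute constant $A>0$). There are $s_0>0$ and $1\ge c_0>A/\sqrt d$ such that $$v(x)-v(\hat x)\ \ge\ c_0\sqrt{d/n}\,\|x-\hat x\|_{H_v}\qquad\text{for all }x\in\Theta\setminus\mathcal U(s_0).$$ Let $\pi\propto e^{-nv}$ be the probability measure on $\Theta$, let $\hat\gamma=\mathcal N(\hat x,H_V^{-1})$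 be the Laplace approximation, and let $d\hat\gamma_S=(1+S)\,d\hat\gamma$ be the corrected one, where $S(x)=-\frac16\langle\nabla^3V(\hat x),(x-\hat x)^{\otimes3}\rangle$. Let $W(x)=V(\hat x+H_V^{-1/2}x)$ and define $$\bar\epsilon_3=\Big(\tfrac16\|\nabla^3W(0)\|_F^2+\tfrac14\|\langle\nabla^3W(0),I_d\rangle\|^2\Big)^{1/2},\qquad \langle T,I_d\rangle_i=\sum_{j}T_{ijj},$$ $$c_k(s)=\sup_{x\in\mathcal U(s)}\|\nabla^kv(x)\|_{H_v},\qquad \epsilon_3=c_3(0)\frac{d}{\sqrt n},\qquad \epsilon_4(s)=c_4(s)^{1/2}\frac d{\sqrt n},$$ $$E(s)=\exp\big((\epsilon_3^2+\epsilon_4(s)^2)s^4\big),\qquad \tau(s)=d\,e^{-c_0sd/8},\qquad s^*=\max\Big(s_0,\ \frac8{c_0}\log\frac{2e}{c_0}\Big).$$ Here $\|\cdot\|_F$ is the Frobenius norm. **Theorem.** For all constants $A,B>0$ there is a constant $K>0$, depending only on $A$ and $B$, such that the following holds for all $d,n,\Theta,v$ satisfying A1 and A2 (the latter with this $A$). Let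 $G:\mathbb R^d\to\mathbb R$ be measurable with $\mathrm{Var}_{\hat\gamma}(G)>0$ and, for some $a_G\ge0$, $$\Big|G(x)-\int G\,d\hat\gamma\Big|\le a_G\exp\big(c_0\sqrt d\,\|x-\hat x\|_{H_V}/2\big)\qquad\text{for all }x\in\mathbb R^d,$$ and put $g=(G-\int G\,d\hat\gamma)/\sqrt{\mathrm{Var}_{\hat\gamma}(G)}$ and $a_g=a_G/\sqrt{\mathrm{Var}_{\hat\gamma}(G)}$. Let $s\ge s^*$ be such that $\mathcal U(s)\subseteq\Theta$, and suppose $\epsilon_3\le B$ and $\epsilon_4(s)\le B$. Set $$\Delta_g(\hat\gamma_S)=\int g\,d\pi-\int g(1+S)\,d\hat\gamma,\qquad L(g)=\int gS\,d\hat\gamma,\qquad \Delta_g(\hat\gamma)=\int g\,d\pi-\int g\,d\hat\gamma,$$ and let $R(g)=\Delta_g(\hat\gamma)-L(g)$. Then $\pi$ is a well-defined probability measure, all these integrals converge absolutely, $R(g)=\Delta_g(\hat\gamma_S)$, and $$|R(g)|=|\Delta_g(\hat\gamma_S)|\ \le\ K\Big(E(s)\big(\epsilon_3^2+\epsilon_4(s)^2\big)+(a_g\vee1)\,\tau(s)\Big).$$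 Moreover $|L(g)|\le\bar\epsilon_3$, and hence $$|\Delta_g(\hat\gamma)|\ \le\ |L(g)|+|R(g)|\ \le\ \bar\epsilon_3+|R(g)|.$$ If in addition $g$ is even about $\hat x$, i.e. $g(\hat x+x)=g(\hat x-x)$ for all $x$, then $L(g)=0$ and $\Delta_g(\hat\gamma)=\Delta_g(\hat\gamma_S)$. -/

import Mathlib

open MeasureTheory ProbabilityTheory
open scoped MatrixOrder

noncomputable section

namespace SkewLaplace

/-- `ℝ^d` with the Euclidean norm. -/
abbrev E (d : ℕ) : Type := EuclideanSpace ℝ (Fin d)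

variable {d : ℕ}

/-- The `i`-th standard basis vector of `ℝ^d`. -/
def stdVec (i : Fin d) : E d := EuclideanSpace.single i (1 : ℝ)

/-- The Hessian matrix `∇²f(x)`. -/
def hess (f : E d → ℝ) (x : E d) : Matrix (Fin d) (Fin d) ℝ :=
  Matrix.of fun i j => iteratedFDeriv ℝ 2 f x ![stdVec i, stdVec j]

/-- The weighted norm `‖x‖_H = √(xᵀ H x)`. -/
def wnorm (H : Matrix (Fin d) (Fin d) ℝ) (x : E d) : ℝ :=
  Real.sqrt (dotProduct (x : Fin d → ℝ) (H.mulVec (x : Fin d → ℝ)))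

/-- The `H`-weighted operator norm of a symmetric tensor of order `k`, seen as a `k`-linear form:
`‖T‖_H = sup { |⟨T, u^{⊗k}⟩| : ‖u‖_H = 1 }`. -/
def tnorm {k : ℕ} (H : Matrix (Fin d) (Fin d) ℝ)
    (T : ContinuousMultilinearMap ℝ (fun _ : Fin k => E d) ℝ) : ℝ :=
  sSup ((fun u : E d => |T (fun _ => u)|) '' {u | wnorm H u = 1})

/-- The local region `U(s) = {x : ‖x - xhat‖_{H_v} ≤ s √(d/n)}`, `H_v = ∇²v(xhat)`. -/
def localRegion (n : ℝ) (v : E d → ℝ) (xhat : E d) (s : ℝ) : Set (E d) :=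
  {x | wnorm (hess v xhat) (x - xhat) ≤ s * Real.sqrt (d / n)}

/-- Regularity and unique strict minimum: `v ∈ C⁴(Θ)`, and `xhat ∈ Θ` is the unique global
minimizer of `v` over `Θ`, with positive definite Hessian. -/
structure RegularUniqueMin (Θ : Set (E d)) (v : E d → ℝ) (xhat : E d) : Prop where
  contDiffOn : ContDiffOn ℝ 4 v Θ
  mem : xhat ∈ Θ
  lt_of_ne : ∀ x ∈ Θ, x ≠ xhat → v xhat < v x
  posDef : (hess v xhat).PosDef

/-- Linear growth of `v` away from the local region `U(s₀)`, with constants `s₀ > 0` and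
`1 ≥ c₀ > A / √d`. -/
structure LinearGrowth (A n : ℝ) (Θ : Set (E d)) (v : E d → ℝ) (xhat : E d) (s₀ c₀ : ℝ) :
    Prop where
  s₀_pos : 0 < s₀
  c₀_le_one : c₀ ≤ 1
  lt_c₀ : A / Real.sqrt d < c₀
  growth : ∀ x ∈ Θ \ localRegion n v xhat s₀,
    c₀ * Real.sqrt (d / n) * wnorm (hess v xhat) (x - xhat) ≤ v x - v xhat

/-- The potential `V = n v`. -/
def potential (n : ℝ) (v : E d → ℝ) : E d → ℝ := fun x => n * v x

/-- The measure with Lebesgue density `e^{-n v}` on `Θ`. -/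
def unnormalized (n : ℝ) (Θ : Set (E d)) (v : E d → ℝ) : Measure (E d) :=
  (volume.restrict Θ).withDensity fun x => ENNReal.ofReal (Real.exp (-potential n v x))

/-- The probability measure `π ∝ e^{-n v}` on `Θ`. -/
def target (n : ℝ) (Θ : Set (E d)) (v : E d → ℝ) : Measure (E d) :=
  (unnormalized n Θ v Set.univ)⁻¹ • unnormalized n Θ v

/-- `H_V = ∇²V(xhat)`. -/
def HV (n : ℝ) (v : E d → ℝ) (xhat : E d) : Matrix (Fin d) (Fin d) ℝ :=
  hess (potential n v) xhat

/-- The Laplace approximation `N(xhat, H_V⁻¹)`. -/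
def laplace (n : ℝ) (v : E d → ℝ) (xhat : E d) : Measure (E d) :=
  multivariateGaussian xhat (HV n v xhat)⁻¹

/-- The skew correction `S(x) = -(1/6) ⟨∇³V(xhat), (x - xhat)^{⊗3}⟩`. -/
def skew (n : ℝ) (v : E d → ℝ) (xhat x : E d) : ℝ :=
  -(1 / 6) * iteratedFDeriv ℝ 3 (potential n v) xhat (fun _ => x - xhat)

/-- The rescaled potential `W(x) = V(xhat + H_V^{-1/2} x)`. -/
def rescaled (n : ℝ) (v : E d → ℝ) (xhat x : E d) : ℝ :=
  potential n v (xhat + Matrix.toEuclideanCLM (𝕜 := ℝ) (CFC.sqrt (HV n v xhat)⁻¹) x)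

/-- The entries of `∇³W(0)`. -/
def thirdW (n : ℝ) (v : E d → ℝ) (xhat : E d) (i j k : Fin d) : ℝ :=
  iteratedFDeriv ℝ 3 (rescaled n v xhat) 0 ![stdVec i, stdVec j, stdVec k]

/-- `εbar₃ = √( ‖∇³W(0)‖_F² / 6 + ‖⟨∇³W(0), I_d⟩‖² / 4 )`, where `‖·‖_F` is the Frobenius norm and
`⟨T, I_d⟩` is the vector with entries `∑ⱼ T_{ijj}`. -/
def epsBar3 (n : ℝ) (v : E d → ℝ) (xhat : E d) : ℝ :=
  Real.sqrt ((1 / 6) * (∑ i, ∑ j, ∑ k, thirdW n v xhat i j k ^ 2)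
    + (1 / 4) * ∑ i, (∑ j, thirdW n v xhat i j j) ^ 2)

/-- `c_k(s) = sup_{x ∈ U(s)} ‖∇ᵏv(x)‖_{H_v}`. -/
def cDeriv (k : ℕ) (n : ℝ) (v : E d → ℝ) (xhat : E d) (s : ℝ) : ℝ :=
  sSup ((fun x => tnorm (hess v xhat) (iteratedFDeriv ℝ k v x)) '' localRegion n v xhat s)

/-- `ε₃ = c₃(0) d / √n`. -/
def eps3 (n : ℝ) (v : E d → ℝ) (xhat : E d) : ℝ :=
  cDeriv 3 n v xhat 0 * (d / Real.sqrt n)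

/-- `ε₄(s) = c₄(s)^{1/2} d / √n`. -/
def eps4 (n : ℝ) (v : E d → ℝ) (xhat : E d) (s : ℝ) : ℝ :=
  Real.sqrt (cDeriv 4 n v xhat s) * (d / Real.sqrt n)

/-- `E(s) = exp((ε₃² + ε₄(s)²) s⁴)`. -/
def expFactor (n : ℝ) (v : E d → ℝ) (xhat : E d) (s : ℝ) : ℝ :=
  Real.exp ((eps3 n v xhat ^ 2 + eps4 n v xhat s ^ 2) * s ^ 4)

/-- `τ(s) = d exp(-c₀ s d / 8)`. -/
def tau (d : ℕ) (c₀ s : ℝ) : ℝ := d * Real.exp (-(c₀ * s * d / 8))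

/-- `s* = max(s₀, (8/c₀) log(2e/c₀))`. -/
def sStar (s₀ c₀ : ℝ) : ℝ := max s₀ (8 / c₀ * Real.log (2 * Real.exp 1 / c₀))

/-- The standardization `g = (G - ∫ G dγ) / √Var_γ(G)` of `G` under `γ`. -/
def standardize (γ : Measure (E d)) (G : E d → ℝ) (x : E d) : ℝ :=
  (G x - ∫ y, G y ∂γ) / Real.sqrt (variance G γ)

/-- `∫ g dπ - ∫ g (1 + S) dγhat`, the error of the skew-corrected approximation
(equivalently, the remainder `R(g)`). -/
def errCorrected (n : ℝ) (Θ : Set (E d)) (v : E d → ℝ) (xhat : E d) (g : E d → ℝ) : ℝ :=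
  (∫ x, g x ∂(target n Θ v)) - ∫ x, g x * (1 + skew n v xhat x) ∂(laplace n v xhat)

/-- The leading term `L(g) = ∫ g S dγhat`. -/
def leading (n : ℝ) (v : E d → ℝ) (xhat : E d) (g : E d → ℝ) : ℝ :=
  ∫ x, g x * skew n v xhat x ∂(laplace n v xhat)

/-- `∫ g dπ - ∫ g dγhat`, the error of the uncorrected Laplace approximation. -/
def errLaplace (n : ℝ) (Θ : Set (E d)) (v : E d → ℝ) (xhat : E d) (g : E d → ℝ) : ℝ :=
  (∫ x, g x ∂(target n Θ v)) - ∫ x, g x ∂(laplace n v xhat)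

end SkewLaplace

end

/-! Whitening x = xhat + H_V^{-1/2} y turns the Laplace approximation into the standard Gaussian γ
on ℝ^d, and π into γ reweighted by w(y) = 1_Θ exp(W(0) - W(y) + ‖y‖²/2), up to normalization. On the
ball ‖y‖ ≤ s√d Taylor's formula gives w = exp(S + ρ), where S = -∇³W(0)[y,y,y]/6 is an odd cubic
form and |ρ| ≤ ε₄²‖y‖⁴/(24 d²). Off that ball A2 gives w ≤ exp(-c₀√d‖y‖ + ‖y‖²/2). Since g is
centred, the remainder is ∫ f w / ∫ w - ∫ f S, with f the whitened g. Hence it suffices to compare ∫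
f w with ∫ f (1 + S), for this f and for f = 1, and to bound ∫ w from below
(`LocalExpansion.abs_integral_sub_le`, `LocalExpansion.le_integral`, combined in
`exists_abs_ratio_sub_le`).

The crux is that e^{S+ρ} - 1 - S has size ε₃² + ε₄² in L²(γ), free of the dimension. In the bulk
‖y‖² ≤ 4d the pointwise bound on S is only of order ε₃√d. However ∇S is O(ε₃) there and S is odd, so
after a smooth cutoff the Maurey–Pisier argument (`integral_exp_le_of_odd`) makes S/ε₃ sub-Gaussian
with an absolute constant. Between the bulk and radius s√d, crude bounds cost the factor E(s) and a
weight exp(‖y‖²/36), which is absorbed by the exponentially small Gaussian mass of the region.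
`exists_isDominating` merges both regimes into one function J with bounded second moment, and
Young's inequality against f closes the local estimate. Off the ball the linear growth of the
potential beats the growth of f, and s ≥ s* pays for the dimensional constants
(`integrable_tail_and_integral_le`).

The leading term is handled by Cauchy–Schwarz and the exact value ∫ S² dγ = εbar₃², obtained by
repeated Gaussian integration by parts (`integral_trilin_sq`). For even g the integrand g S is odd.
-/

noncomputable section

set_option maxSynthPendingDepth 3
set_option linter.unusedSectionVars false

namespace SkewLaplace

section

variable {V : Type*} [NormedAddCommGroup V] [InnerProductSpace ℝ V] [FiniteDimensional ℝ V]
  [MeasurableSpace V] [BorelSpace V]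

/-! ### The standard Gaussian measure -/

/-- The density of the standard Gaussian measure. -/
def gaussDensity (y : V) : ℝ :=
  (2 * Real.pi) ^ (-(Module.finrank ℝ V : ℝ) / 2) * Real.exp (-(1 / 2) * ‖y‖ ^ 2)

lemma gaussDensity_pos (y : V) : 0 < gaussDensity y := by
  unfold gaussDensity; positivity

lemma continuous_gaussDensity : Continuous (gaussDensity (V := V)) := by
  unfold gaussDensity; fun_prop

lemma integrable_exp_neg_mul_sq_norm {b : ℝ} (hb : 0 < b) :
    Integrable (fun y : V => Real.exp (-b * ‖y‖ ^ 2)) := by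
  have h := GaussianFourier.integrable_cexp_neg_mul_sq_norm_add (V := V) (b := b)
    (by simpa using hb) 0 0
  refine h.norm.congr (Filter.Eventually.of_forall fun y => ?_)
  simp [Complex.norm_exp, ← Complex.ofReal_pow]

lemma integral_exp_neg_mul_sq_norm {b : ℝ} (hb : 0 < b) :
    ∫ y : V, Real.exp (-b * ‖y‖ ^ 2) = (Real.pi / b) ^ ((Module.finrank ℝ V : ℝ) / 2) := by
  simpa using GaussianFourier.integral_rexp_neg_mul_sq_norm (V := V) hb

lemma integrable_gaussDensity : Integrable (gaussDensity (V := V)) :=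
  (integrable_exp_neg_mul_sq_norm (by norm_num)).const_mul _

/-- Both measures have characteristic function exp(-‖t‖²/2); for the density this is the complex
Gaussian integral. -/
lemma stdGaussian_eq_withDensity :
    stdGaussian V = volume.withDensity fun y => ENNReal.ofReal (gaussDensity y) := by
  have hfin : IsFiniteMeasure (volume.withDensity fun y : V => ENNReal.ofReal (gaussDensity y)) :=
    isFiniteMeasure_withDensity_ofReal integrable_gaussDensity.2
  refine Measure.ext_of_charFun (funext fun t => ?_)
  rw [charFun_stdGaussian, charFun_apply,
    integral_withDensity_eq_integral_toReal_smul (by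
      exact continuous_gaussDensity.measurable.ennreal_ofReal) (by simp)]
  have h := GaussianFourier.integral_cexp_neg_mul_sq_norm_add (V := V) (b := (1 / 2 : ℂ))
    (by norm_num) Complex.I t
  have hd : ((2 * Real.pi : ℝ) : ℂ) ^ (-(Module.finrank ℝ V : ℂ) / 2) *
      (Real.pi / (1 / 2 : ℂ)) ^ (Module.finrank ℝ V / 2 : ℂ) = 1 := by
    have : (Real.pi / (1 / 2 : ℂ)) = ((2 * Real.pi : ℝ) : ℂ) := by push_cast; ring
    rw [this, ← Complex.cpow_add _ _ (by exact_mod_cast (by positivity : (2 * Real.pi) ≠ 0))]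
    ring_nf; simp
  have h2 : ∀ y : V, (ENNReal.ofReal (gaussDensity y)).toReal •
      Complex.exp (inner ℝ y t * Complex.I) =
        ((2 * Real.pi : ℝ) : ℂ) ^ (-(Module.finrank ℝ V : ℂ) / 2) *
      Complex.exp (-(1 / 2) * ‖y‖ ^ 2 + Complex.I * inner ℝ t y) := by
    intro y
    rw [ENNReal.toReal_ofReal (gaussDensity_pos y).le, gaussDensity, Complex.real_smul,
      Complex.exp_add, real_inner_comm t y]
    rw [Complex.ofReal_mul, Complex.ofReal_cpow (by positivity), Complex.ofReal_exp]
    push_cast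
    rw [mul_comm Complex.I]
    ring
  simp_rw [h2]
  rw [integral_const_mul, h]
  rw [← mul_assoc, hd, one_mul]
  congr 1
  rw [Complex.I_sq]; ring

lemma integral_stdGaussian (f : V → ℝ) :
    ∫ y, f y ∂(stdGaussian V) = ∫ y, gaussDensity y * f y := by
  rw [stdGaussian_eq_withDensity, integral_withDensity_eq_integral_toReal_smul
    (by exact continuous_gaussDensity.measurable.ennreal_ofReal) (by simp)]
  simp only [ENNReal.toReal_ofReal (gaussDensity_pos _).le, smul_eq_mul]

lemma integrable_stdGaussian_iff (f : V → ℝ) :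
    Integrable f (stdGaussian V) ↔ Integrable fun y => gaussDensity y * f y := by
  rw [stdGaussian_eq_withDensity, integrable_withDensity_iff_integrable_smul'
    (by exact continuous_gaussDensity.measurable.ennreal_ofReal) (by simp)]
  simp only [ENNReal.toReal_ofReal (gaussDensity_pos _).le, smul_eq_mul]

/-- This is the universal integrable majorant used below; its integral, √2 to the power of the
dimension, is the price paid in the tail bounds. -/
lemma integrable_exp_sq_div_four :
    Integrable (fun y : V => Real.exp (‖y‖ ^ 2 / 4)) (stdGaussian V) := by
  rw [integrable_stdGaussian_iff]
  refine ((integrable_exp_neg_mul_sq_norm (b := 1 / 4) (by norm_num)).const_mul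
    ((2 * Real.pi) ^ (-(Module.finrank ℝ V : ℝ) / 2))).congr
      (Filter.Eventually.of_forall fun y => ?_)
  simp only [gaussDensity]
  rw [mul_assoc, ← Real.exp_add]; ring_nf

lemma integral_exp_sq_div_four :
    ∫ y : V, Real.exp (‖y‖ ^ 2 / 4) ∂(stdGaussian V) = Real.sqrt 2 ^ Module.finrank ℝ V := by
  rw [integral_stdGaussian]
  have : ∀ y : V, gaussDensity y * Real.exp (‖y‖ ^ 2 / 4) =
      (2 * Real.pi) ^ (-(Module.finrank ℝ V : ℝ) / 2) * Real.exp (-(1 / 4) * ‖y‖ ^ 2) := fun y => by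
    simp only [gaussDensity]
    rw [mul_assoc, ← Real.exp_add]; ring_nf
  simp_rw [this]
  rw [integral_const_mul, integral_exp_neg_mul_sq_norm (by norm_num)]
  have h4 : Real.pi / (1 / 4) = (2 * Real.pi) * 2 := by ring
  rw [h4, Real.mul_rpow (x := 2 * Real.pi) (y := 2) (by positivity) (by positivity), ← mul_assoc,
    ← Real.rpow_add (by positivity)]
  rw [show -(Module.finrank ℝ V : ℝ) / 2 + Module.finrank ℝ V / 2 = 0 by ring, Real.rpow_zero,
    one_mul, Real.sqrt_eq_rpow,
    ← Real.rpow_natCast, ← Real.rpow_mul (by norm_num)]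
  ring_nf

/-- Functions dominated by `exp (‖y‖² / 4)` are Gaussian integrable. -/
lemma integrable_of_le_exp_sq {f : V → ℝ} {C : ℝ}
    (hf : AEStronglyMeasurable f (stdGaussian V))
    (h : ∀ y, |f y| ≤ C * Real.exp (‖y‖ ^ 2 / 4)) : Integrable f (stdGaussian V) :=
  (integrable_exp_sq_div_four.const_mul C).mono' hf (Filter.Eventually.of_forall h)

/-- Gaussian tail bound with an exponential weight. -/
lemma setIntegral_exp_sq_le {b R : ℝ} (hb : b ≤ 1 / 4) (hR : 0 ≤ R) :
    ∫ y in {y : V | R < ‖y‖}, Real.exp (b * ‖y‖ ^ 2) ∂(stdGaussian V) ≤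
      Real.exp (-(1 / 4 - b) * R ^ 2) * Real.sqrt 2 ^ Module.finrank ℝ V := by
  have hms : MeasurableSet {y : V | R < ‖y‖} := measurableSet_lt (by fun_prop) (by fun_prop)
  have hdom : Integrable (fun y : V => Real.exp (-(1 / 4 - b) * R ^ 2) * Real.exp (‖y‖ ^ 2 / 4))
      (stdGaussian V) := integrable_exp_sq_div_four.const_mul _
  calc ∫ y in {y : V | R < ‖y‖}, Real.exp (b * ‖y‖ ^ 2) ∂(stdGaussian V)
      ≤ ∫ y in {y : V | R < ‖y‖}, Real.exp (-(1 / 4 - b) * R ^ 2) * Real.exp (‖y‖ ^ 2 / 4)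
          ∂(stdGaussian V) := by
        refine integral_mono_of_nonneg (Filter.Eventually.of_forall fun y => (Real.exp_pos _).le)
          hdom.integrableOn ?_
        filter_upwards [ae_restrict_mem hms] with y hy
        rw [← Real.exp_add]
        apply Real.exp_le_exp.2
        have : R ^ 2 ≤ ‖y‖ ^ 2 := pow_le_pow_left₀ hR (le_of_lt hy) 2
        nlinarith
    _ ≤ ∫ y : V, Real.exp (-(1 / 4 - b) * R ^ 2) * Real.exp (‖y‖ ^ 2 / 4)
          ∂(stdGaussian V) :=
        setIntegral_le_integral hdom (Filter.Eventually.of_forall fun y => by positivity)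
    _ = _ := by rw [integral_const_mul, integral_exp_sq_div_four]

lemma integral_comp_neg_stdGaussian (f : V → ℝ) :
    ∫ y, f (-y) ∂(stdGaussian V) = ∫ y, f y ∂(stdGaussian V) := by
  have h : MeasurePreserving (LinearIsometryEquiv.neg ℝ (E := V)) (stdGaussian V)
      (stdGaussian V) := ⟨by fun_prop, stdGaussian_map _⟩
  exact h.integral_comp
    (LinearIsometryEquiv.neg ℝ (E := V)).toHomeomorph.measurableEmbedding f

lemma integral_eq_zero_of_odd {f : V → ℝ} (hf : ∀ y, f (-y) = -f y) :
    ∫ y, f y ∂(stdGaussian V) = 0 := by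
  have h := integral_comp_neg_stdGaussian f
  simp_rw [hf, integral_neg] at h
  linarith

lemma integral_exp_dual (ℓ : StrongDual ℝ (V)) :
    ∫ y, Real.exp (ℓ y) ∂(stdGaussian V) = Real.exp (‖ℓ‖ ^ 2 / 2) := by
  have h := IsGaussian.map_eq_gaussianReal (μ := stdGaussian V) ℓ
  rw [variance_dual_stdGaussian, integral_strongDual_stdGaussian] at h
  have h2 := mgf_gaussianReal h 1
  simpa [mgf] using h2

/-- Exponential of the norm is Gaussian integrable. -/
lemma exp_mul_norm_le (c : ℝ) (y : V) :
    Real.exp (c * ‖y‖) ≤ Real.exp (c ^ 2) * Real.exp (‖y‖ ^ 2 / 4) := by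
  rw [← Real.exp_add]
  apply Real.exp_le_exp.2
  nlinarith [sq_nonneg (c - ‖y‖ / 2)]

lemma integrable_exp_mul_norm (c : ℝ) :
    Integrable (fun y : V => Real.exp (c * ‖y‖)) (stdGaussian V) :=
  integrable_of_le_exp_sq (by fun_prop) fun y => by
    rw [abs_of_pos (Real.exp_pos _)]; exact exp_mul_norm_le c y

end

section

variable {V : Type*} [NormedAddCommGroup V] [InnerProductSpace ℝ V] [FiniteDimensional ℝ V]
  [MeasurableSpace V] [BorelSpace V]

/-! ### Gaussian concentration for odd functions with bounded gradient -/

lemma measurePreserving_rotation (θ : ℝ) :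
    MeasurePreserving (ContinuousLinearMap.rotation (E := V) θ)
      ((stdGaussian V).prod (stdGaussian V))
      ((stdGaussian V).prod (stdGaussian V)) :=
  ⟨by fun_prop, IsGaussian.map_rotation_eq_self integral_id_stdGaussian θ⟩

/-- The θ-derivative of the first rotated component is the second rotated component, which is what
lets rotation invariance be used after the chain rule. -/
lemma hasDerivAt_rotation_fst {F : V → ℝ} (hF : ContDiff ℝ 1 F) (p : V × V) (θ : ℝ) :
    HasDerivAt (fun θ => F (ContinuousLinearMap.rotation θ p).1)
      (fderiv ℝ F (ContinuousLinearMap.rotation θ p).1 (ContinuousLinearMap.rotation θ p).2) θ := by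
  have h1 : HasDerivAt (fun θ : ℝ => Real.cos θ • p.1 + Real.sin θ • p.2)
      (-Real.sin θ • p.1 + Real.cos θ • p.2) θ :=
    ((Real.hasDerivAt_cos θ).smul_const p.1).add ((Real.hasDerivAt_sin θ).smul_const p.2)
  have h2 := (hF.differentiable one_ne_zero (Real.cos θ • p.1 + Real.sin θ • p.2)).hasFDerivAt
  exact h2.comp_hasDerivAt θ h1

/-- The uniform probability measure on `(0, π/2]`. -/
def arcMeasure : Measure ℝ :=
  ENNReal.ofReal (2 / Real.pi) • volume.restrict (Set.Ioc 0 (Real.pi / 2))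

instance : IsProbabilityMeasure arcMeasure := by
  constructor
  simp only [arcMeasure, Measure.smul_apply, Measure.restrict_apply MeasurableSet.univ,
    Set.univ_inter, Real.volume_Ioc, sub_zero, smul_eq_mul]
  rw [← ENNReal.ofReal_mul (by positivity)]
  have : 2 / Real.pi * (Real.pi / 2) = 1 := by field_simp
  simp [this]

lemma integral_arcMeasure (f : ℝ → ℝ) :
    ∫ θ, f θ ∂arcMeasure = 2 / Real.pi * ∫ θ in (0)..(Real.pi / 2), f θ := by
  rw [arcMeasure, integral_smul_measure, intervalIntegral.integral_of_le (by positivity),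
    ENNReal.toReal_ofReal (by positivity), smul_eq_mul]

lemma norm_rotation_snd_le (θ : ℝ) (p : V × V) :
    ‖(ContinuousLinearMap.rotation θ p).2‖ ≤ ‖p.1‖ + ‖p.2‖ := by
  rw [ContinuousLinearMap.rotation_apply]
  refine (norm_add_le _ _).trans (add_le_add ?_ ?_)
  · rw [norm_smul, norm_neg]
    exact mul_le_of_le_one_left (norm_nonneg _) (Real.abs_sin_le_one θ)
  · rw [norm_smul]
    exact mul_le_of_le_one_left (norm_nonneg _) (Real.abs_cos_le_one θ)

lemma continuous_rotation_uncurry :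
    Continuous fun q : (V × V) × ℝ => ContinuousLinearMap.rotation q.2 q.1 := by
  simp only [ContinuousLinearMap.rotation_apply]
  fun_prop

/-- The first component runs from p.1 at θ = 0 to p.2 at θ = π/2, so the increment of F is the
integral of its derivative along the arc. Jensen for the uniform measure moves the exponential
inside, and the length of the arc produces the factor π/2. -/
lemma exp_sub_le_integral_arcMeasure {F : V → ℝ} (hF : ContDiff ℝ 1 F) (p : V × V) :
    Real.exp (F p.2 - F p.1) ≤ ∫ θ, Real.exp (Real.pi / 2 *
      fderiv ℝ F (ContinuousLinearMap.rotation θ p).1 (ContinuousLinearMap.rotation θ p).2)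
      ∂arcMeasure := by
  set Φ : V × V → ℝ := fun p => fderiv ℝ F p.1 p.2 with hΦ
  have hΦc : Continuous Φ :=
    ((hF.continuous_fderiv one_ne_zero).comp continuous_fst).clm_apply continuous_snd
  change _ ≤ ∫ θ, Real.exp (Real.pi / 2 * Φ (ContinuousLinearMap.rotation θ p)) ∂arcMeasure
  have hc : Continuous fun θ : ℝ => Φ (ContinuousLinearMap.rotation θ p) :=
    hΦc.comp (g := Φ) (f := fun θ : ℝ => ContinuousLinearMap.rotation θ p) (by
      simp only [ContinuousLinearMap.rotation_apply]; fun_prop)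
  have hftc : ∫ θ in (0)..(Real.pi / 2), Φ (ContinuousLinearMap.rotation θ p) =
      F p.2 - F p.1 := by
    rw [intervalIntegral.integral_eq_sub_of_hasDerivAt
      (fun θ _ => hasDerivAt_rotation_fst hF p θ) (hc.intervalIntegrable _ _)]
    simp [ContinuousLinearMap.rotation_apply]
  have h1 : ∫ θ, Real.pi / 2 * Φ (ContinuousLinearMap.rotation θ p) ∂arcMeasure =
      F p.2 - F p.1 := by
    rw [integral_const_mul, integral_arcMeasure, hftc]
    field_simp
  have hi : ∀ f : ℝ → ℝ, Continuous f → Integrable f arcMeasure := fun f hf =>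
    Integrable.smul_measure ((hf.intervalIntegrable 0 (Real.pi / 2)).1) (by simp)
  rw [← h1]
  exact convexOn_exp.map_integral_le Real.continuous_exp.continuousOn isClosed_univ
    (Filter.Eventually.of_forall fun _ => Set.mem_univ _)
    (hi _ (continuous_const.mul hc)) (hi _ (Real.continuous_exp.comp (continuous_const.mul hc)))

/-- Rotation invariance of the product Gaussian removes θ. With the first variable frozen, what
remains is a linear form in an independent Gaussian vector, whose exponential moment is explicit. -/
lemma integral_exp_rotation_le {F : V → ℝ} {L : ℝ} (hF : ContDiff ℝ 1 F)
    (hL : ∀ y, ‖fderiv ℝ F y‖ ≤ L) (θ : ℝ) :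
    ∫ p, Real.exp (Real.pi / 2 *
      fderiv ℝ F (ContinuousLinearMap.rotation θ p).1 (ContinuousLinearMap.rotation θ p).2)
      ∂((stdGaussian V).prod (stdGaussian V)) ≤ Real.exp (Real.pi ^ 2 * L ^ 2 / 8) := by
  set γ := stdGaussian V
  set Φ : V × V → ℝ := fun p => fderiv ℝ F p.1 p.2 with hΦ
  have hΦc : Continuous Φ :=
    ((hF.continuous_fderiv one_ne_zero).comp continuous_fst).clm_apply continuous_snd
  have hΦle : ∀ p, |Φ p| ≤ L * ‖p.2‖ := fun p =>
    ((fderiv ℝ F p.1).le_opNorm p.2).trans (mul_le_mul_of_nonneg_right (hL _) (norm_nonneg _))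
  change ∫ p, Real.exp (Real.pi / 2 * Φ (ContinuousLinearMap.rotation θ p)) ∂(γ.prod γ) ≤ _
  have hc1 : Continuous fun p => Real.exp (Real.pi / 2 * Φ p) :=
    Real.continuous_exp.comp (continuous_const.mul hΦc)
  have h1 : ∫ p, Real.exp (Real.pi / 2 * Φ (ContinuousLinearMap.rotation θ p)) ∂(γ.prod γ) =
      ∫ p, Real.exp (Real.pi / 2 * Φ p) ∂(γ.prod γ) := by
    have h2 := (measurePreserving_rotation (V := V) θ).map_eq
    conv_rhs => rw [← h2]
    rw [integral_map (by fun_prop) hc1.aestronglyMeasurable]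
  have hi1 : Integrable (fun p => Real.exp (Real.pi / 2 * Φ p)) (γ.prod γ) := by
    refine ((integrable_exp_mul_norm (V := V) 0).mul_prod
      (integrable_exp_mul_norm (Real.pi / 2 * L))).mono' hc1.aestronglyMeasurable
      (Filter.Eventually.of_forall fun p => ?_)
    rw [Real.norm_eq_abs, abs_of_pos (Real.exp_pos _), ← Real.exp_add]
    apply Real.exp_le_exp.2
    have h3 : 0 ≤ Real.pi / 2 := by positivity
    nlinarith [mul_le_mul_of_nonneg_left (abs_le.1 (hΦle p)).2 h3]
  rw [h1, integral_prod _ hi1]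
  have h4 : ∀ x, ∫ z, Real.exp (Real.pi / 2 * Φ (x, z)) ∂γ ≤
      Real.exp (Real.pi ^ 2 * L ^ 2 / 8) := by
    intro x
    have h5 := integral_exp_dual ((Real.pi / 2) • fderiv ℝ F x)
    simp only [smul_apply, smul_eq_mul] at h5
    simp only [hΦ]
    rw [h5]
    apply Real.exp_le_exp.2
    rw [norm_smul, mul_pow, Real.norm_eq_abs, sq_abs]
    have h6 := pow_le_pow_left₀ (norm_nonneg _) (hL x) 2
    nlinarith [mul_le_mul_of_nonneg_left h6 (sq_nonneg Real.pi)]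
  calc _ ≤ ∫ _x : V, Real.exp (Real.pi ^ 2 * L ^ 2 / 8) ∂γ :=
        integral_mono hi1.integral_prod_left (integrable_const _) h4
    _ = _ := by simp

/-- Maurey–Pisier: exponential moment of an odd function with bounded gradient. -/
theorem integral_exp_le_of_odd {F : V → ℝ} {L : ℝ} (hF : ContDiff ℝ 1 F)
    (hodd : ∀ y, F (-y) = -F y) (hL : ∀ y, ‖fderiv ℝ F y‖ ≤ L) :
    ∫ y, Real.exp (F y) ∂(stdGaussian V) ≤ Real.exp (Real.pi ^ 2 * L ^ 2 / 16) := by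
  set γ := stdGaussian V
  have hL0 : 0 ≤ L := (norm_nonneg _).trans (hL 0)
  have hFc : Continuous F := hF.continuous
  have hF' : Continuous (fderiv ℝ F) := hF.continuous_fderiv one_ne_zero
  set Φ : V × V → ℝ := fun p => fderiv ℝ F p.1 p.2 with hΦ
  have hΦc : Continuous Φ := by
    exact (hF'.comp continuous_fst).clm_apply continuous_snd
  have hΦle : ∀ p, |Φ p| ≤ L * ‖p.2‖ := fun p =>
    ((fderiv ℝ F p.1).le_opNorm p.2).trans (mul_le_mul_of_nonneg_right (hL _) (norm_nonneg _))
  -- the symmetrized exponential moment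
  have hsymm : ∫ p, Real.exp (F p.2 - F p.1) ∂(γ.prod γ) = (∫ y, Real.exp (F y) ∂γ) ^ 2 := by
    have h1 : ∫ y, Real.exp (-F y) ∂γ = ∫ y, Real.exp (F y) ∂γ := by
      rw [← integral_comp_neg_stdGaussian (fun y => Real.exp (F y))]
      simp_rw [hodd]; rfl
    have h2 := integral_prod_mul (μ := γ) (ν := γ) (fun y => Real.exp (-F y))
      (fun y => Real.exp (F y))
    rw [h1, ← pow_two] at h2
    rw [← h2]
    refine integral_congr_ae (Filter.Eventually.of_forall fun p => ?_)
    simp only [← Real.exp_add]; ring_nf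
  have hker : ∀ (p : V × V) (θ : ℝ),
      Real.exp (Real.pi / 2 * Φ (ContinuousLinearMap.rotation θ p)) ≤
        Real.exp (Real.pi / 2 * L * ‖p.1‖) * Real.exp (Real.pi / 2 * L * ‖p.2‖) := by
    intro p θ
    rw [← Real.exp_add]
    apply Real.exp_le_exp.2
    have h1 := (abs_le.1 (hΦle (ContinuousLinearMap.rotation θ p))).2
    have h2 := mul_le_mul_of_nonneg_left (norm_rotation_snd_le θ p) hL0
    have h3 : 0 ≤ Real.pi / 2 := by positivity
    nlinarith [mul_le_mul_of_nonneg_left (h1.trans h2) h3]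
  have hcont : Continuous fun q : (V × V) × ℝ =>
      Real.exp (Real.pi / 2 * Φ (ContinuousLinearMap.rotation q.2 q.1)) :=
    Real.continuous_exp.comp (continuous_const.mul (hΦc.comp continuous_rotation_uncurry))
  have hint : Integrable (fun q : (V × V) × ℝ =>
      Real.exp (Real.pi / 2 * Φ (ContinuousLinearMap.rotation q.2 q.1)))
      ((γ.prod γ).prod arcMeasure) := by
    have hb : Integrable (fun p : V × V =>
        Real.exp (Real.pi / 2 * L * ‖p.1‖) * Real.exp (Real.pi / 2 * L * ‖p.2‖)) (γ.prod γ) :=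
      (integrable_exp_mul_norm _).mul_prod (integrable_exp_mul_norm _)
    refine (hb.comp_fst arcMeasure).mono' hcont.aestronglyMeasurable
      (Filter.Eventually.of_forall fun q => ?_)
    rw [Real.norm_eq_abs, abs_of_pos (Real.exp_pos _)]
    exact hker q.1 q.2
  have hjensen := exp_sub_le_integral_arcMeasure hF
  have hrot := integral_exp_rotation_le hF hL
  -- By oddness the symmetrized moment is a perfect square, so the exponent π²L²/8 is halved on
  -- taking the root.
  have hfinal : (∫ y, Real.exp (F y) ∂γ) ^ 2 ≤ Real.exp (Real.pi ^ 2 * L ^ 2 / 16) ^ 2 := by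
    calc (∫ y, Real.exp (F y) ∂γ) ^ 2 = ∫ p, Real.exp (F p.2 - F p.1) ∂(γ.prod γ) := hsymm.symm
      _ ≤ ∫ p, ∫ θ, Real.exp (Real.pi / 2 * Φ (ContinuousLinearMap.rotation θ p)) ∂arcMeasure
            ∂(γ.prod γ) := by
          refine integral_mono_of_nonneg (Filter.Eventually.of_forall fun p => (Real.exp_pos _).le)
            hint.integral_prod_left (Filter.Eventually.of_forall hjensen)
      _ = ∫ θ, ∫ p, Real.exp (Real.pi / 2 * Φ (ContinuousLinearMap.rotation θ p)) ∂(γ.prod γ)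
            ∂arcMeasure := integral_integral_swap hint
      _ ≤ ∫ _θ, Real.exp (Real.pi ^ 2 * L ^ 2 / 8) ∂arcMeasure :=
          integral_mono hint.integral_prod_right (integrable_const _) hrot
      _ = Real.exp (Real.pi ^ 2 * L ^ 2 / 16) ^ 2 := by
          rw [← Real.exp_nat_mul]; simp; ring
  exact le_of_sq_le_sq hfinal (Real.exp_pos _).le

end

section

variable {V : Type*} [NormedAddCommGroup V] [InnerProductSpace ℝ V] [FiniteDimensional ℝ V]
  [MeasurableSpace V] [BorelSpace V]
  {ι : Type*} [Fintype ι] (b : OrthonormalBasis ι ℝ V)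

/-! ### Gaussian moments of cubic forms -/

/-- Continuous functions of polynomial growth. -/
def PolyGrowth (f : V → ℝ) : Prop :=
  Continuous f ∧ ∃ (C : ℝ) (k : ℕ), ∀ y, |f y| ≤ C * (1 + ‖y‖) ^ k

lemma PolyGrowth.integrable {f : V → ℝ} (hf : PolyGrowth f) :
    Integrable f (stdGaussian V) := by
  obtain ⟨hc, C, k, hk⟩ := hf
  have hC : 0 ≤ C := by
    have := (abs_nonneg _).trans (hk 0)
    simpa using this
  refine integrable_of_le_exp_sq (C := C * (k.factorial * Real.exp 1 * Real.exp 1))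
    hc.aestronglyMeasurable fun y => (hk y).trans ?_
  have h1 := Real.pow_div_factorial_le_exp (1 + ‖y‖) (by positivity) k
  rw [div_le_iff₀ (by positivity), Real.exp_add] at h1
  have h2 := exp_mul_norm_le 1 y
  simp only [one_mul, one_pow] at h2
  rw [mul_assoc C]
  refine mul_le_mul_of_nonneg_left (h1.trans ?_) hC
  calc Real.exp 1 * Real.exp ‖y‖ * k.factorial
      ≤ Real.exp 1 * (Real.exp 1 * Real.exp (‖y‖ ^ 2 / 4)) * k.factorial := by gcongr
    _ = _ := by ring

lemma PolyGrowth.mul {f g : V → ℝ} (hf : PolyGrowth f) (hg : PolyGrowth g) :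
    PolyGrowth fun y => f y * g y := by
  obtain ⟨hfc, C, k, hk⟩ := hf
  obtain ⟨hgc, D, l, hl⟩ := hg
  refine ⟨hfc.mul hgc, C * D, k + l, fun y => ?_⟩
  rw [abs_mul]
  calc |f y| * |g y| ≤ (C * (1 + ‖y‖) ^ k) * (D * (1 + ‖y‖) ^ l) :=
        mul_le_mul (hk y) (hl y) (abs_nonneg _) ((abs_nonneg _).trans (hk y))
    _ = _ := by ring

lemma PolyGrowth.add {f g : V → ℝ} (hf : PolyGrowth f) (hg : PolyGrowth g) :
    PolyGrowth fun y => f y + g y := by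
  obtain ⟨hfc, C, k, hk⟩ := hf
  obtain ⟨hgc, D, l, hl⟩ := hg
  have hC : 0 ≤ C := by simpa using (abs_nonneg _).trans (hk 0)
  have hD : 0 ≤ D := by simpa using (abs_nonneg _).trans (hl 0)
  refine ⟨hfc.add hgc, C + D, k + l, fun y => (abs_add_le _ _).trans ?_⟩
  have h1 : (1 : ℝ) ≤ 1 + ‖y‖ := by linarith [norm_nonneg y]
  rw [add_mul]
  refine add_le_add ((hk y).trans ?_) ((hl y).trans ?_)
  · exact mul_le_mul_of_nonneg_left (pow_le_pow_right₀ h1 (by omega)) hC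
  · exact mul_le_mul_of_nonneg_left (pow_le_pow_right₀ h1 (by omega)) hD

lemma PolyGrowth.const (c : ℝ) : PolyGrowth fun _ : V => c :=
  ⟨continuous_const, |c|, 0, fun y => by simp⟩

lemma PolyGrowth.const_mul {f : V → ℝ} (hf : PolyGrowth f) (c : ℝ) :
    PolyGrowth fun y => c * f y :=
  (PolyGrowth.const c).mul hf

lemma PolyGrowth.clm (ℓ : V →L[ℝ] ℝ) : PolyGrowth fun y => ℓ y :=
  ⟨ℓ.continuous, ‖ℓ‖, 1, fun y => (ℓ.le_opNorm y).trans (by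
    rw [pow_one]; exact mul_le_mul_of_nonneg_left (by linarith) (norm_nonneg _))⟩

lemma PolyGrowth.bilin (B : V →L[ℝ] V →L[ℝ] ℝ) : PolyGrowth fun y => B y y := by
  refine ⟨by fun_prop, ‖B‖, 2, fun y => (B.le_opNorm₂ y y).trans ?_⟩
  have h0 : 0 ≤ ‖B‖ := norm_nonneg B
  have h1 : ‖y‖ * ‖y‖ ≤ (1 + ‖y‖) ^ 2 := by nlinarith [norm_nonneg y]
  rw [mul_assoc]
  exact mul_le_mul_of_nonneg_left h1 h0

lemma PolyGrowth.trilin (L : V →L[ℝ] V →L[ℝ] V →L[ℝ] ℝ) : PolyGrowth fun y => L y y y := by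
  refine ⟨by fun_prop, ‖L‖, 3, fun y => ((L y).le_opNorm₂ y y).trans ?_⟩
  have h0 : 0 ≤ ‖L‖ := norm_nonneg L
  have h1 : ‖y‖ ^ 3 ≤ (1 + ‖y‖) ^ 3 := pow_le_pow_left₀ (norm_nonneg y) (by linarith) 3
  have h2 : ‖L y‖ ≤ ‖L‖ * ‖y‖ := L.le_opNorm y
  calc ‖L y‖ * ‖y‖ * ‖y‖ ≤ ‖L‖ * ‖y‖ * ‖y‖ * ‖y‖ := by gcongr
    _ = ‖L‖ * ‖y‖ ^ 3 := by ring
    _ ≤ _ := mul_le_mul_of_nonneg_left h1 h0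

lemma hasFDerivAt_gaussDensity (y : V) :
    HasFDerivAt gaussDensity (-(gaussDensity y) • innerSL ℝ y) y := by
  have h1 : HasFDerivAt (fun y : V => ‖y‖ ^ 2) (2 • innerSL ℝ y) y :=
    (hasStrictFDerivAt_norm_sq y).hasFDerivAt
  have h2 := ((h1.const_mul (-(1 / 2))).exp).const_mul
    ((2 * Real.pi) ^ (-(Module.finrank ℝ V : ℝ) / 2))
  refine h2.congr_fderiv ?_
  ext z
  simp [gaussDensity]
  ring

/-- Stein's identity. -/
lemma integral_inner_mul {F : V → ℝ} {F' : V → V →L[ℝ] ℝ}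
    (hF : ∀ y, HasFDerivAt F (F' y) y) (v : V)
    (h1 : PolyGrowth F) (h2 : PolyGrowth fun y => F' y v) :
    ∫ y, inner ℝ v y * F y ∂(stdGaussian V) = ∫ y, F' y v ∂(stdGaussian V) := by
  have hcoord : PolyGrowth fun y : V => inner ℝ v y := PolyGrowth.clm (innerSL ℝ v)
  have hfd : ∀ y : V, fderiv ℝ gaussDensity y v = -(gaussDensity y * inner ℝ v y) := fun y => by
    rw [(hasFDerivAt_gaussDensity y).fderiv]
    simp [real_inner_comm]
  have hFd : ∀ y, fderiv ℝ F y = F' y := fun y => (hF y).fderiv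
  have ibp := integral_mul_fderiv_eq_neg_fderiv_mul_of_integrable (μ := (volume : Measure V))
    (f := F) (g := gaussDensity) (v := v)
    (by
      refine ((integrable_stdGaussian_iff _).1 h2.integrable).congr
        (Filter.Eventually.of_forall fun y => ?_)
      simp only [hFd]; ring)
    (by
      refine ((integrable_stdGaussian_iff _).1 ((hcoord.mul h1).integrable.neg)).congr
        (Filter.Eventually.of_forall fun y => ?_)
      simp only [hfd, Pi.neg_apply]; ring)
    (by
      refine ((integrable_stdGaussian_iff _).1 h1.integrable).congr
        (Filter.Eventually.of_forall fun y => ?_)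
      simp only; ring)
    (fun y _ => (hF y).differentiableAt)
    (fun y _ => (hasFDerivAt_gaussDensity y).differentiableAt)
  rw [integral_stdGaussian, integral_stdGaussian]
  simp only [hfd, hFd, mul_neg, integral_neg, neg_inj] at ibp
  calc _ = ∫ y, F y * (gaussDensity y * inner ℝ v y) := by congr 1; ext y; ring
    _ = _ := ibp
    _ = _ := by congr 1; ext y; ring

lemma clm_eq_sum {X : Type*} [AddCommGroup X] [Module ℝ X] [TopologicalSpace X]
    (ℓ : V →L[ℝ] X) (y : V) : ℓ y = ∑ i, inner ℝ (b i) y • ℓ (b i) := by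
  conv_lhs => rw [← b.sum_repr' y]
  simp

lemma PolyGrowth.inner (v : V) : PolyGrowth fun y : V => inner ℝ v y :=
  PolyGrowth.clm (innerSL ℝ v)

lemma PolyGrowth.congr {f g : V → ℝ} (hf : PolyGrowth f) (h : ∀ y, g y = f y) : PolyGrowth g := by
  rwa [funext h]

lemma integral_clm_mul {F : V → ℝ} {F' : V → V →L[ℝ] ℝ}
    (hF : ∀ y, HasFDerivAt F (F' y) y) (ℓ : V →L[ℝ] ℝ)
    (h1 : PolyGrowth F) (h2 : ∀ v, PolyGrowth fun y => F' y v) :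
    ∫ y, ℓ y * F y ∂(stdGaussian V) =
      ∑ i, ℓ (b i) * ∫ y, F' y (b i) ∂(stdGaussian V) := by
  have : ∀ y, ℓ y * F y = ∑ i, ℓ (b i) * (inner ℝ (b i) y * F y) := fun y => by
    rw [clm_eq_sum b ℓ y, Finset.sum_mul]
    exact Finset.sum_congr rfl fun i _ => by simp only [smul_eq_mul]; ring
  simp_rw [this]
  rw [integral_finsetSum _ fun i _ => ((((PolyGrowth.inner (b i)).mul h1).const_mul _).integrable)]
  refine Finset.sum_congr rfl fun i _ => ?_
  rw [integral_const_mul, integral_inner_mul hF (b i) h1 (h2 _)]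

lemma integral_clm_mul_clm (ℓ m : V →L[ℝ] ℝ) :
    ∫ y, ℓ y * m y ∂(stdGaussian V) = ∑ i, ℓ (b i) * m (b i) := by
  rw [integral_clm_mul b (F' := fun _ => m) (fun y => m.hasFDerivAt) ℓ (PolyGrowth.clm m)
    (fun v => PolyGrowth.const _)]
  simp

lemma hasFDerivAt_bilin (B : V →L[ℝ] V →L[ℝ] ℝ) (y : V) :
    HasFDerivAt (fun y => B y y) (B.flip y + B y) y := by
  have h := B.hasFDerivAt (x := y) |>.clm_apply (hasFDerivAt_id (𝕜 := ℝ) y)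
  refine h.congr_fderiv ?_
  ext z; simp [add_comm]

lemma integral_bilin (B : V →L[ℝ] V →L[ℝ] ℝ) :
    ∫ y, B y y ∂(stdGaussian V) = ∑ i, B (b i) (b i) := by
  have h : ∀ y, B y y = ∑ i, inner ℝ (b i) y * B (b i) y := fun y => by
    conv_lhs => rw [clm_eq_sum b B y]
    simp
  rw [funext h]
  rw [integral_finsetSum _ fun i _ =>
    (((PolyGrowth.inner (b i)).mul (PolyGrowth.clm _)).integrable)]
  refine Finset.sum_congr rfl fun i _ => ?_
  rw [integral_inner_mul (F' := fun _ => B (b i)) (fun y => (B (b i)).hasFDerivAt) (b i)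
    (PolyGrowth.clm _) (PolyGrowth.const _)]
  simp

/-- Second moment of a symmetric quadratic form. -/
lemma integral_bilin_sq (B : V →L[ℝ] V →L[ℝ] ℝ) (hB : ∀ a b, B a b = B b a) :
    ∫ y, B y y ^ 2 ∂(stdGaussian V) =
      2 * ∑ i, ∑ j, B (b i) (b j) ^ 2 + (∑ i, B (b i) (b i)) ^ 2 := by
  have h : ∀ y, B y y ^ 2 = ∑ i, inner ℝ (b i) y * (B (b i) y * B y y) := fun y => by
    rw [pow_two]
    conv_lhs => enter [1]; rw [clm_eq_sum b B y]
    simp [Finset.sum_mul, mul_assoc]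
  have hpg : ∀ i, PolyGrowth fun y => B (b i) y * B y y := fun i =>
    (PolyGrowth.clm _).mul (PolyGrowth.bilin B)
  have hder : ∀ i y, HasFDerivAt (fun y => B (b i) y * B y y)
      (B (b i) y • (B.flip y + B y) + B y y • B (b i)) y := fun i y =>
    (B (b i)).hasFDerivAt.mul (hasFDerivAt_bilin B y)
  have hval : ∀ i y, (B (b i) y • (B.flip y + B y) + B y y • B (b i)) (b i) =
      2 * (B (b i) y * B (b i) y) + B (b i) (b i) * B y y := fun i y => by
    simp [hB y (b i)]; ring
  have p1 : ∀ i, PolyGrowth fun y => 2 * (B (b i) y * B (b i) y) := fun i =>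
    ((PolyGrowth.clm (B (b i))).mul (PolyGrowth.clm (B (b i)))).const_mul 2
  have p2 : ∀ i, PolyGrowth fun y => B (b i) (b i) * B y y := fun i =>
    (PolyGrowth.bilin B).const_mul _
  simp_rw [h]
  rw [integral_finsetSum _ fun i _ => (((PolyGrowth.inner (b i)).mul (hpg i)).integrable)]
  have hterm : ∀ i, ∫ y, inner ℝ (b i) y * (B (b i) y * B y y) ∂(stdGaussian V) =
      2 * ∑ j, B (b i) (b j) ^ 2 +
        B (b i) (b i) * ∑ j, B (b j) (b j) := fun i => by
    rw [integral_inner_mul (hder i) (b i) (hpg i) (((p1 i).add (p2 i)).congr (hval i))]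
    simp_rw [hval]
    rw [integral_add (p1 i).integrable (p2 i).integrable, integral_const_mul, integral_const_mul,
      integral_bilin b, integral_clm_mul_clm b]
    simp_rw [pow_two]
  simp_rw [hterm]
  rw [Finset.sum_add_distrib, ← Finset.mul_sum, ← Finset.sum_mul, pow_two (∑ i, B _ _)]

/-- A trilinear form is symmetric. -/
structure IsSymmTrilin (L : V →L[ℝ] V →L[ℝ] V →L[ℝ] ℝ) : Prop where
  swap_left : ∀ a b c, L a b c = L b a c
  swap_right : ∀ a b c, L a b c = L a c b

variable {L : V →L[ℝ] V →L[ℝ] V →L[ℝ] ℝ}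

lemma hasFDerivAt_trilin (hL : IsSymmTrilin L) (y : V) :
    HasFDerivAt (fun y => L y y y) ((3 : ℝ) • L y y) y := by
  have h := (L.hasFDerivAt (x := y) |>.clm_apply (hasFDerivAt_id (𝕜 := ℝ) y)).clm_apply
    (hasFDerivAt_id (𝕜 := ℝ) y)
  refine h.congr_fderiv ?_
  ext z
  simp [hL.swap_left z y y, hL.swap_right y z y]
  ring

/-- Second moment of a symmetric cubic form. -/
theorem integral_trilin_sq (hL : IsSymmTrilin L) :
    ∫ y, L y y y ^ 2 ∂(stdGaussian V) =
      6 * ∑ i, ∑ j, ∑ k, L (b i) (b j) (b k) ^ 2 +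
        9 * ∑ i, (∑ j, L (b i) (b j) (b j)) ^ 2 := by
  set e : ι → V := fun i => b i with he
  -- Peel one linear factor off one copy of the cubic form and integrate by parts against it; this
  -- leaves the square of a quadratic form and a linear form times a cubic one (`hlin`).
  have h : ∀ y, L y y y ^ 2 = ∑ i, inner ℝ (b i) y * (L (e i) y y * L y y y) := fun y => by
    rw [pow_two]
    conv_lhs => enter [1]; rw [clm_eq_sum b L y]
    simp [Finset.sum_mul, mul_assoc, he]
  have hpg : ∀ i, PolyGrowth fun y => L (e i) y y * L y y y := fun i =>
    (PolyGrowth.bilin (L (e i))).mul (PolyGrowth.trilin L)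
  have hder : ∀ i y, HasFDerivAt (fun y => L (e i) y y * L y y y)
      (L (e i) y y • ((3 : ℝ) • L y y) + L y y y • ((L (e i)).flip y + L (e i) y)) y := fun i y =>
    (hasFDerivAt_bilin (L (e i)) y).mul (hasFDerivAt_trilin hL y)
  have hval : ∀ i y, (L (e i) y y • ((3 : ℝ) • L y y) +
      L y y y • ((L (e i)).flip y + L (e i) y)) (e i) =
      3 * (L (e i) y y ^ 2) + 2 * (L (e i) (e i) y * L y y y) := fun i y => by
    simp [hL.swap_right (e i) y (e i), hL.swap_right y y (e i), hL.swap_left y (e i) y]; ring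
  have p1 : ∀ i, PolyGrowth fun y => 3 * (L (e i) y y ^ 2) := fun i =>
    (((PolyGrowth.bilin (L (e i))).mul (PolyGrowth.bilin (L (e i)))).const_mul 3).congr
      fun y => by ring
  have p0 : ∀ ℓ : V →L[ℝ] ℝ, PolyGrowth fun y => ℓ y * L y y y := fun ℓ =>
    (PolyGrowth.clm ℓ).mul (PolyGrowth.trilin L)
  simp_rw [h]
  rw [integral_finsetSum _ fun i _ => (((PolyGrowth.inner (b i)).mul (hpg i)).integrable)]
  have hlin : ∀ ℓ : V →L[ℝ] ℝ, ∫ y, ℓ y * L y y y ∂(stdGaussian V) =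
      3 * ∑ i, ℓ (e i) * ∑ j, L (e i) (e j) (e j) := fun ℓ => by
    have hv : ∀ y v, ((3 : ℝ) • L y y) v = 3 * L v y y := fun y v => by
      simp [hL.swap_left v y y, hL.swap_right y v y]
    rw [integral_clm_mul b (hasFDerivAt_trilin hL) ℓ (PolyGrowth.trilin L) (fun v =>
      ((PolyGrowth.bilin (L v)).const_mul 3).congr fun y => hv y v)]
    simp_rw [hv, integral_const_mul, integral_bilin b]
    rw [Finset.mul_sum]
    exact Finset.sum_congr rfl fun i _ => by simp only [he]; ring
  have hterm : ∀ i, ∫ y, inner ℝ (b i) y * (L (e i) y y * L y y y) ∂(stdGaussian V) =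
      6 * (∑ j, ∑ k, L (e i) (e j) (e k) ^ 2) + 3 * (∑ j, L (e i) (e j) (e j)) ^ 2 +
        6 * ∑ k, L (e i) (e i) (e k) * ∑ j, L (e k) (e j) (e j) := fun i => by
    rw [integral_inner_mul (hder i) (b i) (hpg i)
      (((p1 i).add ((p0 (L (e i) (e i))).const_mul 2)).congr (hval i))]
    change ∫ y, (L (e i) y y • ((3 : ℝ) • L y y) +
      L y y y • ((L (e i)).flip y + L (e i) y)) (e i) ∂(stdGaussian V) = _
    simp_rw [hval]
    rw [integral_add (p1 i).integrable ((p0 (L (e i) (e i))).const_mul 2).integrable,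
      integral_const_mul, integral_const_mul, hlin,
      integral_bilin_sq b _ (hL.swap_right (e i))]
    ring
  simp_rw [hterm]
  rw [Finset.sum_add_distrib, Finset.sum_add_distrib, ← Finset.mul_sum, ← Finset.mul_sum,
    ← Finset.mul_sum]
  -- Symmetry moves the repeated index to the last two slots; these 6 squared traces join the 3
  -- already present to make 9.
  have hlast : ∑ i, ∑ k, L (e i) (e i) (e k) * ∑ j, L (e k) (e j) (e j) =
      ∑ i, (∑ j, L (e i) (e j) (e j)) ^ 2 := by
    rw [Finset.sum_comm]
    refine Finset.sum_congr rfl fun k _ => ?_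
    rw [← Finset.sum_mul, pow_two]
    congr 1
    refine Finset.sum_congr rfl fun i _ => ?_
    rw [hL.swap_right, hL.swap_left]
  rw [hlast]
  ring

end

section

variable {V : Type*} [NormedAddCommGroup V] [InnerProductSpace ℝ V] [FiniteDimensional ℝ V]
  [MeasurableSpace V] [BorelSpace V]

/-! ### Cubic forms and their cutoffs -/

variable {L : V →L[ℝ] V →L[ℝ] V →L[ℝ] ℝ}

/-- Polarization bound for symmetric cubic forms. -/
lemma IsSymmTrilin.abs_apply_le (hL : IsSymmTrilin L) {M : ℝ} (hM : ∀ u, |L u u u| ≤ M * ‖u‖ ^ 3)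
    (y z : V) : |L y y z| ≤ 3 * M * ‖y‖ ^ 2 * ‖z‖ := by
  rcases eq_or_ne z 0 with rfl | hz
  · simp
  rcases eq_or_ne y 0 with rfl | hy
  · simp
  have hz' : 0 < ‖z‖ := norm_pos_iff.2 hz
  have hy' : 0 < ‖y‖ := norm_pos_iff.2 hy
  -- Rescaling z to the norm of y balances the terms of the polarization identity `key`, which then
  -- gives (8 + 8 + 2)M/6 = 3M.
  set t : ℝ := ‖y‖ / ‖z‖ with ht
  have htp : 0 < t := by positivity
  set x : V := t • z with hx
  have hxn : ‖x‖ = ‖y‖ := by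
    rw [hx, norm_smul, Real.norm_of_nonneg htp.le, ht]; field_simp
  have hM0 : 0 ≤ M := by
    have h1 := (abs_nonneg _).trans (hM y)
    exact nonneg_of_mul_nonneg_left h1 (by positivity)
  have key : 6 * L y y x = L (y + x) (y + x) (y + x) - L (y - x) (y - x) (y - x)
      - 2 * L x x x := by
    simp only [map_add, map_sub, add_apply, sub_apply]
    rw [hL.swap_left x y y, hL.swap_right y x y, hL.swap_right x x y, hL.swap_left x y x,
      hL.swap_right y x x]
    ring
  have hp : ‖y + x‖ ^ 3 ≤ 8 * ‖y‖ ^ 3 := by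
    have : ‖y + x‖ ≤ 2 * ‖y‖ := (norm_add_le _ _).trans (by rw [hxn]; linarith)
    calc ‖y + x‖ ^ 3 ≤ (2 * ‖y‖) ^ 3 := pow_le_pow_left₀ (norm_nonneg _) this 3
      _ = _ := by ring
  have hm : ‖y - x‖ ^ 3 ≤ 8 * ‖y‖ ^ 3 := by
    have : ‖y - x‖ ≤ 2 * ‖y‖ := (norm_sub_le _ _).trans (by rw [hxn]; linarith)
    calc ‖y - x‖ ^ 3 ≤ (2 * ‖y‖) ^ 3 := pow_le_pow_left₀ (norm_nonneg _) this 3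
      _ = _ := by ring
  have h1 := (hM (y + x)).trans (mul_le_mul_of_nonneg_left hp hM0)
  have h2 := (hM (y - x)).trans (mul_le_mul_of_nonneg_left hm hM0)
  have h3 := hM x
  rw [hxn] at h3
  have h4 : |L y y x| ≤ 3 * M * ‖y‖ ^ 3 := by
    rw [abs_le] at h1 h2 h3 ⊢
    constructor <;> linarith [h1.1, h1.2, h2.1, h2.2, h3.1, h3.2]
  have h5 : |L y y x| = t * |L y y z| := by
    rw [hx, map_smul, smul_eq_mul, abs_mul, abs_of_pos htp]
  rw [h5, ht] at h4
  have h6 : ‖y‖ / ‖z‖ * |L y y z| * ‖z‖ ≤ 3 * M * ‖y‖ ^ 3 * ‖z‖ :=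
    mul_le_mul_of_nonneg_right h4 hz'.le
  have h7 : ‖y‖ / ‖z‖ * |L y y z| * ‖z‖ = ‖y‖ * |L y y z| := by field_simp
  rw [h7] at h6
  refine le_of_mul_le_mul_left (h6.trans_eq ?_) hy'
  ring

/-- The skew correction attached to a trilinear form. -/
def cubicSkew (L : V →L[ℝ] V →L[ℝ] V →L[ℝ] ℝ) (y : V) : ℝ := -(1 / 6) * L y y y

lemma cubicSkew_neg (y : V) : cubicSkew L (-y) = -cubicSkew L y := by
  simp [cubicSkew]

lemma PolyGrowth.cubicSkew (L : V →L[ℝ] V →L[ℝ] V →L[ℝ] ℝ) : PolyGrowth (cubicSkew L) :=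
  (PolyGrowth.trilin L).const_mul _

lemma abs_cubicSkew_le {M : ℝ} (hM : ∀ u, |L u u u| ≤ M * ‖u‖ ^ 3) (y : V) :
    |cubicSkew L y| ≤ M / 6 * ‖y‖ ^ 3 := by
  rw [cubicSkew, abs_mul, abs_neg, abs_of_pos (by norm_num : (0 : ℝ) < 1 / 6)]
  linarith [hM y]

lemma hasFDerivAt_cubicSkew (hL : IsSymmTrilin L) (y : V) :
    HasFDerivAt (cubicSkew L) ((-(1 / 2) : ℝ) • L y y) y := by
  have h := (hasFDerivAt_trilin hL y).const_mul (-(1 / 6) : ℝ)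
  refine h.congr_fderiv ?_
  rw [smul_smul]; norm_num

lemma norm_fderiv_cubicSkew_le (hL : IsSymmTrilin L) {M : ℝ} (hM0 : 0 ≤ M)
    (hM : ∀ u, |L u u u| ≤ M * ‖u‖ ^ 3) (y : V) :
    ‖(-(1 / 2) : ℝ) • L y y‖ ≤ 3 / 2 * M * ‖y‖ ^ 2 := by
  rw [norm_smul]
  have : ‖L y y‖ ≤ 3 * M * ‖y‖ ^ 2 :=
    ContinuousLinearMap.opNorm_le_bound _ (by positivity) fun z => hL.abs_apply_le hM y z
  norm_num
  linarith

lemma deriv_smoothTransition_of_neg {x : ℝ} (hx : x < 0) : deriv Real.smoothTransition x = 0 := by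
  have : Real.smoothTransition =ᶠ[nhds x] fun _ => 0 := by
    filter_upwards [Iio_mem_nhds hx] with z hz
    exact Real.smoothTransition.zero_of_nonpos (le_of_lt hz)
  rw [this.deriv_eq, deriv_const]

lemma exists_abs_deriv_smoothTransition_le :
    ∃ M : ℝ, 0 ≤ M ∧ ∀ x, |deriv Real.smoothTransition x| ≤ M := by
  have hc : Continuous (deriv Real.smoothTransition) :=
    (Real.smoothTransition.contDiff (n := 1)).continuous_deriv le_rfl
  obtain ⟨M, hM⟩ := isCompact_Icc.exists_bound_of_continuousOn (s := Set.Icc (0 : ℝ) 1)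
    hc.continuousOn
  refine ⟨max M 0, le_max_right _ _, fun x => ?_⟩
  by_cases hx : x ∈ Set.Icc (0 : ℝ) 1
  · exact (hM x hx).trans (le_max_left _ _)
  have h0 : deriv Real.smoothTransition x = 0 := by
    rw [Set.mem_Icc, not_and_or, not_le, not_le] at hx
    rcases hx with hx | hx
    · exact deriv_smoothTransition_of_neg hx
    · have : Real.smoothTransition =ᶠ[nhds x] fun _ => 1 := by
        filter_upwards [Ioi_mem_nhds hx] with z hz
        exact Real.smoothTransition.one_of_one_le (le_of_lt hz)
      rw [this.deriv_eq, deriv_const]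
  rw [h0]; simp

/-- The cubic skew correction, smoothly cut off at radius of order `√D`. -/
def cutoffSkew (L : V →L[ℝ] V →L[ℝ] V →L[ℝ] ℝ) (D : ℝ) (y : V) : ℝ :=
  cubicSkew L y * Real.smoothTransition (5 - ‖y‖ ^ 2 / D)

lemma cutoffSkew_neg (D : ℝ) (y : V) : cutoffSkew L D (-y) = -cutoffSkew L D y := by
  simp [cutoffSkew, cubicSkew_neg]

lemma cutoffSkew_eq {D : ℝ} (hD : 0 < D) {y : V} (hy : ‖y‖ ^ 2 ≤ 4 * D) :
    cutoffSkew L D y = cubicSkew L y := by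
  rw [cutoffSkew, Real.smoothTransition.one_of_one_le, mul_one]
  have : ‖y‖ ^ 2 / D ≤ 4 := by rwa [div_le_iff₀ hD]
  linarith

lemma contDiff_cutoffSkew (D : ℝ) : ContDiff ℝ 1 (cutoffSkew L D) := by
  unfold cutoffSkew cubicSkew
  refine ContDiff.mul ?_ ?_
  · fun_prop
  · exact Real.smoothTransition.contDiff.comp
      (contDiff_const.sub ((contDiff_norm_sq ℝ).div_const _))

/-- On the support ‖y‖² ≤ 5D the gradient of the cubic form is of order (ε/D)·D, and the form times
the gradient of the cutoff is of order ε√D · D^{-1/2}. The normalization ε/D is what makes both O(ε)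
whatever D is; 15/2 and 25M/3 are the two terms at ‖y‖² = 5D. -/
lemma exists_norm_fderiv_cutoffSkew_le : ∃ C : ℝ, 0 ≤ C ∧
    ∀ {V : Type*} [NormedAddCommGroup V] [InnerProductSpace ℝ V] [FiniteDimensional ℝ V]
      [MeasurableSpace V] [BorelSpace V] {L : V →L[ℝ] V →L[ℝ] V →L[ℝ] ℝ} (_ : IsSymmTrilin L)
      {D ε : ℝ}, 0 < D → 0 ≤ ε →
      (∀ u, |L u u u| ≤ ε / D * ‖u‖ ^ 3) → ∀ y, ‖fderiv ℝ (cutoffSkew L D) y‖ ≤ C * ε := by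
  obtain ⟨M, hM0, hM⟩ := exists_abs_deriv_smoothTransition_le
  refine ⟨15 / 2 + 25 / 3 * M, by positivity, ?_⟩
  intro V _ _ _ _ _ L hL D ε hD hε hLε y
  set χ := Real.smoothTransition (5 - ‖y‖ ^ 2 / D) with hχ
  set χ' := deriv Real.smoothTransition (5 - ‖y‖ ^ 2 / D) with hχ'
  have h1 : HasFDerivAt (fun y : V => 5 - ‖y‖ ^ 2 / D) (-(D⁻¹ • (2 • innerSL ℝ y))) y := by
    have h := ((hasStrictFDerivAt_norm_sq y).hasFDerivAt.const_mul D⁻¹).const_sub 5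
    simpa only [div_eq_inv_mul] using h
  have h2 : HasDerivAt Real.smoothTransition χ' (5 - ‖y‖ ^ 2 / D) :=
    ((Real.smoothTransition.contDiff (n := 1)).differentiable one_ne_zero _).hasDerivAt
  have h3 := (hasFDerivAt_cubicSkew hL y).mul (h2.comp_hasFDerivAt y h1)
  have h4 : fderiv ℝ (cutoffSkew L D) y = _ := h3.fderiv
  rw [h4]
  simp only [Function.comp]
  have hMn : 0 ≤ ε / D := by positivity
  have hS := abs_cubicSkew_le hLε y
  have hS' := norm_fderiv_cubicSkew_le hL hMn hLε y
  have hn : ‖-(D⁻¹ • (2 • innerSL ℝ y))‖ ≤ 2 / D * ‖y‖ := by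
    rw [norm_neg, norm_smul, ← Nat.cast_smul_eq_nsmul ℝ, norm_smul, innerSL_apply_norm]
    simp only [norm_inv, Real.norm_eq_abs, abs_of_pos hD]
    norm_num
    exact le_of_eq (by ring)
  refine (norm_add_le _ _).trans ?_
  rw [norm_smul, norm_smul, norm_smul, Real.norm_eq_abs, Real.norm_eq_abs, Real.norm_eq_abs]
  by_cases hy : ‖y‖ ^ 2 ≤ 5 * D
  · have hχ1 : |χ| ≤ 1 := by
      rw [abs_of_nonneg (Real.smoothTransition.nonneg _)]; exact Real.smoothTransition.le_one _
    have t1 : |cubicSkew L y| * (|χ'| * ‖-(D⁻¹ • (2 • innerSL ℝ y))‖) ≤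
        ε / D / 6 * ‖y‖ ^ 3 * (M * (2 / D * ‖y‖)) := by
      gcongr
      exact hM _
    have t2 : |χ| * ‖(-(1 / 2) : ℝ) • L y y‖ ≤ 1 * (3 / 2 * (ε / D) * ‖y‖ ^ 2) := by
      gcongr
    have t3 : ‖y‖ ^ 2 / D ≤ 5 := by rwa [div_le_iff₀ hD]
    have t4 : 0 ≤ ‖y‖ ^ 2 / D := by positivity
    have t5 : ε / D / 6 * ‖y‖ ^ 3 * (M * (2 / D * ‖y‖)) = ε * M / 3 * (‖y‖ ^ 2 / D) ^ 2 := by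
      field_simp; ring
    have t6 : 1 * (3 / 2 * (ε / D) * ‖y‖ ^ 2) = 3 / 2 * ε * (‖y‖ ^ 2 / D) := by
      field_simp
    have t7 : (‖y‖ ^ 2 / D) ^ 2 ≤ 25 := by nlinarith
    have t8 : ε * M / 3 * (‖y‖ ^ 2 / D) ^ 2 ≤ ε * M / 3 * 25 :=
      mul_le_mul_of_nonneg_left t7 (by positivity)
    have t9 : 3 / 2 * ε * (‖y‖ ^ 2 / D) ≤ 3 / 2 * ε * 5 :=
      mul_le_mul_of_nonneg_left t3 (by positivity)
    linarith
  · push Not at hy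
    have hneg : 5 - ‖y‖ ^ 2 / D < 0 := by
      have : 5 < ‖y‖ ^ 2 / D := by rwa [lt_div_iff₀ hD]
      linarith
    have e1 : χ = 0 := Real.smoothTransition.zero_of_nonpos hneg.le
    have e2 : χ' = 0 := deriv_smoothTransition_of_neg hneg
    rw [← hχ, e1, e2]
    simp
    positivity

end

section

/-! ### Elementary inequalities -/

lemma abs_exp_sub_one_sub_le (r : ℝ) : |Real.exp r - 1 - r| ≤ r ^ 2 * (1 + Real.exp r) := by
  have h1 := Real.add_one_le_exp r
  have h2 := Real.add_one_le_exp (-r)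
  have h3 : Real.exp r * Real.exp (-r) = 1 := by rw [← Real.exp_add]; simp
  have h4 := Real.exp_pos r
  have h5 : Real.exp r * (1 - r) ≤ 1 := by nlinarith
  rw [abs_of_nonneg (by linarith)]
  rcases le_total 0 r with hr | hr
  · nlinarith [mul_nonneg (mul_nonneg hr hr) h4.le, mul_nonneg hr hr,
      mul_le_mul_of_nonneg_left (show Real.exp r - 1 ≤ r * Real.exp r by linarith) hr]
  · nlinarith [mul_nonneg (sq_nonneg r) h4.le]

lemma one_add_sq_le_two_mul_exp_abs (x : ℝ) : 1 + x ^ 2 ≤ 2 * Real.exp |x| := by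
  have := Real.quadratic_le_exp_of_nonneg (abs_nonneg x)
  rw [sq_abs] at this
  linarith [abs_nonneg x]

lemma exp_abs_le (x : ℝ) : Real.exp |x| ≤ Real.exp x + Real.exp (-x) := by
  rcases abs_choice x with h | h <;> rw [h]
  · linarith [Real.exp_pos (-x)]
  · linarith [Real.exp_pos x]

lemma pow_le_mul_exp_div (k : ℕ) {a t : ℝ} (ha : 0 < a) (ht : 0 ≤ t) :
    t ^ k ≤ k.factorial * a ^ k * Real.exp (t / a) := by
  have h := Real.pow_div_factorial_le_exp (t / a) (by positivity) k
  rw [div_le_iff₀ (by positivity), div_pow, div_le_iff₀ (by positivity)] at h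
  linarith

lemma abs_exp_add_sub_one_sub_le (S ρ : ℝ) : |Real.exp (S + ρ) - 1 - S| ≤
    |ρ| + (2 * S ^ 2 + 2 * ρ ^ 2) * (1 + Real.exp (S + ρ)) := by
  have h1 := abs_exp_sub_one_sub_le (S + ρ)
  have h2 : Real.exp (S + ρ) - 1 - S = (Real.exp (S + ρ) - 1 - (S + ρ)) + ρ := by ring
  have h3 : (S + ρ) ^ 2 ≤ 2 * S ^ 2 + 2 * ρ ^ 2 := by nlinarith [sq_nonneg (S - ρ)]
  have h4 := Real.exp_pos (S + ρ)
  rw [h2]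
  refine (abs_add_le _ _).trans ?_
  nlinarith [mul_le_mul_of_nonneg_right h3 (by linarith : 0 ≤ 1 + Real.exp (S + ρ))]

/-- Taylor bound in the bulk, where the correction is a bounded multiple of a
sub-Gaussian variable `x`. -/
lemma bulk_bound {B ε₃ ε₄ ρ : ℝ} (h3 : 0 ≤ ε₃) (h3B : ε₃ ≤ B)
    (h4B : ε₄ ^ 2 ≤ B ^ 2) (x : ℝ) (hρ : |ρ| ≤ ε₄ ^ 2) :
    |Real.exp (ε₃ * x + ρ) - 1 - ε₃ * x| ≤
      (1 + 8 * (1 + B ^ 2) * (1 + Real.exp (B ^ 2))) * (ε₃ ^ 2 + ε₄ ^ 2) *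
        Real.exp ((1 + B) * |x|) := by
  have hB : 0 ≤ B := h3.trans h3B
  refine (abs_exp_add_sub_one_sub_le _ _).trans ?_
  have hx := abs_nonneg x
  have e1 : Real.exp (ε₃ * x + ρ) ≤ Real.exp (B ^ 2) * Real.exp (B * |x|) := by
    rw [← Real.exp_add]
    apply Real.exp_le_exp.2
    have : ε₃ * x ≤ B * |x| :=
      (mul_le_mul_of_nonneg_left (le_abs_self x) h3).trans (mul_le_mul_of_nonneg_right h3B hx)
    linarith [le_abs_self ρ]
  have e2 : (1 : ℝ) ≤ Real.exp (B * |x|) := Real.one_le_exp (by positivity)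
  have e3 : (1 : ℝ) ≤ Real.exp |x| := Real.one_le_exp hx
  have e4 : Real.exp ((1 + B) * |x|) = Real.exp |x| * Real.exp (B * |x|) := by
    rw [← Real.exp_add]; ring_nf
  have e5 := one_add_sq_le_two_mul_exp_abs x
  set X := Real.exp |x|
  set Y := Real.exp (B * |x|)
  set Q := Real.exp (B ^ 2)
  have hQ : 0 < Q := Real.exp_pos _
  have f1 : 1 + Real.exp (ε₃ * x + ρ) ≤ (1 + Q) * Y := by nlinarith
  have f2 : ρ ^ 2 ≤ B ^ 2 * ε₄ ^ 2 := by
    rw [← sq_abs]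
    nlinarith [abs_nonneg ρ, sq_nonneg ε₄]
  have f3 : 2 * (ε₃ * x) ^ 2 + 2 * ρ ^ 2 ≤ 8 * (1 + B ^ 2) * (ε₃ ^ 2 + ε₄ ^ 2) * X := by
    have g1 : (ε₃ * x) ^ 2 ≤ ε₃ ^ 2 * (2 * X) := by
      rw [mul_pow]; exact mul_le_mul_of_nonneg_left (by linarith) (sq_nonneg _)
    have g2 : B ^ 2 * ε₄ ^ 2 ≤ B ^ 2 * ε₄ ^ 2 * X := le_mul_of_one_le_right (by positivity) e3
    have g3 : 0 ≤ B ^ 2 * ε₃ ^ 2 * X := by positivity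
    have g4 : 0 ≤ ε₄ ^ 2 * X := by positivity
    have g5 : 0 ≤ ε₃ ^ 2 * X := by positivity
    have g6 : 0 ≤ B ^ 2 * ε₄ ^ 2 * X := by positivity
    nlinarith
  have f4 : |ρ| ≤ (ε₃ ^ 2 + ε₄ ^ 2) * (X * Y) := by
    have g1 : 1 ≤ X * Y := by nlinarith
    nlinarith [sq_nonneg ε₃, sq_nonneg ε₄,
      mul_le_mul_of_nonneg_left g1 (by positivity : 0 ≤ ε₃ ^ 2 + ε₄ ^ 2)]
  have f5 : (2 * (ε₃ * x) ^ 2 + 2 * ρ ^ 2) * (1 + Real.exp (ε₃ * x + ρ)) ≤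
      (8 * (1 + B ^ 2) * (ε₃ ^ 2 + ε₄ ^ 2) * X) * ((1 + Q) * Y) :=
    mul_le_mul f3 f1 (by positivity) (by positivity)
  rw [e4]
  calc _ ≤ _ := add_le_add f4 f5
    _ = _ := by ring

/-- Taylor bound far from the mode, with `t` the squared distance to the mode. -/
lemma far_bound {B ε₃ ε₄ s t S ρ : ℝ} (h4B : ε₄ ^ 2 ≤ B ^ 2) (ht : 0 ≤ t)
    (hS : S ^ 2 ≤ ε₃ ^ 2 * t ^ 3) (hS' : |S| ≤ ε₃ ^ 2 * s ^ 4 / 2 + t / 72)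
    (hρ : |ρ| ≤ ε₄ ^ 2 * t ^ 2) (hρ' : |ρ| ≤ ε₄ ^ 2 * s ^ 4) :
    |Real.exp (S + ρ) - 1 - S| ≤
      (2 * 72 ^ 2 + 24 * 72 ^ 3 + 96 * 72 ^ 4 * B ^ 2) * (ε₃ ^ 2 + ε₄ ^ 2) *
        Real.exp ((ε₃ ^ 2 + ε₄ ^ 2) * s ^ 4) * Real.exp (t / 36) := by
  refine (abs_exp_add_sub_one_sub_le _ _).trans ?_
  set Z := Real.exp ((ε₃ ^ 2 + ε₄ ^ 2) * s ^ 4)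
  set Y := Real.exp (t / 72)
  have hs4 : 0 ≤ s ^ 4 := by positivity
  have hZ : 1 ≤ Z := Real.one_le_exp (by positivity)
  have hY : 1 ≤ Y := Real.one_le_exp (by positivity)
  have hYY : Real.exp (t / 36) = Y * Y := by rw [← Real.exp_add]; ring_nf
  have e1 : Real.exp (S + ρ) ≤ Z * Y := by
    rw [← Real.exp_add]
    apply Real.exp_le_exp.2
    nlinarith [le_abs_self S, le_abs_self ρ, mul_nonneg (sq_nonneg ε₃) hs4]
  -- Powers of t are absorbed by a second copy of exp(t/72); the two copies together make exp(t/36).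
  have p2 : t ^ 2 ≤ 2 * 72 ^ 2 * Y := by
    simpa [Nat.factorial] using pow_le_mul_exp_div 2 (a := 72) (by norm_num) ht
  have p3 : t ^ 3 ≤ 6 * 72 ^ 3 * Y := by
    simpa [Nat.factorial] using pow_le_mul_exp_div 3 (a := 72) (by norm_num) ht
  have p4 : t ^ 4 ≤ 24 * 72 ^ 4 * Y := by
    simpa [Nat.factorial] using pow_le_mul_exp_div 4 (a := 72) (by norm_num) ht
  have f1 : 1 + Real.exp (S + ρ) ≤ 2 * (Z * Y) := by nlinarith
  have f2 : ρ ^ 2 ≤ B ^ 2 * ε₄ ^ 2 * t ^ 4 := by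
    rw [← sq_abs]
    have g1 : |ρ| ^ 2 ≤ (ε₄ ^ 2 * t ^ 2) ^ 2 := pow_le_pow_left₀ (abs_nonneg _) hρ 2
    have g2 : 0 ≤ ε₄ ^ 2 * t ^ 4 := by positivity
    nlinarith [mul_le_mul_of_nonneg_right h4B g2]
  have f3 : S ^ 2 ≤ ε₃ ^ 2 * (6 * 72 ^ 3 * Y) :=
    hS.trans (mul_le_mul_of_nonneg_left p3 (sq_nonneg _))
  have f4 : ρ ^ 2 ≤ ε₄ ^ 2 * (24 * 72 ^ 4 * B ^ 2 * Y) := by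
    refine f2.trans ?_
    have := mul_le_mul_of_nonneg_left p4 (by positivity : 0 ≤ B ^ 2 * ε₄ ^ 2)
    linarith
  have f5 : 2 * S ^ 2 + 2 * ρ ^ 2 ≤
      (12 * 72 ^ 3 + 48 * 72 ^ 4 * B ^ 2) * (ε₃ ^ 2 + ε₄ ^ 2) * Y := by
    have g1 : 0 ≤ ε₃ ^ 2 * (B ^ 2 * Y) := by positivity
    have g2 : 0 ≤ ε₄ ^ 2 * Y := by positivity
    nlinarith
  have f6 : |ρ| ≤ 2 * 72 ^ 2 * (ε₃ ^ 2 + ε₄ ^ 2) * (Z * (Y * Y)) := by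
    have g0 : |ρ| ≤ ε₄ ^ 2 * (2 * 72 ^ 2 * Y) :=
      hρ.trans (mul_le_mul_of_nonneg_left p2 (sq_nonneg _))
    have g1 : Y ≤ Z * (Y * Y) := by
      have : 1 ≤ Z * Y := by nlinarith
      nlinarith
    have g2 : ε₄ ^ 2 * Y ≤ (ε₃ ^ 2 + ε₄ ^ 2) * (Z * (Y * Y)) := by
      apply mul_le_mul _ g1 (by positivity) (by positivity)
      nlinarith [sq_nonneg ε₃]
    linarith
  have f7 : (2 * S ^ 2 + 2 * ρ ^ 2) * (1 + Real.exp (S + ρ)) ≤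
      ((12 * 72 ^ 3 + 48 * 72 ^ 4 * B ^ 2) * (ε₃ ^ 2 + ε₄ ^ 2) * Y) * (2 * (Z * Y)) :=
    mul_le_mul f5 f1 (by positivity) (by positivity)
  rw [hYY]
  calc _ ≤ _ := add_le_add f6 f7
    _ = _ := by ring

/-- Since √2 ≤ e^{1/2}, a decay rate of at least 1/2 per dimension pays for the factor √2^k coming
from `integral_exp_sq_div_four`. -/
lemma sqrt_two_pow_mul_exp_le {c : ℝ} (hc : 1 / 2 ≤ c) (k : ℕ) :
    Real.exp (-(c * k)) * Real.sqrt 2 ^ k ≤ 1 := by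
  have h1 : Real.sqrt 2 ≤ Real.exp (1 / 2) := by
    rw [Real.sqrt_le_left (Real.exp_pos _).le, ← Real.exp_nat_mul]
    have := Real.add_one_le_exp 1
    norm_num at this ⊢
    linarith
  calc Real.exp (-(c * k)) * Real.sqrt 2 ^ k
      ≤ Real.exp (-(1 / 2 * k)) * Real.exp (1 / 2) ^ k := by
        gcongr
    _ = 1 := by rw [← Real.exp_nat_mul, ← Real.exp_add]; ring_nf; simp

/-! ### The dominating function -/

variable {V : Type*} [NormedAddCommGroup V] [InnerProductSpace ℝ V] [FiniteDimensional ℝ V]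
  [MeasurableSpace V] [BorelSpace V] {L : V →L[ℝ] V →L[ℝ] V →L[ℝ] ℝ}

/-- A function with bounded Gaussian second moment that dominates, up to constants, the skew
correction and the local error of the first order expansion. -/
structure IsDominating (L : V →L[ℝ] V →L[ℝ] V →L[ℝ] ℝ) (C ε₃ ε₄ s : ℝ) (J : V → ℝ) : Prop where
  integrable_sq : Integrable (fun y => J y ^ 2) (stdGaussian V)
  integral_sq_le : ∫ y, J y ^ 2 ∂(stdGaussian V) ≤ C
  skew_le : ∀ y, |cubicSkew L y| ≤ C * J y
  error_le : ∀ y ρ, ‖y‖ ^ 2 ≤ s ^ 2 * Module.finrank ℝ V →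
    |ρ| ≤ ε₄ ^ 2 * ‖y‖ ^ 4 / (24 * (Module.finrank ℝ V : ℝ) ^ 2) →
    |Real.exp (cubicSkew L y + ρ) - 1 - cubicSkew L y| ≤
      C * (Real.exp ((ε₃ ^ 2 + ε₄ ^ 2) * s ^ 4) * (ε₃ ^ 2 + ε₄ ^ 2)) * J y

/-- The sub-Gaussian part together with a Gaussian weight away from the bulk. -/
def dominant (F : V → ℝ) (c : ℝ) (y : V) : ℝ :=
  Real.exp (c * F y) + Real.exp (-c * F y) +
    {y : V | Real.sqrt (4 * Module.finrank ℝ V) < ‖y‖}.indicator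
      (fun y => Real.exp (1 / 36 * ‖y‖ ^ 2)) y

lemma measurableSet_far (R : ℝ) : MeasurableSet {y : V | R < ‖y‖} :=
  measurableSet_lt (by fun_prop) (by fun_prop)

lemma measurable_dominant {F : V → ℝ} (hF : Continuous F) (c : ℝ) : Measurable (dominant F c) := by
  unfold dominant
  refine Measurable.add (Continuous.measurable (by fun_prop)) ?_
  exact Measurable.indicator (by fun_prop) (measurableSet_far _)

lemma dominant_sq_le (F : V → ℝ) (c : ℝ) (y : V) :
    dominant F c y ^ 2 ≤ 3 * (Real.exp (2 * c * F y) + Real.exp (-(2 * c) * F y) +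
      {y : V | Real.sqrt (4 * Module.finrank ℝ V) < ‖y‖}.indicator
        (fun y => Real.exp (1 / 18 * ‖y‖ ^ 2)) y) := by
  have h1 : Real.exp (2 * c * F y) = Real.exp (c * F y) ^ 2 := by
    rw [← Real.exp_nat_mul]; push_cast; ring_nf
  have h2 : Real.exp (-(2 * c) * F y) = Real.exp (-c * F y) ^ 2 := by
    rw [← Real.exp_nat_mul]; push_cast; ring_nf
  have h3 : {y : V | Real.sqrt (4 * Module.finrank ℝ V) < ‖y‖}.indicator
      (fun y => Real.exp (1 / 18 * ‖y‖ ^ 2)) y =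
      {y : V | Real.sqrt (4 * Module.finrank ℝ V) < ‖y‖}.indicator
        (fun y => Real.exp (1 / 36 * ‖y‖ ^ 2)) y ^ 2 := by
    by_cases hy : y ∈ {y : V | Real.sqrt (4 * Module.finrank ℝ V) < ‖y‖}
    · rw [Set.indicator_of_mem hy, Set.indicator_of_mem hy, ← Real.exp_nat_mul]
      push_cast; ring_nf
    · rw [Set.indicator_of_notMem hy, Set.indicator_of_notMem hy]; simp
  rw [h1, h2, h3, dominant]
  set p := Real.exp (c * F y)
  set q := Real.exp (-c * F y)
  set r := {y : V | Real.sqrt (4 * Module.finrank ℝ V) < ‖y‖}.indicator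
        (fun y => Real.exp (1 / 36 * ‖y‖ ^ 2)) y
  nlinarith [sq_nonneg (p - q), sq_nonneg (p - r), sq_nonneg (q - r)]

end

/-! ### Existence of a dominating function with dimension-free second moment -/

section

variable {V : Type*} [NormedAddCommGroup V] [InnerProductSpace ℝ V] [FiniteDimensional ℝ V]
  [MeasurableSpace V] [BorelSpace V] {L : V →L[ℝ] V →L[ℝ] V →L[ℝ] ℝ}

lemma integrable_exp_mul_of_fderiv_le {F : V → ℝ} {K : ℝ} (hF : ContDiff ℝ 1 F)
    (h0 : F 0 = 0) (hK : ∀ y, ‖fderiv ℝ F y‖ ≤ K) (c : ℝ) :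
    Integrable (fun y => Real.exp (c * F y)) (stdGaussian V) := by
  have hlip : ∀ y, |F y| ≤ K * ‖y‖ := fun y => by
    have := Convex.norm_image_sub_le_of_norm_fderiv_le (𝕜 := ℝ) (f := F) (s := Set.univ) (x := 0)
      (y := y) (fun x _ => hF.differentiable one_ne_zero x) (fun x _ => hK x) convex_univ
      (Set.mem_univ _) (Set.mem_univ _)
    simpa [h0] using this
  have hc : Continuous fun y => Real.exp (c * F y) := by have := hF.continuous; fun_prop
  refine (integrable_exp_mul_norm (|c| * K)).mono' hc.aestronglyMeasurable
    (Filter.Eventually.of_forall fun y => ?_)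
  rw [Real.norm_eq_abs, abs_of_pos (Real.exp_pos _)]
  apply Real.exp_le_exp.2
  calc c * F y ≤ |c * F y| := le_abs_self _
    _ = |c| * |F y| := abs_mul _ _
    _ ≤ |c| * (K * ‖y‖) := mul_le_mul_of_nonneg_left (hlip y) (abs_nonneg _)
    _ = _ := by ring

lemma integral_exp_mul_le {F : V → ℝ} {K : ℝ} (hF : ContDiff ℝ 1 F)
    (hodd : ∀ y, F (-y) = -F y) (hK : ∀ y, ‖fderiv ℝ F y‖ ≤ K) (c : ℝ) :
    ∫ y, Real.exp (c * F y) ∂(stdGaussian V) ≤ Real.exp (Real.pi ^ 2 * (c * K) ^ 2 / 16) := by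
  have h := integral_exp_le_of_odd (F := fun y => c * F y) (L := |c| * K)
    (contDiff_const.mul hF) (fun y => by rw [hodd]; ring) (fun y => by
      rw [fderiv_const_mul (hF.differentiable one_ne_zero y), norm_smul]
      exact mul_le_mul_of_nonneg_left (hK y) (abs_nonneg _))
  rwa [mul_pow, sq_abs, ← mul_pow] at h

/-- Beyond radius 2√D the Chernoff factor is e^{-(1/4 - b)·4D}; the condition b ≤ 1/8 makes it at
most e^{-D/2}, enough against √2^D. -/
lemma integral_far_le {b : ℝ} (hb : b ≤ 1 / 8) {D : ℝ} (hD : D = Module.finrank ℝ V) :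
    ∫ y, {y : V | Real.sqrt (4 * D) < ‖y‖}.indicator (fun y => Real.exp (b * ‖y‖ ^ 2)) y
      ∂(stdGaussian V) ≤ 1 := by
  subst hD
  rw [integral_indicator (measurableSet_far _)]
  refine (setIntegral_exp_sq_le (by linarith) (Real.sqrt_nonneg _)).trans ?_
  rw [Real.sq_sqrt (by positivity)]
  have := sqrt_two_pow_mul_exp_le (c := (1 / 4 - b) * 4) (by linarith) (Module.finrank ℝ V)
  refine le_of_eq_of_le ?_ this
  ring_nf

lemma integrable_indicator_exp_sq {b : ℝ} (hb : b ≤ 1 / 4) (R : ℝ) :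
    Integrable ({y : V | R < ‖y‖}.indicator fun y => Real.exp (b * ‖y‖ ^ 2)) (stdGaussian V) := by
  refine Integrable.indicator ?_ (measurableSet_far _)
  refine integrable_of_le_exp_sq (C := 1) (by fun_prop) fun y => ?_
  rw [abs_of_pos (Real.exp_pos _), one_mul]
  apply Real.exp_le_exp.2
  nlinarith [sq_nonneg ‖y‖]

lemma integrable_dominant_sq {F : V → ℝ} {K : ℝ} (hF : ContDiff ℝ 1 F)
    (h0 : F 0 = 0) (hK : ∀ y, ‖fderiv ℝ F y‖ ≤ K) (c : ℝ) :
    Integrable (fun y => dominant F c y ^ 2) (stdGaussian V) := by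
  have hi := fun c => integrable_exp_mul_of_fderiv_le hF h0 hK c
  refine ((((hi (2 * c)).add (hi (-(2 * c)))).add
    (integrable_indicator_exp_sq (b := 1 / 18) (by norm_num)
      (Real.sqrt (4 * Module.finrank ℝ V)))).const_mul 3).mono'
    ((measurable_dominant hF.continuous c).pow_const 2).aestronglyMeasurable
    (Filter.Eventually.of_forall fun y => ?_)
  rw [Real.norm_eq_abs, abs_of_nonneg (sq_nonneg _)]
  exact dominant_sq_le F c y

lemma integral_dominant_sq_le {F : V → ℝ} {K : ℝ} (hF : ContDiff ℝ 1 F)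
    (hodd : ∀ y, F (-y) = -F y) (hK : ∀ y, ‖fderiv ℝ F y‖ ≤ K) (c : ℝ) :
    ∫ y, dominant F c y ^ 2 ∂(stdGaussian V) ≤
      3 * (2 * Real.exp (Real.pi ^ 2 * (2 * c * K) ^ 2 / 16) + 1) := by
  have h0 : F 0 = 0 := by have := hodd 0; simp at this; linarith
  have hi := fun c => integrable_exp_mul_of_fderiv_le hF h0 hK c
  have hfar := integrable_indicator_exp_sq (V := V) (b := 1 / 18) (by norm_num)
    (Real.sqrt (4 * Module.finrank ℝ V))
  have h1 := integral_exp_mul_le hF hodd hK (2 * c)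
  have h2 := integral_exp_mul_le hF hodd hK (-(2 * c))
  have h3 := integral_far_le (V := V) (b := 1 / 18) (by norm_num) rfl
  have h4 : (-(2 * c) * K) ^ 2 = (2 * c * K) ^ 2 := by ring
  rw [h4] at h2
  have hmono := integral_mono (integrable_dominant_sq hF h0 hK c)
    ((((hi (2 * c)).add (hi (-(2 * c)))).add hfar).const_mul 3) (dominant_sq_le F c)
  refine hmono.trans ?_
  rw [integral_const_mul, integral_add' ((hi _).add (hi _)) hfar, integral_add' (hi _) (hi _)]
  linarith

-- The choice is J = `dominant F (1 + B)` with F the cut-off cubic form divided by ε₃. In the bulk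
-- the form equals ε₃ F, so its square releases ε₃², while F² e^{B|F|} is absorbed by e^{(1+B)|F|}.
-- Outside, exp(‖y‖²/36) absorbs all powers of ‖y‖. The constants C₀, C₁, C₂, C₃ serve the second
-- moment, the bulk error, the far error and the size of the form in the far region.
set_option maxHeartbeats 800000 in
theorem exists_isDominating {B : ℝ} (hB : 0 ≤ B) : ∃ C : ℝ, 0 < C ∧
    ∀ {V : Type*} [NormedAddCommGroup V] [InnerProductSpace ℝ V] [FiniteDimensional ℝ V]
      [MeasurableSpace V] [BorelSpace V] {L : V →L[ℝ] V →L[ℝ] V →L[ℝ] ℝ} {ε₃ ε₄ s : ℝ},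
      IsSymmTrilin L → 0 < Module.finrank ℝ V → 0 ≤ ε₃ → ε₃ ≤ B → ε₄ ^ 2 ≤ B ^ 2 →
      (∀ u, |L u u u| ≤ ε₃ / Module.finrank ℝ V * ‖u‖ ^ 3) →
      ∃ J, IsDominating L C ε₃ ε₄ s J := by
  obtain ⟨K, hK0, hK⟩ := exists_norm_fderiv_cutoffSkew_le
  set C₀ := 3 * (2 * Real.exp (Real.pi ^ 2 * (2 * (1 + B) * K) ^ 2 / 16) + 1) with hC₀
  set C₁ := 1 + 8 * (1 + B ^ 2) * (1 + Real.exp (B ^ 2)) with hC₁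
  set C₂ := 2 * 72 ^ 2 + 24 * 72 ^ 3 + 96 * 72 ^ 4 * B ^ 2 with hC₂
  set C₃ := B * (1 + 2 * 36 ^ 2) with hC₃
  have p0 : 0 < C₀ := by positivity
  have p1 : 0 < C₁ := by positivity
  have p2 : 0 < C₂ := by positivity
  have p3 : 0 ≤ C₃ := by positivity
  refine ⟨C₀ + C₁ + C₂ + C₃, by positivity, ?_⟩
  intro V _ _ _ _ _ L ε₃ ε₄ s hL hd h3 h3B h4B hLε
  set D : ℝ := (Module.finrank ℝ V : ℝ) with hD
  have hD1 : 1 ≤ D := by rw [hD]; exact_mod_cast hd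
  have hD0 : 0 < D := by linarith
  -- For ε₃ = 0 the inverse is 0 and F vanishes, consistently with the cubic form being zero; this
  -- is the degenerate case split off below.
  set F : V → ℝ := fun y => ε₃⁻¹ * cutoffSkew L D y with hF
  have hFc : ContDiff ℝ 1 F := contDiff_const.mul (contDiff_cutoffSkew D)
  have hodd : ∀ y, F (-y) = -F y := fun y => by simp only [hF, cutoffSkew_neg]; ring
  have h0 : F 0 = 0 := by have := hodd 0; simp at this; linarith
  have hFK : ∀ y, ‖fderiv ℝ F y‖ ≤ K := fun y => by
    have e : fderiv ℝ F y = ε₃⁻¹ • fderiv ℝ (cutoffSkew L D) y :=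
      fderiv_const_mul ((contDiff_cutoffSkew D).differentiable one_ne_zero y) _
    rw [e, norm_smul, Real.norm_of_nonneg (inv_nonneg.2 h3)]
    rcases h3.eq_or_lt with h | h
    · rw [← h]; simpa using hK0
    · rw [inv_mul_le_iff₀ h, mul_comm]
      exact hK hL hD0 h3 hLε y
  have hJ0 : ∀ y, 0 ≤ dominant F (1 + B) y := fun y =>
    add_nonneg (by positivity) (Set.indicator_nonneg (fun _ _ => (Real.exp_pos _).le) _)
  have hnear : ∀ y, ‖y‖ ^ 2 ≤ 4 * D → cubicSkew L y = ε₃ * F y := fun y hy => by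
    rw [hF]
    simp only
    rw [cutoffSkew_eq hD0 hy]
    rcases h3.eq_or_lt with h | h
    · have := abs_cubicSkew_le hLε y
      rw [← h] at this ⊢
      simp at this ⊢
      exact this
    · field_simp
  have hnearJ : ∀ y, Real.exp ((1 + B) * |F y|) ≤ dominant F (1 + B) y := fun y => by
    have e1 : (1 + B) * |F y| = |(1 + B) * F y| := by
      rw [abs_mul (1 + B), abs_of_pos (by linarith : 0 < 1 + B)]
    rw [e1]
    refine (exp_abs_le _).trans ?_
    unfold dominant
    rw [neg_mul]
    exact le_add_of_nonneg_right (Set.indicator_nonneg (fun _ _ => (Real.exp_pos _).le) _)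
  have hfarJ : ∀ y, 4 * D < ‖y‖ ^ 2 → Real.exp (‖y‖ ^ 2 / 36) ≤ dominant F (1 + B) y :=
      fun y hy => by
    have hmem : y ∈ {y : V | Real.sqrt (4 * Module.finrank ℝ V) < ‖y‖} := by
      simp only [Set.mem_ofPred_eq]
      rw [Real.sqrt_lt' (lt_of_le_of_ne (norm_nonneg y) ?_)]
      · exact hy
      · intro h; rw [← h] at hy; norm_num at hy; linarith
    unfold dominant
    rw [Set.indicator_of_mem hmem]
    have e1 : ‖y‖ ^ 2 / 36 = 1 / 36 * ‖y‖ ^ 2 := by ring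
    rw [e1]
    linarith [Real.exp_pos ((1 + B) * F y), Real.exp_pos (-(1 + B) * F y)]
  have hSsq : ∀ y, cubicSkew L y ^ 2 ≤ ε₃ ^ 2 * (‖y‖ ^ 2) ^ 3 := fun y => by
    have h1 := abs_cubicSkew_le hLε y
    have h2 : ε₃ / D / 6 * ‖y‖ ^ 3 ≤ ε₃ * ‖y‖ ^ 3 := by
      gcongr
      rw [div_div]
      exact div_le_self h3 (by linarith)
    calc cubicSkew L y ^ 2 = |cubicSkew L y| ^ 2 := (sq_abs _).symm
      _ ≤ (ε₃ * ‖y‖ ^ 3) ^ 2 := pow_le_pow_left₀ (abs_nonneg _) (h1.trans h2) 2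
      _ = _ := by ring
  refine ⟨dominant F (1 + B), integrable_dominant_sq hFc h0 hFK _, ?_, ?_, ?_⟩
  · refine (integral_dominant_sq_le hFc hodd hFK _).trans ?_
    linarith
  · intro y
    by_cases hy : ‖y‖ ^ 2 ≤ 4 * D
    · have h1 : |F y| ≤ Real.exp ((1 + B) * |F y|) := by
        have := Real.add_one_le_exp ((1 + B) * |F y|)
        nlinarith [abs_nonneg (F y)]
      calc |cubicSkew L y| = ε₃ * |F y| := by rw [hnear y hy, abs_mul, abs_of_nonneg h3]
        _ ≤ B * dominant F (1 + B) y :=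
            mul_le_mul h3B (h1.trans (hnearJ y)) (abs_nonneg _) hB
        _ ≤ _ := by
            apply mul_le_mul_of_nonneg_right _ (hJ0 y)
            have : B ≤ C₃ := le_mul_of_one_le_right hB (by norm_num)
            linarith
    · push Not at hy
      set t := ‖y‖ ^ 2 with ht
      have ht0 : 0 ≤ t := by positivity
      have p : t ^ 2 ≤ 2 * 36 ^ 2 * Real.exp (t / 36) := by
        simpa [Nat.factorial] using pow_le_mul_exp_div 2 (a := 36) (by norm_num) ht0
      have e1 : 1 ≤ Real.exp (t / 36) := Real.one_le_exp (by positivity)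
      have h1 : |cubicSkew L y| ≤ ε₃ * (1 + t ^ 2) := by
        refine abs_le_of_sq_le_sq ((hSsq y).trans ?_) (by positivity)
        rw [mul_pow]
        refine mul_le_mul_of_nonneg_left ?_ (sq_nonneg _)
        nlinarith [sq_nonneg (t ^ 2 - t), pow_nonneg ht0 4, pow_nonneg ht0 3, pow_nonneg ht0 2]
      calc |cubicSkew L y| ≤ ε₃ * (1 + t ^ 2) := h1
        _ ≤ B * ((1 + 2 * 36 ^ 2) * Real.exp (t / 36)) :=
            mul_le_mul h3B (by linarith) (by positivity) hB
        _ = C₃ * Real.exp (t / 36) := by rw [hC₃]; ring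
        _ ≤ (C₀ + C₁ + C₂ + C₃) * dominant F (1 + B) y :=
            mul_le_mul (by linarith) (hfarJ y hy) (Real.exp_pos _).le (by positivity)
  · intro y ρ hys hρ
    set Z := Real.exp ((ε₃ ^ 2 + ε₄ ^ 2) * s ^ 4) with hZ
    have hZ1 : 1 ≤ Z := Real.one_le_exp (by positivity)
    have hε : 0 ≤ ε₃ ^ 2 + ε₄ ^ 2 := by positivity
    by_cases hy : ‖y‖ ^ 2 ≤ 4 * D
    · have hρ' : |ρ| ≤ ε₄ ^ 2 := by
        refine hρ.trans ?_
        rw [div_le_iff₀ (by positivity)]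
        have : ‖y‖ ^ 4 ≤ 24 * D ^ 2 := by nlinarith [sq_nonneg ‖y‖]
        nlinarith [sq_nonneg ε₄, mul_le_mul_of_nonneg_left this (sq_nonneg ε₄)]
      rw [hnear y hy]
      refine (bulk_bound h3 h3B h4B (F y) hρ').trans ?_
      calc C₁ * (ε₃ ^ 2 + ε₄ ^ 2) * Real.exp ((1 + B) * |F y|)
          ≤ C₁ * (Z * (ε₃ ^ 2 + ε₄ ^ 2)) * dominant F (1 + B) y := by
            refine mul_le_mul (mul_le_mul_of_nonneg_left ?_ p1.le) (hnearJ y)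
              (Real.exp_pos _).le (by positivity)
            exact le_mul_of_one_le_left hε hZ1
        _ ≤ _ := by
            apply mul_le_mul_of_nonneg_right _ (hJ0 y)
            apply mul_le_mul_of_nonneg_right _ (by positivity)
            linarith
    · push Not at hy
      have ht0 : 0 ≤ ‖y‖ ^ 2 := by positivity
      have hDD : 1 ≤ D ^ 2 := by nlinarith
      have h1 : |ρ| ≤ ε₄ ^ 2 * (‖y‖ ^ 2) ^ 2 := by
        refine hρ.trans ?_
        rw [div_le_iff₀ (by positivity)]
        have : 0 ≤ ε₄ ^ 2 * ‖y‖ ^ 4 := by positivity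
        nlinarith
      have h2 : |ρ| ≤ ε₄ ^ 2 * s ^ 4 := by
        refine hρ.trans ?_
        rw [div_le_iff₀ (by positivity)]
        have e : ‖y‖ ^ 4 ≤ s ^ 4 * D ^ 2 := by
          calc ‖y‖ ^ 4 = (‖y‖ ^ 2) ^ 2 := by ring
            _ ≤ (s ^ 2 * D) ^ 2 := pow_le_pow_left₀ ht0 hys 2
            _ = _ := by ring
        have e2 : 0 ≤ ε₄ ^ 2 * s ^ 4 * D ^ 2 := by positivity
        nlinarith [mul_le_mul_of_nonneg_left e (sq_nonneg ε₄)]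
      have h3' : |cubicSkew L y| ≤ ε₃ ^ 2 * s ^ 4 / 2 + ‖y‖ ^ 2 / 72 := by
        refine (abs_cubicSkew_le hLε y).trans ?_
        -- A factor ‖y‖²/D is traded for s², and Young's inequality applied to (ε₃ s²)(‖y‖/6) then
        -- produces the ε₃² s⁴ of E(s).
        have e : ε₃ / D / 6 * ‖y‖ ^ 3 ≤ ε₃ / 6 * s ^ 2 * ‖y‖ := by
          have : ‖y‖ ^ 2 / D ≤ s ^ 2 := by rwa [div_le_iff₀ hD0]
          calc ε₃ / D / 6 * ‖y‖ ^ 3 = ε₃ / 6 * (‖y‖ ^ 2 / D) * ‖y‖ := by field_simp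
            _ ≤ _ := by gcongr
        have e3 : ε₃ / 6 * s ^ 2 * ‖y‖ ≤ ε₃ ^ 2 * s ^ 4 / 2 + ‖y‖ ^ 2 / 72 := by
          have e4 := sq_nonneg (ε₃ * s ^ 2 - ‖y‖ / 6)
          ring_nf at e4 ⊢
          linarith
        exact e.trans e3
      refine (far_bound h4B ht0 (hSsq y) h3' h1 h2).trans ?_
      calc C₂ * (ε₃ ^ 2 + ε₄ ^ 2) * Z * Real.exp (‖y‖ ^ 2 / 36)
          = C₂ * (Z * (ε₃ ^ 2 + ε₄ ^ 2)) * Real.exp (‖y‖ ^ 2 / 36) := by ring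
        _ ≤ (C₀ + C₁ + C₂ + C₃) * (Z * (ε₃ ^ 2 + ε₄ ^ 2)) * dominant F (1 + B) y := by
            refine mul_le_mul (mul_le_mul_of_nonneg_right ?_ (by positivity)) (hfarJ y hy)
              (Real.exp_pos _).le (by positivity)
            linarith

end

section

/-! ### Tails -/

lemma integral_exp_neg_mul_abs {c : ℝ} (hc : 0 < c) :
    ∫ x : ℝ, Real.exp (-c * |x|) = 2 / c := by
  rw [integral_comp_abs (f := fun x => Real.exp (-c * x)),
    integral_exp_mul_Ioi (neg_lt_zero.2 hc)]
  simp
  ring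

lemma integrable_exp_neg_mul_abs {c : ℝ} (hc : 0 < c) :
    Integrable fun x : ℝ => Real.exp (-c * |x|) := by
  -- The value 2/c was computed without assuming convergence, whereas a non-integrable function
  -- would have integral 0.
  by_contra h
  have := integral_exp_neg_mul_abs hc
  rw [integral_undef h] at this
  have : 0 < 2 / c := by positivity
  linarith

lemma sum_abs_le_sqrt_mul_norm {m : ℕ} (y : EuclideanSpace ℝ (Fin m)) :
    ∑ i, |y i| ≤ Real.sqrt m * ‖y‖ := by
  have h : (∑ i, |y i|) ^ 2 ≤ m * ‖y‖ ^ 2 := by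
    have := sq_sum_le_card_mul_sum_sq (s := Finset.univ) (f := fun i => |y i|)
    simpa [EuclideanSpace.real_norm_sq_eq] using this
  have h2 : (∑ i, |y i|) ^ 2 ≤ (Real.sqrt m * ‖y‖) ^ 2 := by
    rwa [mul_pow, Real.sq_sqrt (Nat.cast_nonneg m)]
  exact abs_le_of_sq_le_sq' h2 (by positivity) |>.2

/-- The comparison of the ℓ¹ and ℓ² norms replaces a radial exponential by a product of
one-dimensional ones, so no sphere volumes are needed. -/
lemma exp_neg_mul_norm_le_prod {m : ℕ} {b : ℝ} (hb : 0 < b) (hm : 0 < m)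
    (y : EuclideanSpace ℝ (Fin m)) :
    Real.exp (-b * ‖y‖) ≤ ∏ i, Real.exp (-(b / Real.sqrt m) * |y i|) := by
  rw [← Real.exp_sum, ← Finset.mul_sum]
  apply Real.exp_le_exp.2
  have hm' : 0 < Real.sqrt m := Real.sqrt_pos.2 (by exact_mod_cast hm)
  have h := mul_le_mul_of_nonneg_left (sum_abs_le_sqrt_mul_norm y) (div_pos hb hm').le
  have e : b / Real.sqrt m * (Real.sqrt m * ‖y‖) = b * ‖y‖ := by field_simp
  rw [e] at h
  linarith

lemma integrable_prod_exp_and_integral {m : ℕ} {c : ℝ} (hc : 0 < c) :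
    Integrable (fun y : EuclideanSpace ℝ (Fin m) => ∏ i, Real.exp (-c * |y i|)) ∧
      ∫ y : EuclideanSpace ℝ (Fin m), ∏ i, Real.exp (-c * |y i|) = (2 / c) ^ m := by
  have hmp := PiLp.volume_preserving_ofLp (Fin m)
  have hemb : MeasurableEmbedding (WithLp.ofLp : EuclideanSpace ℝ (Fin m) → (Fin m → ℝ)) :=
    (MeasurableEquiv.toLp 2 (Fin m → ℝ)).symm.measurableEmbedding
  constructor
  · exact (hmp.integrable_comp_emb hemb (g := fun z => ∏ i, Real.exp (-c * |z i|))).2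
      (Integrable.fintype_prod fun _ => integrable_exp_neg_mul_abs hc)
  · have h := hmp.integral_comp hemb (fun z => ∏ i, Real.exp (-c * |z i|))
    rw [h, integral_fintype_prod_volume_eq_pow (fun x : ℝ => Real.exp (-c * |x|)),
      integral_exp_neg_mul_abs hc, Fintype.card_fin]

variable {V : Type*} [NormedAddCommGroup V] [InnerProductSpace ℝ V] [FiniteDimensional ℝ V]
  [MeasurableSpace V] [BorelSpace V]

/-- Crude bound on the Laplace type integral `∫ e^{-b‖y‖} dy`. -/
lemma integrable_exp_neg_mul_norm_and_integral_le {b : ℝ} (hb : 0 < b)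
    (hV : 0 < Module.finrank ℝ V) :
    Integrable (fun y : V => Real.exp (-b * ‖y‖)) ∧
      ∫ y : V, Real.exp (-b * ‖y‖) ≤
        (2 * Real.sqrt (Module.finrank ℝ V) / b) ^ Module.finrank ℝ V := by
  set m := Module.finrank ℝ V
  have hc : 0 < b / Real.sqrt m := div_pos hb (Real.sqrt_pos.2 (by exact_mod_cast hV))
  obtain ⟨hi, he⟩ := integrable_prod_exp_and_integral (m := m) hc
  have hi2 : Integrable fun y : EuclideanSpace ℝ (Fin m) => Real.exp (-b * ‖y‖) :=
    hi.mono' (by fun_prop) (Filter.Eventually.of_forall fun y => by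
      rw [Real.norm_eq_abs, abs_of_pos (Real.exp_pos _)]
      exact exp_neg_mul_norm_le_prod hb hV y)
  have hmp := (stdOrthonormalBasis ℝ V).measurePreserving_repr
  have hemb : MeasurableEmbedding (stdOrthonormalBasis ℝ V).repr :=
    (stdOrthonormalBasis ℝ V).repr.toHomeomorph.measurableEmbedding
  have hfun : (fun y : V => Real.exp (-b * ‖y‖)) =
      (fun z : EuclideanSpace ℝ (Fin m) => Real.exp (-b * ‖z‖)) ∘
        (stdOrthonormalBasis ℝ V).repr := by
    ext y; simp
  constructor
  · rw [hfun]; exact (hmp.integrable_comp_emb hemb).2 hi2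
  · have h := hmp.integral_comp hemb (fun z => Real.exp (-b * ‖z‖))
    simp only [LinearIsometryEquiv.norm_map] at h
    rw [h]
    refine (integral_mono hi2 hi fun y => exp_neg_mul_norm_le_prod hb hV y).trans_eq ?_
    rw [he]
    congr 1
    rw [div_div_eq_mul_div]

/-- Consequences of a large radius. -/
lemma radius_bounds {c₀ s : ℝ} (hc : 0 < c₀) (hc1 : c₀ ≤ 1)
    (hs : 8 / c₀ * Real.log (2 * Real.exp 1 / c₀) ≤ s) :
    8 ≤ s ∧ 8 / c₀ ≤ Real.exp (c₀ * s / 4) := by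
  have hl1 : 1 ≤ Real.log (2 * Real.exp 1 / c₀) := by
    rw [Real.le_log_iff_exp_le (by positivity), le_div_iff₀ hc]
    nlinarith [Real.exp_pos 1]
  constructor
  · refine le_trans ?_ hs
    rw [div_mul_eq_mul_div, le_div_iff₀ hc]
    nlinarith
  · have h2 : 2 * Real.log (2 * Real.exp 1 / c₀) ≤ c₀ * s / 4 := by
      rw [div_mul_eq_mul_div, div_le_iff₀ hc] at hs
      linarith
    refine le_trans ?_ (Real.exp_le_exp.2 h2)
    rw [mul_comm, Real.exp_mul, Real.exp_log (by positivity)]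
    rw [Real.rpow_ofNat, div_pow, div_le_div_iff₀ hc (by positivity)]
    have he := Real.exp_one_gt_d9
    have h3 : 8 ≤ (2 * Real.exp 1) ^ 2 := by nlinarith
    have h4 : c₀ ^ 2 ≤ c₀ := by nlinarith
    nlinarith

/-- Tail of the target measure outside the local region. -/
lemma integrable_tail_and_integral_le {c₀ s : ℝ} (hc : 0 < c₀) (hc1 : c₀ ≤ 1)
    (hs : 8 / c₀ * Real.log (2 * Real.exp 1 / c₀) ≤ s) (hV : 0 < Module.finrank ℝ V) :
    Integrable ({y : V | s * Real.sqrt (Module.finrank ℝ V) < ‖y‖}.indicator fun y =>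
        Real.exp (-(c₀ * Real.sqrt (Module.finrank ℝ V) / 2) * ‖y‖ + 1 / 2 * ‖y‖ ^ 2))
        (stdGaussian V) ∧
      ∫ y, {y : V | s * Real.sqrt (Module.finrank ℝ V) < ‖y‖}.indicator (fun y =>
        Real.exp (-(c₀ * Real.sqrt (Module.finrank ℝ V) / 2) * ‖y‖ + 1 / 2 * ‖y‖ ^ 2)) y
        ∂(stdGaussian V) ≤ Real.exp (-(c₀ * s * Module.finrank ℝ V / 8)) := by
  obtain ⟨hs8, hexp⟩ := radius_bounds hc hc1 hs
  set m := Module.finrank ℝ V with hm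
  set r := Real.sqrt (m : ℝ) with hr
  have hm0 : (0 : ℝ) < m := by exact_mod_cast hV
  have hr0 : 0 < r := Real.sqrt_pos.2 hm0
  have hrr : r * r = m := Real.mul_self_sqrt hm0.le
  -- The rate c₀r/2 is split: 3/8 is spent on ‖y‖ > s r and yields e^{-3c₀sm/8}, and 1/8 is kept for
  -- integrability. The resulting factor (8/c₀)^m costs at most e^{c₀sm/4}, leaving e^{-c₀sm/8}.
  set b := c₀ * r / 8 with hb
  have hb0 : 0 < b := by positivity
  obtain ⟨hi, hle⟩ := integrable_exp_neg_mul_norm_and_integral_le (V := V) hb0 hV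
  set N := (2 * Real.pi) ^ (-(m : ℝ) / 2) with hN
  have hN0 : 0 < N := by positivity
  have hpt : ∀ y : V, gaussDensity y * {y : V | s * r < ‖y‖}.indicator (fun y =>
      Real.exp (-(c₀ * r / 2) * ‖y‖ + 1 / 2 * ‖y‖ ^ 2)) y ≤
      N * Real.exp (-(3 / 8 * c₀ * s * m)) * Real.exp (-b * ‖y‖) := by
    intro y
    by_cases hy : y ∈ {y : V | s * r < ‖y‖}
    · rw [Set.indicator_of_mem hy, gaussDensity, mul_assoc, ← Real.exp_add, mul_assoc,
        ← Real.exp_add]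
      refine mul_le_mul_of_nonneg_left (Real.exp_le_exp.2 ?_) hN0.le
      have hy' : s * r < ‖y‖ := hy
      have : 3 / 8 * c₀ * r * (s * r) ≤ 3 / 8 * c₀ * r * ‖y‖ :=
        mul_le_mul_of_nonneg_left hy'.le (by positivity)
      have e : 3 / 8 * c₀ * r * (s * r) = 3 / 8 * c₀ * s * m := by rw [← hrr]; ring
      rw [hb]
      linarith
    · rw [Set.indicator_of_notMem hy]
      simp only [mul_zero]
      positivity
  have hnn : ∀ y : V, 0 ≤ gaussDensity y * {y : V | s * r < ‖y‖}.indicator (fun y =>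
      Real.exp (-(c₀ * r / 2) * ‖y‖ + 1 / 2 * ‖y‖ ^ 2)) y := fun y =>
    mul_nonneg (gaussDensity_pos y).le
      (Set.indicator_nonneg (fun _ _ => (Real.exp_pos _).le) _)
  have hdom := hi.const_mul (N * Real.exp (-(3 / 8 * c₀ * s * m)))
  have hint : Integrable fun y : V => gaussDensity y * {y : V | s * r < ‖y‖}.indicator (fun y =>
      Real.exp (-(c₀ * r / 2) * ‖y‖ + 1 / 2 * ‖y‖ ^ 2)) y := by
    refine hdom.mono' ?_ (Filter.Eventually.of_forall fun y => ?_)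
    · refine (continuous_gaussDensity.measurable.mul
        (Measurable.indicator (by fun_prop) (measurableSet_far _))).aestronglyMeasurable
    · rw [Real.norm_of_nonneg (hnn y)]; exact hpt y
  refine ⟨(integrable_stdGaussian_iff _).2 hint, ?_⟩
  rw [integral_stdGaussian]
  refine (integral_mono hint hdom hpt).trans ?_
  rw [integral_const_mul]
  -- Since 2π ≥ 4, the Gaussian normalization halves the base 16/c₀ of the volume bound.
  have hN2 : N ≤ (1 / 2) ^ m := by
    have e1 : N = ((2 * Real.pi) ^ (-(1 / 2) : ℝ)) ^ m := by
      rw [hN, ← Real.rpow_natCast, ← Real.rpow_mul (by positivity)]; ring_nf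
    rw [e1]
    refine pow_le_pow_left₀ (by positivity) ?_ m
    have e2 : (1 / 2 : ℝ) = (4 : ℝ) ^ (-(1 / 2) : ℝ) := by
      rw [show (4 : ℝ) = 2 ^ (2 : ℝ) by norm_num, ← Real.rpow_mul (by norm_num)]
      norm_num
    exact (Real.rpow_le_rpow_of_nonpos (by norm_num) (by linarith [Real.pi_gt_three])
      (by norm_num)).trans_eq e2.symm
  have hbase : 2 * r / b = 16 / c₀ := by rw [hb]; field_simp; norm_num
  rw [hbase] at hle
  calc N * Real.exp (-(3 / 8 * c₀ * s * m)) * ∫ y : V, Real.exp (-b * ‖y‖)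
      ≤ (1 / 2) ^ m * Real.exp (-(3 / 8 * c₀ * s * m)) * (16 / c₀) ^ m := by
        gcongr
    _ = Real.exp (-(3 / 8 * c₀ * s * m)) * (8 / c₀) ^ m := by
        rw [mul_right_comm, ← mul_pow, mul_comm]; congr 2; ring
    _ ≤ Real.exp (-(3 / 8 * c₀ * s * m)) * Real.exp (c₀ * s / 4) ^ m := by
        gcongr
    _ = Real.exp (-(c₀ * s * m / 8)) := by
        rw [← Real.exp_nat_mul, ← Real.exp_add]; congr 1; ring

end

section

/-! ### The expansion in normalized coordinates -/

/-- A density `w` with respect to the standard Gaussian measure that agrees with `exp S`, up to a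
quartic remainder, on the ball of radius `s √D`, and decays off that ball. -/
structure LocalExpansion {V : Type*} [NormedAddCommGroup V] [InnerProductSpace ℝ V]
    [MeasurableSpace V]
    (L : V →L[ℝ] V →L[ℝ] V →L[ℝ] ℝ) (B ε₃ ε₄ s c₀ : ℝ) (w : V → ℝ) : Prop where
  symm : IsSymmTrilin L
  finrank_pos : 0 < Module.finrank ℝ V
  ε₃_nonneg : 0 ≤ ε₃
  ε₃_le : ε₃ ≤ B
  ε₄_sq_le : ε₄ ^ 2 ≤ B ^ 2
  cubic_le : ∀ u, |L u u u| ≤ ε₃ / Module.finrank ℝ V * ‖u‖ ^ 3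
  c₀_pos : 0 < c₀
  c₀_le_one : c₀ ≤ 1
  radius_le : 8 / c₀ * Real.log (2 * Real.exp 1 / c₀) ≤ s
  measurable : Measurable w
  near : ∀ y, ‖y‖ ≤ s * Real.sqrt (Module.finrank ℝ V) →
    ∃ ρ, |ρ| ≤ ε₄ ^ 2 * ‖y‖ ^ 4 / (24 * (Module.finrank ℝ V : ℝ) ^ 2) ∧
      w y = Real.exp (cubicSkew L y + ρ)
  far : ∀ y, s * Real.sqrt (Module.finrank ℝ V) < ‖y‖ →
    0 ≤ w y ∧ w y ≤ Real.exp (-(c₀ * Real.sqrt (Module.finrank ℝ V)) * ‖y‖ + 1 / 2 * ‖y‖ ^ 2)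

variable {V : Type*} [NormedAddCommGroup V] [InnerProductSpace ℝ V] [FiniteDimensional ℝ V]
  [MeasurableSpace V] [BorelSpace V] {L : V →L[ℝ] V →L[ℝ] V →L[ℝ] ℝ}
  {B ε₃ ε₄ s c₀ : ℝ} {w : V → ℝ}

lemma LocalExpansion.nonneg (h : LocalExpansion L B ε₃ ε₄ s c₀ w) (y : V) : 0 ≤ w y := by
  rcases le_or_gt ‖y‖ (s * Real.sqrt (Module.finrank ℝ V)) with hy | hy
  · obtain ⟨ρ, _, hw⟩ := h.near y hy
    rw [hw]; positivity
  · exact (h.far y hy).1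

lemma LocalExpansion.one_add_skew_sq_le (h : LocalExpansion L B ε₃ ε₄ s c₀ w) (y : V) :
    (1 + cubicSkew L y) ^ 2 ≤ (2 + 12 * 36 ^ 3 * B ^ 2) * Real.exp (1 / 36 * ‖y‖ ^ 2) := by
  have hD1 : (1 : ℝ) ≤ Module.finrank ℝ V := by exact_mod_cast h.finrank_pos
  have h3 := h.ε₃_nonneg
  have h1 := abs_cubicSkew_le h.cubic_le y
  have h2 : ε₃ / Module.finrank ℝ V / 6 * ‖y‖ ^ 3 ≤ B * ‖y‖ ^ 3 := by
    refine mul_le_mul_of_nonneg_right ?_ (by positivity)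
    rw [div_div]
    exact (div_le_self h3 (by linarith)).trans h.ε₃_le
  have hS : cubicSkew L y ^ 2 ≤ B ^ 2 * (‖y‖ ^ 2) ^ 3 := by
    calc cubicSkew L y ^ 2 = |cubicSkew L y| ^ 2 := (sq_abs _).symm
      _ ≤ (B * ‖y‖ ^ 3) ^ 2 := pow_le_pow_left₀ (abs_nonneg _) (h1.trans h2) 2
      _ = _ := by ring
  have p : (‖y‖ ^ 2) ^ 3 ≤ 6 * 36 ^ 3 * Real.exp (1 / 36 * ‖y‖ ^ 2) := by
    have := pow_le_mul_exp_div 3 (a := 36) (by norm_num) (sq_nonneg ‖y‖)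
    rw [show 1 / 36 * ‖y‖ ^ 2 = ‖y‖ ^ 2 / 36 by ring]
    simpa [Nat.factorial] using this
  have e1 : 1 ≤ Real.exp (1 / 36 * ‖y‖ ^ 2) := Real.one_le_exp (by positivity)
  have h4 := mul_le_mul_of_nonneg_left p (sq_nonneg B)
  nlinarith [sq_nonneg (1 - cubicSkew L y)]

/-- The bound is stated as a square because Young's inequality later divides it by e^{-c₀sm/8}.
There is ample room: s ≥ 8 makes 2s²/9 - c₀s/4 at least 1/2. -/
lemma LocalExpansion.integral_far_le (h : LocalExpansion L B ε₃ ε₄ s c₀ w) :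
    ∫ y, {y : V | s * Real.sqrt (Module.finrank ℝ V) < ‖y‖}.indicator
      (fun y => Real.exp (1 / 36 * ‖y‖ ^ 2)) y ∂(stdGaussian V) ≤
      Real.exp (-(c₀ * s * Module.finrank ℝ V / 8)) ^ 2 := by
  obtain ⟨hs8, -⟩ := radius_bounds h.c₀_pos h.c₀_le_one h.radius_le
  have hc := h.c₀_pos
  have hc1 := h.c₀_le_one
  rw [integral_indicator (measurableSet_far _)]
  refine (setIntegral_exp_sq_le (by norm_num) (by positivity)).trans ?_
  rw [mul_pow, Real.sq_sqrt (by positivity), ← Real.exp_nat_mul]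
  have hcs : c₀ * s ≤ s := by nlinarith
  have := sqrt_two_pow_mul_exp_le (c := 2 / 9 * s ^ 2 - c₀ * s / 4) (by nlinarith)
    (Module.finrank ℝ V)
  set m := Module.finrank ℝ V
  calc Real.exp (-(1 / 4 - 1 / 36) * (s ^ 2 * m)) * Real.sqrt 2 ^ m
      = Real.exp (-(c₀ * s * m / 4)) *
          (Real.exp (-((2 / 9 * s ^ 2 - c₀ * s / 4) * m)) * Real.sqrt 2 ^ m) := by
        rw [← mul_assoc (Real.exp (-(c₀ * s * m / 4))), ← Real.exp_add]; congr 2; ring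
    _ ≤ Real.exp (-(c₀ * s * m / 4)) * 1 := by gcongr
    _ = _ := by rw [mul_one]; congr 1; push_cast; ring

/-- The integrand of the expansion is dominated pointwise. -/
lemma LocalExpansion.abs_mul_sub_le (h : LocalExpansion L B ε₃ ε₄ s c₀ w) {C : ℝ} {J f : V → ℝ}
    (hC : 0 < C) (hJ : IsDominating L C ε₃ ε₄ s J) {a δ : ℝ} (ha : 0 ≤ a) (hδ : 0 < δ)
    (hfa : ∀ y, |f y| ≤ a * Real.exp (c₀ * Real.sqrt (Module.finrank ℝ V) * ‖y‖ / 2)) (y : V) :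
    |f y * (w y - 1 - cubicSkew L y)| ≤
      C * (Real.exp ((ε₃ ^ 2 + ε₄ ^ 2) * s ^ 4) * (ε₃ ^ 2 + ε₄ ^ 2)) / 2 * (f y ^ 2 + J y ^ 2) +
      a * {y : V | s * Real.sqrt (Module.finrank ℝ V) < ‖y‖}.indicator (fun y =>
        Real.exp (-(c₀ * Real.sqrt (Module.finrank ℝ V) / 2) * ‖y‖ + 1 / 2 * ‖y‖ ^ 2)) y +
      (δ / 2 * f y ^ 2 + (2 + 12 * 36 ^ 3 * B ^ 2) / (2 * δ) *
        {y : V | s * Real.sqrt (Module.finrank ℝ V) < ‖y‖}.indicator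
          (fun y => Real.exp (1 / 36 * ‖y‖ ^ 2)) y) := by
  obtain ⟨hs8, -⟩ := radius_bounds h.c₀_pos h.c₀_le_one h.radius_le
  set P := Real.exp ((ε₃ ^ 2 + ε₄ ^ 2) * s ^ 4) * (ε₃ ^ 2 + ε₄ ^ 2) with hP
  have hP0 : 0 ≤ P := by positivity
  rcases le_or_gt ‖y‖ (s * Real.sqrt (Module.finrank ℝ V)) with hy | hy
  · have hnot : y ∉ {y : V | s * Real.sqrt (Module.finrank ℝ V) < ‖y‖} := not_lt.2 hy
    rw [Set.indicator_of_notMem hnot, Set.indicator_of_notMem hnot]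
    obtain ⟨ρ, hρ, hw⟩ := h.near y hy
    have hy2 : ‖y‖ ^ 2 ≤ s ^ 2 * Module.finrank ℝ V := by
      calc ‖y‖ ^ 2 ≤ (s * Real.sqrt (Module.finrank ℝ V)) ^ 2 :=
            pow_le_pow_left₀ (norm_nonneg _) hy 2
        _ = _ := by rw [mul_pow, Real.sq_sqrt (by positivity)]
    have h1 := hJ.error_le y ρ hy2 hρ
    rw [abs_mul, hw]
    have h2 : |f y| * J y ≤ (f y ^ 2 + J y ^ 2) / 2 := by
      rw [← sq_abs (f y)]
      nlinarith [sq_nonneg (|f y| - J y)]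
    have h3 : 0 ≤ δ / 2 * f y ^ 2 := by positivity
    have h4 : 0 ≤ C * P := by positivity
    calc _ ≤ |f y| * (C * P * J y) := mul_le_mul_of_nonneg_left h1 (abs_nonneg _)
      _ = C * P * (|f y| * J y) := by ring
      _ ≤ C * P * ((f y ^ 2 + J y ^ 2) / 2) := mul_le_mul_of_nonneg_left h2 h4
      _ ≤ _ := by linarith
  · have hmem : y ∈ {y : V | s * Real.sqrt (Module.finrank ℝ V) < ‖y‖} := hy
    rw [Set.indicator_of_mem hmem, Set.indicator_of_mem hmem]
    obtain ⟨hw0, hw⟩ := h.far y hy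
    set r := Real.sqrt (Module.finrank ℝ V)
    -- The growth of f uses up half of the decay rate c₀r of w.
    have h1 : |f y * w y| ≤ a * Real.exp (-(c₀ * r / 2) * ‖y‖ + 1 / 2 * ‖y‖ ^ 2) := by
      rw [abs_mul, abs_of_nonneg hw0]
      calc |f y| * w y ≤ (a * Real.exp (c₀ * r * ‖y‖ / 2)) *
            Real.exp (-(c₀ * r) * ‖y‖ + 1 / 2 * ‖y‖ ^ 2) :=
            mul_le_mul (hfa y) hw hw0 (by positivity)
        _ = _ := by rw [mul_assoc, ← Real.exp_add]; congr 2; ring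
    have h2 : |f y * (1 + cubicSkew L y)| ≤ δ / 2 * f y ^ 2 +
        (2 + 12 * 36 ^ 3 * B ^ 2) / (2 * δ) * Real.exp (1 / 36 * ‖y‖ ^ 2) := by
      have e1 := h.one_add_skew_sq_le y
      have e2 : |f y * (1 + cubicSkew L y)| ≤
          δ / 2 * f y ^ 2 + 1 / (2 * δ) * (1 + cubicSkew L y) ^ 2 := by
        rw [abs_mul, ← sq_abs (f y), ← sq_abs (1 + cubicSkew L y)]
        set p := |f y|
        set q := |1 + cubicSkew L y|
        have e3 : δ / 2 * p ^ 2 + 1 / (2 * δ) * q ^ 2 - p * q = (δ * p - q) ^ 2 / (2 * δ) := by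
          field_simp; ring
        have e4 : 0 ≤ (δ * p - q) ^ 2 / (2 * δ) := by positivity
        linarith
      have e5 : 1 / (2 * δ) * (1 + cubicSkew L y) ^ 2 ≤ (2 + 12 * 36 ^ 3 * B ^ 2) / (2 * δ) *
          Real.exp (1 / 36 * ‖y‖ ^ 2) := by
        rw [div_mul_eq_mul_div, div_mul_eq_mul_div, one_mul]
        gcongr
      linarith
    have h3 : 0 ≤ C * P / 2 * (f y ^ 2 + J y ^ 2) := by positivity
    have h4 : f y * (w y - 1 - cubicSkew L y) = f y * w y - f y * (1 + cubicSkew L y) := by ring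
    rw [h4]
    refine (abs_sub _ _).trans ?_
    linarith

lemma integrable_mul_of_sq {f g : V → ℝ} {μ : Measure V} (hf : Measurable f) (hg : Measurable g)
    (hf2 : Integrable (fun y => f y ^ 2) μ) (hg2 : Integrable (fun y => g y ^ 2) μ) :
    Integrable (fun y => f y * g y) μ := by
  refine (hf2.add hg2).mono' (hf.mul hg).aestronglyMeasurable
    (Filter.Eventually.of_forall fun y => ?_)
  rw [Real.norm_eq_abs, Pi.add_apply, abs_le]
  constructor <;> nlinarith [sq_nonneg (f y - g y), sq_nonneg (f y + g y)]

/-- First order expansion of the unnormalized integral of an observable. -/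
lemma LocalExpansion.abs_integral_sub_le (h : LocalExpansion L B ε₃ ε₄ s c₀ w) {C : ℝ}
    {J f : V → ℝ} (hC : 0 < C) (hJ : IsDominating L C ε₃ ε₄ s J) {a : ℝ} (ha : 0 ≤ a)
    (hf : Measurable f) (hf2 : Integrable (fun y => f y ^ 2) (stdGaussian V))
    (hf1 : ∫ y, f y ^ 2 ∂(stdGaussian V) ≤ 1)
    (hfa : ∀ y, |f y| ≤ a * Real.exp (c₀ * Real.sqrt (Module.finrank ℝ V) * ‖y‖ / 2)) :
    Integrable (fun y => f y * w y) (stdGaussian V) ∧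
    |∫ y, f y * w y ∂(stdGaussian V) - ∫ y, f y * (1 + cubicSkew L y) ∂(stdGaussian V)| ≤
      (C * (1 + C) + 12 * 36 ^ 3 * B ^ 2 + 5) *
        (Real.exp ((ε₃ ^ 2 + ε₄ ^ 2) * s ^ 4) * (ε₃ ^ 2 + ε₄ ^ 2) +
          max a 1 * Real.exp (-(c₀ * s * Module.finrank ℝ V / 8))) := by
  -- Taking the Young weight equal to the tail size balances δ∫f² against δ⁻¹∫U, because ∫U ≤ δ².
  set δ := Real.exp (-(c₀ * s * Module.finrank ℝ V / 8)) with hδ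
  have hδ0 : 0 < δ := Real.exp_pos _
  set P := Real.exp ((ε₃ ^ 2 + ε₄ ^ 2) * s ^ 4) * (ε₃ ^ 2 + ε₄ ^ 2) with hP
  have hP0 : 0 ≤ P := by positivity
  set Q := 2 + 12 * 36 ^ 3 * B ^ 2 with hQ
  have hQ0 : 0 < Q := by positivity
  obtain ⟨hTi, hTle⟩ := integrable_tail_and_integral_le (V := V) h.c₀_pos h.c₀_le_one h.radius_le
    h.finrank_pos
  set T := {y : V | s * Real.sqrt (Module.finrank ℝ V) < ‖y‖}.indicator (fun y =>
        Real.exp (-(c₀ * Real.sqrt (Module.finrank ℝ V) / 2) * ‖y‖ + 1 / 2 * ‖y‖ ^ 2))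
  have hUi := integrable_indicator_exp_sq (V := V) (b := 1 / 36) (by norm_num)
    (s * Real.sqrt (Module.finrank ℝ V))
  have hUle := h.integral_far_le
  set U := {y : V | s * Real.sqrt (Module.finrank ℝ V) < ‖y‖}.indicator
          (fun y => Real.exp (1 / 36 * ‖y‖ ^ 2))
  have hSm : Measurable (cubicSkew L) := (PolyGrowth.cubicSkew L).1.measurable
  have hdom : ∀ y, |f y * (w y - 1 - cubicSkew L y)| ≤ C * P / 2 * (f y ^ 2 + J y ^ 2) +
      a * T y + (δ / 2 * f y ^ 2 + Q / (2 * δ) * U y) := fun y =>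
    h.abs_mul_sub_le hC hJ ha hδ0 hfa y
  have i1 : Integrable (fun y => C * P / 2 * (f y ^ 2 + J y ^ 2)) (stdGaussian V) :=
    (hf2.add hJ.integrable_sq).const_mul _
  have i2 : Integrable (fun y => a * T y) (stdGaussian V) := hTi.const_mul _
  have i3 : Integrable (fun y => δ / 2 * f y ^ 2) (stdGaussian V) := hf2.const_mul _
  have i4 : Integrable (fun y => Q / (2 * δ) * U y) (stdGaussian V) := hUi.const_mul _
  have i12 : Integrable (fun y => C * P / 2 * (f y ^ 2 + J y ^ 2) + a * T y) (stdGaussian V) :=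
    i1.add i2
  have i34 : Integrable (fun y => δ / 2 * f y ^ 2 + Q / (2 * δ) * U y) (stdGaussian V) :=
    i3.add i4
  have iR : Integrable (fun y => C * P / 2 * (f y ^ 2 + J y ^ 2) +
      a * T y + (δ / 2 * f y ^ 2 + Q / (2 * δ) * U y)) (stdGaussian V) := i12.add i34
  have iD : Integrable (fun y => f y * (w y - 1 - cubicSkew L y)) (stdGaussian V) :=
    iR.mono' (hf.mul ((h.measurable.sub_const 1).sub hSm)).aestronglyMeasurable
      (Filter.Eventually.of_forall hdom)
  have hS2 : Integrable (fun y => (1 + cubicSkew L y) ^ 2) (stdGaussian V) := by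
    refine (((PolyGrowth.const 1).add (PolyGrowth.cubicSkew L)).mul
      ((PolyGrowth.const 1).add (PolyGrowth.cubicSkew L))).integrable.congr
      (Filter.Eventually.of_forall fun y => ?_)
    simp only; ring
  have i5 : Integrable (fun y => f y * (1 + cubicSkew L y)) (stdGaussian V) :=
    integrable_mul_of_sq hf (hSm.const_add 1) hf2 hS2
  have hfw : ∀ y, f y * w y = f y * (w y - 1 - cubicSkew L y) + f y * (1 + cubicSkew L y) :=
    fun y => by ring
  have iW : Integrable (fun y => f y * w y) (stdGaussian V) :=
    (iD.add i5).congr (Filter.Eventually.of_forall fun y => (hfw y).symm)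
  refine ⟨iW, ?_⟩
  rw [← integral_sub iW i5]
  have e1 : ∀ y, f y * w y - f y * (1 + cubicSkew L y) = f y * (w y - 1 - cubicSkew L y) :=
    fun y => by ring
  simp_rw [e1]
  refine (abs_integral_le_integral_abs).trans ((integral_mono iD.abs iR hdom).trans ?_)
  rw [integral_add i12 i34, integral_add i1 i2, integral_add i3 i4,
    integral_const_mul, integral_const_mul, integral_const_mul, integral_const_mul,
    integral_add hf2 hJ.integrable_sq]
  have hmax1 : a ≤ max a 1 := le_max_left _ _
  have hmax2 : 1 ≤ max a 1 := le_max_right _ _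
  set M := max a 1
  have b1 : C * P / 2 * (∫ y, f y ^ 2 ∂(stdGaussian V) + ∫ y, J y ^ 2 ∂(stdGaussian V)) ≤
      C * P / 2 * (1 + C) :=
    mul_le_mul_of_nonneg_left (add_le_add hf1 hJ.integral_sq_le) (by positivity)
  have b2 : a * ∫ y, T y ∂(stdGaussian V) ≤ M * δ :=
    (mul_le_mul_of_nonneg_left hTle ha).trans (mul_le_mul_of_nonneg_right hmax1 hδ0.le)
  have b3 : δ / 2 * ∫ y, f y ^ 2 ∂(stdGaussian V) ≤ M * δ := by
    have := mul_le_mul_of_nonneg_left hf1 (by positivity : 0 ≤ δ / 2)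
    nlinarith
  have b4 : Q / (2 * δ) * ∫ y, U y ∂(stdGaussian V) ≤ Q / 2 * (M * δ) := by
    calc Q / (2 * δ) * ∫ y, U y ∂(stdGaussian V) ≤ Q / (2 * δ) * δ ^ 2 :=
          mul_le_mul_of_nonneg_left hUle (by positivity)
      _ = Q / 2 * (1 * δ) := by field_simp
      _ ≤ _ := by gcongr
  have hMδ : 0 ≤ M * δ := by positivity
  have c1 : 0 ≤ (C * (1 + C) / 2 + Q + 3) * P := by positivity
  have c2 : 0 ≤ (C * (1 + C) + Q / 2 + 1) * (M * δ) := by positivity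
  have c3 : (C * (1 + C) + 12 * 36 ^ 3 * B ^ 2 + 5) = C * (1 + C) + Q + 3 := by rw [hQ]; ring
  rw [c3]
  nlinarith

end

section

/-! ### Expansion of normalized integrals -/

section

variable {V : Type*} [NormedAddCommGroup V] [InnerProductSpace ℝ V] [FiniteDimensional ℝ V]
  [MeasurableSpace V] [BorelSpace V] {L : V →L[ℝ] V →L[ℝ] V →L[ℝ] ℝ}
  {B ε₃ ε₄ s c₀ : ℝ} {w : V → ℝ}

/-- The complement has mass at most e^{-m}√2^m ≤ e^{-m/2} ≤ e^{-1/2} ≤ 2/3, where m ≥ 1 is the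
dimension. -/
lemma measureReal_norm_le_two_sqrt (hD : 0 < Module.finrank ℝ V) :
    1 / 3 ≤ (stdGaussian V).real {y : V | ‖y‖ ≤ 2 * Real.sqrt (Module.finrank ℝ V)} := by
  have hD1 : (1 : ℝ) ≤ Module.finrank ℝ V := by exact_mod_cast hD
  have h1 := setIntegral_exp_sq_le (V := V) (b := 0) (R := 2 * Real.sqrt (Module.finrank ℝ V))
    (by norm_num) (by positivity)
  have h2 := sqrt_two_pow_mul_exp_le (c := 1 / 2) le_rfl (Module.finrank ℝ V)
  have hc : {y : V | ‖y‖ ≤ 2 * Real.sqrt (Module.finrank ℝ V)} =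
      {y : V | 2 * Real.sqrt (Module.finrank ℝ V) < ‖y‖}ᶜ := by
    ext y; simp
  rw [hc, probReal_compl_eq_one_sub (measurableSet_far _)]
  simp only [zero_mul, Real.exp_zero, integral_const, smul_eq_mul, mul_one,
    measureReal_restrict_apply_univ, mul_pow, Real.sq_sqrt (Nat.cast_nonneg _)] at h1
  set m := Module.finrank ℝ V
  have h3 : Real.exp (-(1 / 4 - 0) * (2 ^ 2 * (m : ℝ))) * Real.sqrt 2 ^ m ≤
      Real.exp (-(1 / 2)) := by
    calc Real.exp (-(1 / 4 - 0) * (2 ^ 2 * (m : ℝ))) * Real.sqrt 2 ^ m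
        = Real.exp (-(1 / 2 * (m : ℝ))) * (Real.exp (-(1 / 2 * m)) * Real.sqrt 2 ^ m) := by
          rw [← mul_assoc (Real.exp (-(1 / 2 * (m : ℝ)))), ← Real.exp_add]; congr 2; ring
      _ ≤ Real.exp (-(1 / 2)) * 1 := by
          gcongr
          linarith
      _ = _ := mul_one _
  have h4 : Real.exp (-(1 / 2 : ℝ)) ≤ 2 / 3 := by
    rw [Real.exp_neg, inv_le_comm₀ (Real.exp_pos _) (by norm_num)]
    have := Real.add_one_le_exp (1 / 2 : ℝ)
    norm_num at this ⊢
    linarith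
  linarith

/-- The normalizing constant is bounded below. -/
lemma LocalExpansion.le_integral (h : LocalExpansion L B ε₃ ε₄ s c₀ w)
    (hw : Integrable w (stdGaussian V)) :
    Real.exp (-B ^ 2) / 3 ≤ ∫ y, w y ∂(stdGaussian V) := by
  obtain ⟨hs8, -⟩ := radius_bounds h.c₀_pos h.c₀_le_one h.radius_le
  have hD1 : (1 : ℝ) ≤ Module.finrank ℝ V := by exact_mod_cast h.finrank_pos
  set K := {y : V | ‖y‖ ≤ 2 * Real.sqrt (Module.finrank ℝ V)} with hK
  have hKm : MeasurableSet K := measurableSet_le (by fun_prop) (by fun_prop)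
  -- Only the ball of radius 2√D is kept; there |ρ| ≤ 16ε₄²/24 ≤ B², and e^S ≥ 1 + S. The odd cubic
  -- term integrates to zero over this symmetric set, so no smallness of ε₃ is needed.
  have hpt : ∀ y, Real.exp (-B ^ 2) * (K.indicator 1 y + K.indicator (cubicSkew L) y) ≤ w y := by
    intro y
    by_cases hy : y ∈ K
    · rw [Set.indicator_of_mem hy, Set.indicator_of_mem hy, Pi.one_apply]
      have hy' : ‖y‖ ≤ 2 * Real.sqrt (Module.finrank ℝ V) := hy
      obtain ⟨ρ, hρ, hwy⟩ := h.near y (hy'.trans (by gcongr; linarith))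
      have hρ' : |ρ| ≤ B ^ 2 := by
        refine hρ.trans ?_
        rw [div_le_iff₀ (by positivity)]
        have h4 : ‖y‖ ^ 4 ≤ 16 * (Module.finrank ℝ V : ℝ) ^ 2 := by
          calc ‖y‖ ^ 4 ≤ (2 * Real.sqrt (Module.finrank ℝ V)) ^ 4 :=
                pow_le_pow_left₀ (norm_nonneg _) hy' 4
            _ = 16 * (Real.sqrt (Module.finrank ℝ V) ^ 2) ^ 2 := by ring
            _ = _ := by rw [Real.sq_sqrt (by positivity)]
        have := mul_le_mul h.ε₄_sq_le h4 (by positivity) (by positivity)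
        have h5 : 0 ≤ B ^ 2 * (Module.finrank ℝ V : ℝ) ^ 2 := by positivity
        linarith
      rw [hwy, add_comm (cubicSkew L y) ρ, Real.exp_add]
      have e1 : Real.exp (-B ^ 2) ≤ Real.exp ρ := Real.exp_le_exp.2 (by
        have := (abs_le.1 hρ').1; linarith)
      have e2 := Real.add_one_le_exp (cubicSkew L y)
      calc Real.exp (-B ^ 2) * (1 + cubicSkew L y)
          ≤ Real.exp (-B ^ 2) * Real.exp (cubicSkew L y) := by gcongr; linarith
        _ ≤ _ := by gcongr
    · rw [Set.indicator_of_notMem hy, Set.indicator_of_notMem hy]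
      simpa using h.nonneg y
  have i1 : Integrable (K.indicator (1 : V → ℝ)) (stdGaussian V) :=
    (integrable_const (1 : ℝ)).indicator hKm
  have i2 : Integrable (K.indicator (cubicSkew L)) (stdGaussian V) :=
    (PolyGrowth.cubicSkew L).integrable.indicator hKm
  have hodd : ∫ y, K.indicator (cubicSkew L) y ∂(stdGaussian V) = 0 := by
    refine integral_eq_zero_of_odd fun y => ?_
    by_cases hy : y ∈ K
    · have hy' : -y ∈ K := by simpa [hK] using hy
      rw [Set.indicator_of_mem hy, Set.indicator_of_mem hy', cubicSkew_neg]
    · have hy' : -y ∉ K := by simpa [hK] using hy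
      rw [Set.indicator_of_notMem hy, Set.indicator_of_notMem hy', neg_zero]
  have := integral_mono ((i1.add i2).const_mul (Real.exp (-B ^ 2))) hw hpt
  simp only [Pi.add_apply] at this
  rw [integral_const_mul, integral_add i1 i2, hodd, add_zero, integral_indicator_one hKm] at this
  have h3 := measureReal_norm_le_two_sqrt (V := V) h.finrank_pos
  have h4 := mul_le_mul_of_nonneg_left h3 (Real.exp_pos (-B ^ 2)).le
  linarith

/-- A crude bound suffices here: it controls the limit value when passing to the quotient by ∫ w.
The sharp bound by εbar₃ is obtained separately. -/
lemma IsDominating.abs_integral_mul_skew_le {C : ℝ} {J f : V → ℝ}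
    (hJ : IsDominating L C ε₃ ε₄ s J) (hf : Measurable f)
    (hf2 : Integrable (fun y => f y ^ 2) (stdGaussian V))
    (hf1 : ∫ y, f y ^ 2 ∂(stdGaussian V) ≤ 1) :
    Integrable (fun y => f y * cubicSkew L y) (stdGaussian V) ∧
      |∫ y, f y * cubicSkew L y ∂(stdGaussian V)| ≤ (1 + C ^ 2 * C) / 2 := by
  have hSm : Measurable (cubicSkew L) := (PolyGrowth.cubicSkew L).1.measurable
  have hS2 : Integrable (fun y => cubicSkew L y ^ 2) (stdGaussian V) :=
    ((PolyGrowth.cubicSkew L).mul (PolyGrowth.cubicSkew L)).integrable.congr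
      (Filter.Eventually.of_forall fun y => by simp only; ring)
  have i1 := integrable_mul_of_sq hf hSm hf2 hS2
  refine ⟨i1, ?_⟩
  have i2 : Integrable (fun y => C ^ 2 / 2 * J y ^ 2) (stdGaussian V) :=
    hJ.integrable_sq.const_mul _
  have i3 : Integrable (fun y => 1 / 2 * f y ^ 2) (stdGaussian V) := hf2.const_mul _
  have hpt : ∀ y, |f y * cubicSkew L y| ≤ 1 / 2 * f y ^ 2 + C ^ 2 / 2 * J y ^ 2 := by
    intro y
    have h1 : cubicSkew L y ^ 2 ≤ (C * J y) ^ 2 := by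
      rw [← sq_abs]; exact pow_le_pow_left₀ (abs_nonneg _) (hJ.skew_le y) 2
    rw [abs_mul, ← sq_abs (f y)]
    rw [← sq_abs] at h1
    nlinarith [sq_nonneg (|f y| - |cubicSkew L y|)]
  refine abs_integral_le_integral_abs.trans ((integral_mono i1.abs (i3.add i2) hpt).trans ?_)
  simp only [Pi.add_apply]
  rw [integral_add i3 i2, integral_const_mul, integral_const_mul]
  have := mul_le_mul_of_nonneg_left hJ.integral_sq_le (by positivity : 0 ≤ C ^ 2 / 2)
  linarith

end

lemma abs_div_sub_le {N D T c r t : ℝ} (hc : 0 < c) (hD : c ≤ D) (h1 : |N - T| ≤ r)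
    (h2 : |D - 1| ≤ r) (ht : |T| ≤ t) : |N / D - T| ≤ (1 + t) / c * r := by
  have hD0 : 0 < D := hc.trans_le hD
  have hr : 0 ≤ r := (abs_nonneg _).trans h1
  have ht0 : 0 ≤ t := (abs_nonneg _).trans ht
  have e : N / D - T = ((N - T) - T * (D - 1)) / D := by field_simp; ring
  rw [e, abs_div, abs_of_pos hD0, div_mul_eq_mul_div]
  refine div_le_div₀ (by positivity) ?_ hc hD
  refine (abs_sub _ _).trans ?_
  rw [abs_mul]
  have := mul_le_mul ht h2 (abs_nonneg _) ht0
  linarith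

/-- First order expansion of the normalized integral of a standardized observable. -/
theorem exists_abs_ratio_sub_le {B : ℝ} (hB : 0 ≤ B) : ∃ K : ℝ, 0 < K ∧
    ∀ {V : Type*} [NormedAddCommGroup V] [InnerProductSpace ℝ V] [FiniteDimensional ℝ V]
      [MeasurableSpace V] [BorelSpace V] {L : V →L[ℝ] V →L[ℝ] V →L[ℝ] ℝ}
      {ε₃ ε₄ s c₀ : ℝ} {w : V → ℝ}, LocalExpansion L B ε₃ ε₄ s c₀ w →
      ∀ {f : V → ℝ} {a : ℝ}, 0 ≤ a → Measurable f →
      Integrable (fun y => f y ^ 2) (stdGaussian V) →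
      ∫ y, f y ^ 2 ∂(stdGaussian V) ≤ 1 →
      Integrable f (stdGaussian V) → ∫ y, f y ∂(stdGaussian V) = 0 →
      (∀ y, |f y| ≤ a * Real.exp (c₀ * Real.sqrt (Module.finrank ℝ V) * ‖y‖ / 2)) →
      Integrable w (stdGaussian V) ∧ 0 < ∫ y, w y ∂(stdGaussian V) ∧
      Integrable (fun y => f y * w y) (stdGaussian V) ∧
      Integrable (fun y => f y * cubicSkew L y) (stdGaussian V) ∧
      |(∫ y, f y * w y ∂(stdGaussian V)) / (∫ y, w y ∂(stdGaussian V)) -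
          ∫ y, f y * cubicSkew L y ∂(stdGaussian V)| ≤
        K * (Real.exp ((ε₃ ^ 2 + ε₄ ^ 2) * s ^ 4) * (ε₃ ^ 2 + ε₄ ^ 2) +
          max a 1 * Real.exp (-(c₀ * s * Module.finrank ℝ V / 8))) := by
  obtain ⟨C, hC, hdomi⟩ := exists_isDominating hB
  refine ⟨(1 + (1 + C ^ 2 * C) / 2) / (Real.exp (-B ^ 2) / 3) *
    (C * (1 + C) + 12 * 36 ^ 3 * B ^ 2 + 5), by positivity, ?_⟩
  intro V _ _ _ _ _ L ε₃ ε₄ s c₀ w h f a ha hf hf2 hf1 hfi hf0 hfa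
  obtain ⟨J, hJ⟩ := hdomi (s := s) h.symm h.finrank_pos h.ε₃_nonneg h.ε₃_le h.ε₄_sq_le h.cubic_le
  have hc := h.c₀_pos
  obtain ⟨a1, a2⟩ := h.abs_integral_sub_le hC hJ ha hf hf2 hf1 hfa
  -- The normalizing constant is the case f = 1 of the same expansion; the odd cubic term drops out,
  -- so ∫ w is 1 up to the same error.
  obtain ⟨b1, b2⟩ := h.abs_integral_sub_le (f := fun _ => 1) hC hJ zero_le_one measurable_const
    (by simp) (by simp) (fun y => by
      rw [abs_one, one_mul]; exact Real.one_le_exp (by positivity))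
  obtain ⟨i1, i2⟩ := hJ.abs_integral_mul_skew_le hf hf2 hf1
  simp only [one_mul, max_self] at b1 b2
  have hSi : Integrable (cubicSkew L) (stdGaussian V) := (PolyGrowth.cubicSkew L).integrable
  rw [integral_add (integrable_const _) hSi, integral_eq_zero_of_odd cubicSkew_neg] at b2
  simp only [integral_const, probReal_univ, smul_eq_mul, mul_one, add_zero] at b2
  simp only [mul_add, mul_one] at a2
  rw [integral_add hfi i1, hf0, zero_add] at a2
  have hlow := h.le_integral b1
  have hcpos : 0 < Real.exp (-B ^ 2) / 3 := by positivity
  refine ⟨b1, hcpos.trans_le hlow, a1, i1, ?_⟩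
  rw [mul_assoc]
  refine abs_div_sub_le hcpos hlow (a2.trans_eq (by ring)) (b2.trans ?_) i2
  gcongr
  nlinarith [le_max_right a 1, Real.exp_pos (-(c₀ * s * Module.finrank ℝ V / 8))]

end

section

/-! ### Affine change of variables -/

section

variable {V : Type*} [NormedAddCommGroup V] [InnerProductSpace ℝ V] [FiniteDimensional ℝ V]
  [MeasurableSpace V] [BorelSpace V]

/-- The image is again a Haar measure, hence a multiple of volume. The multiple cancels when the
target is normalized, so its value is never needed. -/
lemma exists_map_affine_volume (x₀ : V) (e : V ≃L[ℝ] V) :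
    ∃ c : ENNReal, c ≠ 0 ∧ c ≠ ⊤ ∧
      (volume : Measure V).map (fun y => x₀ + e y) = c • (volume : Measure V) := by
  have h1 : (volume : Measure V).map (fun y => x₀ + e y) = (volume : Measure V).map e := by
    rw [show (fun y => x₀ + e y) = (fun z => x₀ + z) ∘ e from rfl,
      ← Measure.map_map (by fun_prop) (by fun_prop)]
    have := e.isAddHaarMeasure_map (volume : Measure V)
    exact map_add_left_eq_self _ _
  have h2 := e.isAddHaarMeasure_map (volume : Measure V)
  refine ⟨_, ?_, ?_, h1.trans (Measure.isAddLeftInvariant_eq_smul _ volume)⟩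
  · simpa using (Measure.addHaarScalarFactor_pos_of_isAddHaarMeasure
      ((volume : Measure V).map e) volume).ne'
  · simp

/-- A measure with a density, as the image of a reweighted standard Gaussian measure. -/
lemma exists_withDensity_eq_smul_map (x₀ : V) (e : V ≃L[ℝ] V) {h : V → ℝ} (hm : Measurable h)
    {κ : ℝ} (hκ : 0 < κ) : ∃ c : ENNReal, c ≠ 0 ∧ c ≠ ⊤ ∧
      (volume : Measure V).withDensity (fun x => ENNReal.ofReal (h x)) =
        c • ((stdGaussian V).withDensity (fun y => ENNReal.ofReal
          (h (x₀ + e y) * (κ * Real.exp (‖y‖ ^ 2 / 2))))).map (fun y => x₀ + e y) := by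
  obtain ⟨c, hc0, hct, hc⟩ := exists_map_affine_volume x₀ e
  set t : ℝ := (2 * Real.pi) ^ (-(Module.finrank ℝ V : ℝ) / 2) * κ with ht
  have ht0 : 0 < t := by positivity
  have hφ : Measurable (fun y : V => x₀ + e y) := by fun_prop
  have hw : Measurable (fun y : V => ENNReal.ofReal
      (h (x₀ + e y) * (κ * Real.exp (‖y‖ ^ 2 / 2)))) := by fun_prop
  have hT : ENNReal.ofReal t ≠ 0 := by simpa using ht0
  refine ⟨(ENNReal.ofReal t)⁻¹ * c⁻¹, ?_, ?_, ?_⟩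
  · exact mul_ne_zero (by simp) (by simpa using hct)
  · exact ENNReal.mul_ne_top (by simpa using ht0) (by simpa using hc0)
  ext s hs
  have key : ∀ y : V, ENNReal.ofReal (gaussDensity y) *
      ENNReal.ofReal (h (x₀ + e y) * (κ * Real.exp (‖y‖ ^ 2 / 2))) =
      ENNReal.ofReal t * ENNReal.ofReal (h (x₀ + e y)) := by
    intro y
    rw [← ENNReal.ofReal_mul (gaussDensity_pos y).le, ← ENNReal.ofReal_mul ht0.le]
    congr 1
    have : Real.exp (-(1 / 2) * ‖y‖ ^ 2) * Real.exp (‖y‖ ^ 2 / 2) = 1 := by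
      rw [← Real.exp_add]; simp; ring
    rw [gaussDensity, ht]
    linear_combination ((2 * Real.pi) ^ (-(Module.finrank ℝ V : ℝ) / 2) * κ * h (x₀ + e y)) * this
  have hg : Measurable (fun y : V => ENNReal.ofReal (gaussDensity y)) :=
    continuous_gaussDensity.measurable.ennreal_ofReal
  rw [Measure.smul_apply, Measure.map_apply hφ hs, stdGaussian_eq_withDensity,
    ← withDensity_mul _ hg hw, withDensity_apply _ (hφ hs), withDensity_apply _ hs]
  simp only [Pi.mul_apply, key]
  rw [lintegral_const_mul _ (by fun_prop), ← setLIntegral_map hs hm.ennreal_ofReal hφ, hc,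
    Measure.restrict_smul, lintegral_smul_measure, smul_eq_mul, smul_eq_mul]
  rw [mul_mul_mul_comm, ← mul_assoc, mul_assoc, ← mul_assoc c⁻¹,
    ENNReal.inv_mul_cancel hc0 hct, one_mul,
    ENNReal.inv_mul_cancel hT (by simp), one_mul]

/-- Normalizing a measure that is a multiple of the image of a reweighted measure. -/
lemma normalized_map_withDensity {γ μ : Measure V} {φ : V → V} (hφ : Measurable φ) {w : V → ℝ}
    (hwm : Measurable w) (hw0 : ∀ y, 0 ≤ w y) (hwi : Integrable w γ) (hpos : 0 < ∫ y, w y ∂γ)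
    {c : ENNReal} (hc0 : c ≠ 0) (hct : c ≠ ⊤)
    (hμ : μ = c • (γ.withDensity (fun y => ENNReal.ofReal (w y))).map φ) :
    IsProbabilityMeasure ((μ Set.univ)⁻¹ • μ) ∧
      ∀ g : V → ℝ, Measurable g → Integrable (fun y => g (φ y) * w y) γ →
        Integrable g ((μ Set.univ)⁻¹ • μ) ∧
        ∫ x, g x ∂((μ Set.univ)⁻¹ • μ) = (∫ y, g (φ y) * w y ∂γ) / ∫ y, w y ∂γ := by
  set m := ∫ y, w y ∂γ with hmdef
  have huniv : μ Set.univ = c * ENNReal.ofReal m := by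
    rw [hμ, Measure.smul_apply, Measure.map_apply hφ MeasurableSet.univ, Set.preimage_univ,
      withDensity_apply _ MeasurableSet.univ, Measure.restrict_univ, smul_eq_mul,
      ← ofReal_integral_eq_lintegral_ofReal hwi (Filter.Eventually.of_forall hw0)]
  have hm0 : ENNReal.ofReal m ≠ 0 := by simpa using hpos
  have hμ0 : μ Set.univ ≠ 0 := by rw [huniv]; exact mul_ne_zero hc0 hm0
  have hμt : μ Set.univ ≠ ⊤ := by
    rw [huniv]; exact ENNReal.mul_ne_top hct ENNReal.ofReal_ne_top
  have hπ : (μ Set.univ)⁻¹ • μ =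
      (ENNReal.ofReal m)⁻¹ • (γ.withDensity (fun y => ENNReal.ofReal (w y))).map φ := by
    rw [huniv, hμ, smul_smul, ENNReal.mul_inv (Or.inl hc0) (Or.inl hct), mul_comm c⁻¹, mul_assoc,
      ENNReal.inv_mul_cancel hc0 hct, mul_one]
  refine ⟨⟨?_⟩, fun g hg hgi => ?_⟩
  · rw [Measure.smul_apply, smul_eq_mul, ENNReal.inv_mul_cancel hμ0 hμt]
  have hwm' : Measurable (fun y => ENNReal.ofReal (w y)) := hwm.ennreal_ofReal
  have htop : ∀ᵐ y ∂γ, ENNReal.ofReal (w y) < ⊤ :=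
    Filter.Eventually.of_forall fun y => ENNReal.ofReal_lt_top
  have e1 : ∀ y, (ENNReal.ofReal (w y)).toReal • g (φ y) = g (φ y) * w y := fun y => by
    rw [ENNReal.toReal_ofReal (hw0 y), smul_eq_mul, mul_comm]
  rw [hπ]
  constructor
  · refine Integrable.smul_measure ?_ (by simpa using hpos)
    rw [integrable_map_measure hg.aestronglyMeasurable hφ.aemeasurable,
      integrable_withDensity_iff_integrable_smul' hwm' htop]
    simpa only [Function.comp_apply, e1] using hgi
  · rw [integral_smul_measure, integral_map hφ.aemeasurable hg.aestronglyMeasurable,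
      integral_withDensity_eq_integral_toReal_smul hwm' htop]
    simp only [e1]
    rw [ENNReal.toReal_inv, ENNReal.toReal_ofReal hpos.le, smul_eq_mul, inv_mul_eq_div]

end

end

section

/-! ### Taylor expansion of the rescaled potential -/

section

variable {V : Type*} [NormedAddCommGroup V] [InnerProductSpace ℝ V] [FiniteDimensional ℝ V]

/-- The third derivative at the origin as an iterated linear map. -/
def thirdForm (W : V → ℝ) : V →L[ℝ] V →L[ℝ] V →L[ℝ] ℝ :=
  fderiv ℝ (fderiv ℝ (fderiv ℝ W)) 0

lemma thirdForm_apply (W : V → ℝ) (a b c : V) :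
    thirdForm W a b c = iteratedFDeriv ℝ 3 W 0 ![a, b, c] := by
  rw [iteratedFDeriv_succ_apply_right, iteratedFDeriv_succ_apply_right,
    iteratedFDeriv_succ_apply_right]
  simp [Fin.init, thirdForm]

/-- Exchanging the first two slots is the symmetry of second derivatives for `fderiv ℝ W`. For the
last two, the second derivative of W is symmetric throughout a neighbourhood of 0, and this identity
is differentiated. -/
lemma isSymmTrilin_thirdForm {W : V → ℝ} (hW : ContDiffAt ℝ 3 W 0) :
    IsSymmTrilin (thirdForm W) := by
  have h1 : ContDiffAt ℝ 2 (fderiv ℝ W) 0 := hW.fderiv_right (by norm_num)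
  have h2 : ContDiffAt ℝ 1 (fderiv ℝ (fderiv ℝ W)) 0 := h1.fderiv_right (by norm_num)
  constructor
  · intro a b c
    have := (h1.isSymmSndFDerivAt (by simp)).eq a b
    exact congrArg (fun ℓ : V →L[ℝ] ℝ => ℓ c) this
  · intro a b c
    have hD : HasFDerivAt (fderiv ℝ (fderiv ℝ W)) (thirdForm W) 0 :=
      (h2.differentiableAt (by norm_num)).hasFDerivAt
    have e1 : ∀ p q : V, HasFDerivAt (fun x => fderiv ℝ (fderiv ℝ W) x p q)
        (((ContinuousLinearMap.apply ℝ ℝ q).comp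
          (ContinuousLinearMap.apply ℝ (V →L[ℝ] ℝ) p)).comp (thirdForm W)) 0 := fun p q =>
      ((ContinuousLinearMap.apply ℝ ℝ q).comp
          (ContinuousLinearMap.apply ℝ (V →L[ℝ] ℝ) p)).hasFDerivAt.comp 0 hD
    have e2 : (fun x => fderiv ℝ (fderiv ℝ W) x b c) =ᶠ[nhds 0]
        fun x => fderiv ℝ (fderiv ℝ W) x c b := by
      filter_upwards [hW.eventually (by norm_num)] with x hx
      exact (hx.isSymmSndFDerivAt (by norm_num)).eq b c
    have := ((e1 c b).congr_of_eventuallyEq e2).unique (e1 b c)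
    have := congrArg (fun ℓ : V →L[ℝ] ℝ => ℓ a) this
    simpa using this.symm

/-- The integral remainder contributes 1/3! times ∫₀¹ (1-t)³ dt = 1/4. It involves only the fourth
derivative on the diagonal, which is what `tnorm` controls. -/
lemma abs_taylor_sub_le {W : V → ℝ} {y : V} {M : ℝ}
    (hf : ∀ t ∈ Set.Icc (0 : ℝ) 1, ContDiffAt ℝ 4 W (t • y))
    (hM : ∀ t ∈ Set.Icc (0 : ℝ) 1, |iteratedFDeriv ℝ 4 W (t • y) (fun _ => y)| ≤ M) :
    |W y - W 0 - fderiv ℝ W 0 y - 1 / 2 * iteratedFDeriv ℝ 2 W 0 (fun _ => y) -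
      1 / 6 * iteratedFDeriv ℝ 3 W 0 (fun _ => y)| ≤ M / 24 := by
  have h := map_add_eq_sum_add_integral_iteratedFDeriv (f := W) (x := 0) (y := y) (n := 3)
    (fun t ht => by
      have := hf t ht
      rw [zero_add]; norm_num; exact this)
  simp only [zero_add, Finset.sum_range_succ, Finset.sum_range_zero, Nat.factorial,
    iteratedFDeriv_zero_apply, iteratedFDeriv_one_apply, smul_eq_mul] at h
  norm_num at h
  have hI : |∫ t in (0 : ℝ)..1, (1 - t) ^ 3 * iteratedFDeriv ℝ 4 W (t • y) (fun _ => y)| ≤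
      M / 4 := by
    have h1 := intervalIntegral.norm_integral_le_of_norm_le (μ := volume) (a := (0 : ℝ)) (b := 1)
      (f := fun t => (1 - t) ^ 3 * iteratedFDeriv ℝ 4 W (t • y) (fun _ => y))
      (g := fun t => (1 - t) ^ 3 * M) zero_le_one
      (Filter.Eventually.of_forall fun t ht => by
        have h0 : 0 ≤ (1 - t) ^ 3 := pow_nonneg (by linarith [ht.2]) 3
        rw [Real.norm_eq_abs, abs_mul, abs_of_nonneg h0]
        exact mul_le_mul_of_nonneg_left (hM t ⟨ht.1.le, ht.2⟩) h0)
      (Continuous.intervalIntegrable (by fun_prop) _ _)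
    have h2 : ∫ t in (0 : ℝ)..1, (1 - t) ^ 3 * M = M / 4 := by
      rw [intervalIntegral.integral_mul_const,
        intervalIntegral.integral_comp_sub_left (fun t : ℝ => t ^ 3) 1]
      norm_num; ring
    rw [h2, Real.norm_eq_abs] at h1
    exact h1
  set I := ∫ t in (0 : ℝ)..1, (1 - t) ^ 3 * iteratedFDeriv ℝ 4 W (t • y) (fun _ => y)
  have e : W y - W 0 - fderiv ℝ W 0 y - 1 / 2 * iteratedFDeriv ℝ 2 W 0 (fun _ => y) -
      1 / 6 * iteratedFDeriv ℝ 3 W 0 (fun _ => y) = 1 / 6 * I := by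
    linarith
  rw [e, abs_mul, abs_of_pos (by norm_num : (0 : ℝ) < 1 / 6)]
  linarith

end

end

section

/-! ### Weighted norms of vectors and tensors -/

lemma iteratedFDeriv_comp_affine {V : Type*} [NormedAddCommGroup V] [NormedSpace ℝ V]
    (f : V → ℝ) (x₀ : V) (e : V ≃L[ℝ] V) (k : ℕ) (y : V) (m : Fin k → V) :
    iteratedFDeriv ℝ k (fun y => f (x₀ + e y)) y m =
      iteratedFDeriv ℝ k f (x₀ + e y) (fun i => e (m i)) := by
  have h := e.iteratedFDerivWithin_comp_right (fun z => f (x₀ + z)) uniqueDiffOn_univ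
    (x := y) (Set.mem_univ _) k
  rw [Set.preimage_univ, iteratedFDerivWithin_univ, iteratedFDerivWithin_univ,
    iteratedFDeriv_comp_add_left] at h
  exact congrArg (fun T => T m) h

variable {d : ℕ} {H : Matrix (Fin d) (Fin d) ℝ}

lemma wnorm_nonneg (H : Matrix (Fin d) (Fin d) ℝ) (x : E d) : 0 ≤ wnorm H x := Real.sqrt_nonneg _

lemma wnorm_smul_matrix {n : ℝ} (hn : 0 ≤ n) (H : Matrix (Fin d) (Fin d) ℝ) (x : E d) :
    wnorm (n • H) x = Real.sqrt n * wnorm H x := by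
  rw [wnorm, wnorm, Matrix.smul_mulVec, dotProduct_smul, smul_eq_mul, Real.sqrt_mul hn]

/-- The square root of the inverse of `H` maps the Euclidean norm to the `H`-norm. -/
lemma exists_whitening (hH : H.PosDef) : ∃ e : E d ≃L[ℝ] E d,
    (∀ y, e y = Matrix.toEuclideanCLM (𝕜 := ℝ) (CFC.sqrt H⁻¹) y) ∧
    ∀ y, wnorm H (e y) = ‖y‖ := by
  have hI : (H⁻¹).PosDef := hH.inv
  have h0 : 0 ≤ H⁻¹ := hI.posSemidef.nonneg
  set P := CFC.sqrt H⁻¹ with hP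
  have hPP : P * P = H⁻¹ := CFC.sqrt_mul_sqrt_self _ h0
  have hPs : P.transpose = P := by
    have := (Matrix.nonneg_iff_posSemidef.1 (CFC.sqrt_nonneg H⁻¹)).isHermitian
    rw [← Matrix.conjTranspose_eq_transpose_of_trivial]
    exact this
  have hdet : IsUnit H.det := hH.det_pos.ne'.isUnit
  have hPdet : IsUnit P.det := by
    have h1 : P.det * P.det = H⁻¹.det := by rw [← Matrix.det_mul, hPP]
    have h2 : H⁻¹.det ≠ 0 := hI.det_pos.ne'
    rw [← h1] at h2
    exact (left_ne_zero_of_mul h2).isUnit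
  have hPHP : P * (H * P) = 1 := by
    have h1 : H = P⁻¹ * P⁻¹ := by
      rw [← Matrix.mul_inv_rev, hPP, Matrix.nonsing_inv_nonsing_inv _ hdet]
    rw [h1, Matrix.mul_assoc, Matrix.nonsing_inv_mul _ hPdet, Matrix.mul_one,
      Matrix.mul_nonsing_inv _ hPdet]
  have hl : ∀ A B : Matrix (Fin d) (Fin d) ℝ, A * B = 1 → ∀ y : E d,
      Matrix.toEuclideanCLM (𝕜 := ℝ) A (Matrix.toEuclideanCLM (𝕜 := ℝ) B y) = y := by
    intro A B hAB y
    rw [← mul_apply_eq_comp, ← map_mul, hAB, map_one, one_apply_eq_self]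
  refine ⟨ContinuousLinearEquiv.equivOfInverse (Matrix.toEuclideanCLM (𝕜 := ℝ) P)
    (Matrix.toEuclideanCLM (𝕜 := ℝ) P⁻¹) (hl _ _ (Matrix.nonsing_inv_mul _ hPdet))
    (hl _ _ (Matrix.mul_nonsing_inv _ hPdet)), fun y => rfl, fun y => ?_⟩
  rw [ContinuousLinearEquiv.equivOfInverse_apply, wnorm, Matrix.ofLp_toEuclideanCLM,
    Matrix.mulVec_mulVec]
  have h3 : dotProduct (P.mulVec y) ((H * P).mulVec y) = ‖y‖ ^ 2 := by
    rw [Matrix.dotProduct_mulVec, ← Matrix.mulVec_transpose, Matrix.mulVec_mulVec,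
      Matrix.transpose_mul, hPs, Matrix.mul_assoc]
    rw [show H.transpose = H from by
      rw [← Matrix.conjTranspose_eq_transpose_of_trivial]; exact hH.isHermitian, hPHP,
      Matrix.one_mulVec, EuclideanSpace.norm_sq_eq]
    simp [dotProduct, sq]
  rw [h3, Real.sqrt_sq (norm_nonneg _)]

/-- The H-unit sphere is Euclidean-bounded, so the supremum in `tnorm` is a genuine one and not the
default 0 of an unbounded set. -/
lemma bddAbove_tnorm (hH : H.PosDef) {k : ℕ} : ∃ C : ℝ, 0 ≤ C ∧
    ∀ (T : ContinuousMultilinearMap ℝ (fun _ : Fin k => E d) ℝ) (u : E d), wnorm H u = 1 →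
      |T (fun _ => u)| ≤ ‖T‖ * C := by
  obtain ⟨e, -, he⟩ := exists_whitening hH
  refine ⟨‖(e : E d →L[ℝ] E d)‖ ^ k, by positivity, fun T u hu => ?_⟩
  have h1 : ‖u‖ ≤ ‖(e : E d →L[ℝ] E d)‖ := by
    have h2 := (e : E d →L[ℝ] E d).le_opNorm (e.symm u)
    have h3 := he (e.symm u)
    rw [e.apply_symm_apply, hu] at h3
    simpa [← h3] using h2
  refine (T.le_opNorm _).trans ?_
  rw [Finset.prod_const, Finset.card_univ, Fintype.card_fin]
  gcongr

lemma abs_apply_le_tnorm (hH : H.PosDef) {k : ℕ} (hk : k ≠ 0)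
    (T : ContinuousMultilinearMap ℝ (fun _ : Fin k => E d) ℝ) (u : E d) :
    |T (fun _ => u)| ≤ tnorm H T * wnorm H u ^ k := by
  obtain ⟨C, -, hC⟩ := bddAbove_tnorm hH (k := k)
  obtain ⟨e, -, he⟩ := exists_whitening hH
  obtain ⟨y, rfl⟩ := e.surjective u
  -- The zero vector cannot be normalized; both sides vanish there because k ≠ 0.
  rcases eq_or_ne y 0 with rfl | hy
  · have : T (fun _ => e 0) = 0 := by
      have : Nonempty (Fin k) := ⟨⟨0, Nat.pos_of_ne_zero hk⟩⟩
      rw [map_zero]; exact T.map_zero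
    rw [this, he]; simp [hk]
  have hy0 : 0 < ‖y‖ := norm_pos_iff.2 hy
  set z := ‖y‖⁻¹ • y with hz
  have hz1 : wnorm H (e z) = 1 := by rw [he, hz, norm_smul]; simp [hy0.ne']
  have h1 : |T (fun _ => e z)| ≤ tnorm H T :=
    le_csSup ⟨_, by rintro _ ⟨u, hu, rfl⟩; exact hC T u hu⟩ ⟨e z, hz1, rfl⟩
  have h2 : e y = ‖y‖ • e z := by rw [hz, map_smul, smul_inv_smul₀ hy0.ne']
  have h3 : T (fun _ => e y) = ‖y‖ ^ k * T (fun _ => e z) := by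
    rw [h2, T.map_smul_univ (fun _ => ‖y‖) (fun _ => e z)]
    simp
  rw [h3, he, abs_mul, abs_of_nonneg (by positivity), mul_comm]
  gcongr

lemma tnorm_nonneg {k : ℕ} (T : ContinuousMultilinearMap ℝ (fun _ : Fin k => E d) ℝ) :
    0 ≤ tnorm H T :=
  Real.sSup_nonneg (by rintro _ ⟨u, -, rfl⟩; exact abs_nonneg _)

lemma cDeriv_nonneg (k : ℕ) (n : ℝ) (v : E d → ℝ) (xhat : E d) (s : ℝ) :
    0 ≤ cDeriv k n v xhat s :=
  Real.sSup_nonneg (by rintro _ ⟨u, -, rfl⟩; exact tnorm_nonneg _)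

lemma isCompact_localRegion {n : ℝ} {v : E d → ℝ} {xhat : E d} (hH : (hess v xhat).PosDef)
    (s : ℝ) : IsCompact (localRegion n v xhat s) := by
  obtain ⟨e, -, he⟩ := exists_whitening hH
  have h : localRegion n v xhat s =
      (fun y => xhat + e y) '' Metric.closedBall 0 (s * Real.sqrt (d / n)) := by
    ext x
    constructor
    · intro hx
      refine ⟨e.symm (x - xhat), ?_, by simp⟩
      have := he (e.symm (x - xhat))
      rw [e.apply_symm_apply] at this
      rw [mem_closedBall_zero_iff, ← this]
      exact hx
    · rintro ⟨y, hy, rfl⟩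
      rw [mem_closedBall_zero_iff] at hy
      change wnorm _ (xhat + e y - xhat) ≤ _
      rwa [add_sub_cancel_left, he]
  rw [h]
  exact (isCompact_closedBall _ _).image (by fun_prop)

/-- A real `sSup` bounds its elements only if the set is bounded; here boundedness comes from
continuity of the k-th derivative on the compact set U(s) ⊆ Θ. -/
lemma tnorm_le_cDeriv {n : ℝ} {v : E d → ℝ} {xhat : E d} {Θ : Set (E d)} (hΘ : IsOpen Θ)
    (hv : ContDiffOn ℝ 4 v Θ) (hH : (hess v xhat).PosDef) {k : ℕ} (hk : k ≤ 4) {s : ℝ}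
    (hs : localRegion n v xhat s ⊆ Θ) {x : E d} (hx : x ∈ localRegion n v xhat s) :
    tnorm (hess v xhat) (iteratedFDeriv ℝ k v x) ≤ cDeriv k n v xhat s := by
  obtain ⟨C, hC0, hC⟩ := bddAbove_tnorm hH (k := k)
  have hcont : ContinuousOn (fun x => ‖iteratedFDeriv ℝ k v x‖) (localRegion n v xhat s) := by
    have h1 : ContinuousOn (iteratedFDerivWithin ℝ k v Θ) Θ :=
      hv.continuousOn_iteratedFDerivWithin (by exact_mod_cast hk) hΘ.uniqueDiffOn
    have h2 : ContinuousOn (iteratedFDeriv ℝ k v) Θ :=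
      h1.congr fun y hy => (iteratedFDerivWithin_of_isOpen k hΘ hy).symm
    exact (h2.mono hs).norm
  obtain ⟨M, hM⟩ := (isCompact_localRegion (n := n) hH s).bddAbove_image hcont
  refine le_csSup ⟨M * C, ?_⟩ ⟨x, hx, rfl⟩
  rintro _ ⟨z, hz, rfl⟩
  have hMz : ‖iteratedFDeriv ℝ k v z‖ ≤ M := hM ⟨z, hz, rfl⟩
  have hM0 : 0 ≤ M := (norm_nonneg _).trans hMz
  refine Real.sSup_le ?_ (by positivity)
  rintro _ ⟨u, hu, rfl⟩
  exact (hC _ u hu).trans (by gcongr)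

lemma sum_smul_stdVec (u : E d) : ∑ i, u i • stdVec i = u := by
  have := (EuclideanSpace.basisFun (Fin d) ℝ).sum_repr u
  simpa [stdVec] using this

/-- The second derivative as a quadratic form. -/
lemma iteratedFDeriv_two_apply_const (f : E d → ℝ) (x u : E d) :
    iteratedFDeriv ℝ 2 f x (fun _ => u) = dotProduct (u : Fin d → ℝ) ((hess f x).mulVec u) := by
  have h : ∀ a b, iteratedFDeriv ℝ 2 f x ![a, b] = fderiv ℝ (fderiv ℝ f) x a b := fun a b => by
    rw [iteratedFDeriv_two_apply]; rfl
  have hu : (fun _ : Fin 2 => u) = ![u, u] := by ext i; fin_cases i <;> rfl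
  rw [hu, h]
  conv_lhs => rw [← sum_smul_stdVec u]
  simp only [map_sum, map_smul, sum_apply, smul_apply,
    dotProduct, Matrix.mulVec, hess, Matrix.of_apply, h, smul_eq_mul, Finset.mul_sum]
  rw [Finset.sum_comm]
  refine Finset.sum_congr rfl fun i _ => Finset.sum_congr rfl fun j _ => ?_
  ring

lemma wnorm_sq (hH : H.PosDef) (u : E d) :
    wnorm H u ^ 2 = dotProduct (u : Fin d → ℝ) (H.mulVec u) := by
  rw [wnorm, Real.sq_sqrt]
  simpa using hH.posSemidef.dotProduct_mulVec_nonneg (u : Fin d → ℝ)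

end

section

/-! ### The rescaled density -/

variable {d : ℕ} {A B n s s₀ c₀ : ℝ} {Θ : Set (E d)} {v : E d → ℝ} {xhat : E d}

/-- The density of the rescaled target with respect to the standard Gaussian measure, up to a
constant. -/
def rescaledDensity (n : ℝ) (Θ : Set (E d)) (v : E d → ℝ) (xhat y : E d) : ℝ :=
  Θ.indicator (fun x => Real.exp (-potential n v x))
    (xhat + Matrix.toEuclideanCLM (𝕜 := ℝ) (CFC.sqrt (HV n v xhat)⁻¹) y) *
    (Real.exp (potential n v xhat) * Real.exp (‖y‖ ^ 2 / 2))

lemma RegularUniqueMin.contDiffAt (h : RegularUniqueMin Θ v xhat) (hΘ : IsOpen Θ) {x : E d}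
    (hx : x ∈ Θ) : ContDiffAt ℝ 4 v x :=
  h.contDiffOn.contDiffAt (hΘ.mem_nhds hx)

lemma iteratedFDeriv_potential {k : ℕ} (hk : k ≤ 4) {x : E d} (hv : ContDiffAt ℝ 4 v x) :
    iteratedFDeriv ℝ k (potential n v) x = n • iteratedFDeriv ℝ k v x :=
  iteratedFDeriv_const_smul_apply (a := n) (f := v) (hv.of_le (by exact_mod_cast hk))

lemma RegularUniqueMin.HV_eq (h : RegularUniqueMin Θ v xhat) (hΘ : IsOpen Θ) :
    HV n v xhat = n • hess v xhat := by
  ext i j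
  simp [HV, hess, iteratedFDeriv_potential (by norm_num : 2 ≤ 4) (h.contDiffAt hΘ h.mem)]

lemma RegularUniqueMin.HV_posDef (h : RegularUniqueMin Θ v xhat) (hΘ : IsOpen Θ) (hn : 0 < n) :
    (HV n v xhat).PosDef := by
  rw [h.HV_eq hΘ]; exact h.posDef.smul hn

lemma measurable_indicator_exp (h : RegularUniqueMin Θ v xhat) (hΘ : IsOpen Θ) :
    Measurable (Θ.indicator fun x => Real.exp (-potential n v x)) := by
  classical
  rw [← Set.piecewise_eq_indicator]
  refine ContinuousOn.measurable_piecewise ?_ continuousOn_const hΘ.measurableSet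
  have := h.contDiffOn.continuousOn
  unfold potential
  fun_prop

/-- A whitening map for the rescaled problem. -/
structure IsWhitening (n : ℝ) (v : E d → ℝ) (xhat : E d) (e : E d ≃L[ℝ] E d) : Prop where
  eq : ∀ y, e y = Matrix.toEuclideanCLM (𝕜 := ℝ) (CFC.sqrt (HV n v xhat)⁻¹) y
  norm_HV : ∀ y, wnorm (HV n v xhat) (e y) = ‖y‖
  norm_hess : ∀ y, wnorm (hess v xhat) (e y) = ‖y‖ / Real.sqrt n

lemma RegularUniqueMin.exists_isWhitening (h : RegularUniqueMin Θ v xhat) (hΘ : IsOpen Θ)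
    (hn : 0 < n) : ∃ e, IsWhitening n v xhat e := by
  obtain ⟨e, he, hw⟩ := exists_whitening (h.HV_posDef hΘ hn)
  refine ⟨e, he, hw, fun y => ?_⟩
  rw [← hw y, h.HV_eq hΘ, wnorm_smul_matrix hn.le, mul_div_cancel_left₀]
  exact (Real.sqrt_pos.2 hn).ne'

variable {e : E d ≃L[ℝ] E d}

lemma IsWhitening.rescaled_eq (he : IsWhitening n v xhat e) :
    rescaled n v xhat = fun y => potential n v (xhat + e y) := by
  ext y; rw [rescaled, he.eq]

lemma IsWhitening.iteratedFDeriv_rescaled (he : IsWhitening n v xhat e) {k : ℕ} (hk : k ≤ 4)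
    {y : E d} (hv : ContDiffAt ℝ 4 v (xhat + e y)) (m : Fin k → E d) :
    iteratedFDeriv ℝ k (rescaled n v xhat) y m =
      n * iteratedFDeriv ℝ k v (xhat + e y) (fun i => e (m i)) := by
  rw [he.rescaled_eq, iteratedFDeriv_comp_affine, iteratedFDeriv_potential hk hv]
  rfl

lemma IsWhitening.contDiffAt_rescaled (he : IsWhitening n v xhat e) {y : E d}
    (hv : ContDiffAt ℝ 4 v (xhat + e y)) : ContDiffAt ℝ 4 (rescaled n v xhat) y := by
  rw [he.rescaled_eq]
  have h1 : ContDiffAt ℝ 4 (potential n v) (xhat + e y) := contDiffAt_const.mul hv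
  exact ContDiffAt.comp (g := potential n v) (f := fun y => xhat + e y) y h1 (by fun_prop)

lemma sqrt_div_div_sqrt (hn : 0 < n) (d : ℕ) (r : ℝ) :
    r / Real.sqrt n ≤ s * Real.sqrt (d / n) ↔ r ≤ s * Real.sqrt d := by
  have := Real.sqrt_pos.2 hn
  rw [Real.sqrt_div (Nat.cast_nonneg d), mul_div_assoc', div_le_div_iff_of_pos_right this]

lemma IsWhitening.mem_localRegion_iff (he : IsWhitening n v xhat e) (hn : 0 < n) (y : E d) :
    xhat + e y ∈ localRegion n v xhat s ↔ ‖y‖ ≤ s * Real.sqrt d := by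
  rw [localRegion, Set.mem_ofPred_eq, add_sub_cancel_left, he.norm_hess, sqrt_div_div_sqrt hn]

/-- Directional derivatives of the rescaled potential are controlled by `cDeriv`. -/
lemma IsWhitening.abs_iteratedFDeriv_rescaled_le (he : IsWhitening n v xhat e)
    (h : RegularUniqueMin Θ v xhat) (hΘ : IsOpen Θ) (hn : 0 < n)
    (hs : localRegion n v xhat s ⊆ Θ) {k : ℕ} (hk0 : k ≠ 0) (hk : k ≤ 4) {y : E d}
    (hy : ‖y‖ ≤ s * Real.sqrt d) (u : E d) :
    |iteratedFDeriv ℝ k (rescaled n v xhat) y (fun _ => u)| ≤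
      n * (cDeriv k n v xhat s * (‖u‖ / Real.sqrt n) ^ k) := by
  have hmem := (he.mem_localRegion_iff (s := s) hn y).2 hy
  rw [he.iteratedFDeriv_rescaled hk (h.contDiffAt hΘ (hs hmem)), abs_mul, abs_of_pos hn,
    ← he.norm_hess]
  refine mul_le_mul_of_nonneg_left ?_ hn.le
  refine (abs_apply_le_tnorm h.posDef hk0 _ _).trans ?_
  exact mul_le_mul_of_nonneg_right (tnorm_le_cDeriv hΘ h.contDiffOn h.posDef hk hs hmem)
    (pow_nonneg (wnorm_nonneg _ _) _)

lemma IsWhitening.rescaledDensity_eq (he : IsWhitening n v xhat e) {y : E d}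
    (hy : xhat + e y ∈ Θ) : rescaledDensity n Θ v xhat y =
      Real.exp (-(rescaled n v xhat y - rescaled n v xhat 0) + ‖y‖ ^ 2 / 2) := by
  rw [rescaledDensity, ← he.eq, Set.indicator_of_mem hy, he.rescaled_eq]
  simp only [map_zero, add_zero]
  rw [← Real.exp_add, ← Real.exp_add]
  congr 1; ring

lemma IsWhitening.fderiv_rescaled_zero (he : IsWhitening n v xhat e)
    (h : RegularUniqueMin Θ v xhat) (hΘ : IsOpen Θ) (hn : 0 < n) :
    fderiv ℝ (rescaled n v xhat) 0 = 0 := by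
  refine IsLocalMin.fderiv_eq_zero ?_
  have hc : ContinuousAt (fun y => xhat + e y) 0 := by fun_prop
  have h0 : Θ ∈ nhds (xhat + e 0) := by
    rw [map_zero, add_zero]; exact hΘ.mem_nhds h.mem
  filter_upwards [hc.preimage_mem_nhds h0] with y hy
  rw [he.rescaled_eq]
  simp only [map_zero, add_zero, potential]
  refine mul_le_mul_of_nonneg_left ?_ hn.le
  by_cases hne : xhat + e y = xhat
  · rw [hne]
  · exact (h.lt_of_ne _ hy hne).le

lemma IsWhitening.iteratedFDeriv_two_rescaled_zero (he : IsWhitening n v xhat e)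
    (h : RegularUniqueMin Θ v xhat) (hΘ : IsOpen Θ) (hn : 0 < n) (y : E d) :
    iteratedFDeriv ℝ 2 (rescaled n v xhat) 0 (fun _ => y) = ‖y‖ ^ 2 := by
  rw [he.rescaled_eq, iteratedFDeriv_comp_affine, map_zero, add_zero,
    iteratedFDeriv_two_apply_const, ← he.norm_HV y, wnorm_sq (h.HV_posDef hΘ hn)]
  rfl

lemma const_eq_cons (y : E d) : (fun _ : Fin 3 => y) = ![y, y, y] := by
  ext i; fin_cases i <;> rfl

/-- The rescaled target satisfies the hypotheses of the local expansion. -/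
theorem IsWhitening.localExpansion (he : IsWhitening n v xhat e) (hA : 0 < A) (hd : 0 < d)
    (hn : 0 < n) (hΘ : IsOpen Θ) (h : RegularUniqueMin Θ v xhat)
    (hlin : LinearGrowth A n Θ v xhat s₀ c₀) (hs : sStar s₀ c₀ ≤ s)
    (hsub : localRegion n v xhat s ⊆ Θ) (h3 : eps3 n v xhat ≤ B) (h4 : eps4 n v xhat s ≤ B) :
    LocalExpansion (thirdForm (rescaled n v xhat)) B (eps3 n v xhat) (eps4 n v xhat s) s c₀
      (rescaledDensity n Θ v xhat) := by
  have hdpos : (0 : ℝ) < d := by exact_mod_cast hd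
  have hfin : Module.finrank ℝ (E d) = d := finrank_euclideanSpace_fin
  have hsn := Real.sqrt_pos.2 hn
  have hsn2 : Real.sqrt n ^ 2 = n := Real.sq_sqrt hn.le
  have hs₀ : s₀ ≤ s := (le_max_left _ _).trans hs
  have hs0 : 0 ≤ s := hlin.s₀_pos.le.trans hs₀
  have hxhat : xhat + e 0 ∈ Θ := by rw [map_zero, add_zero]; exact h.mem
  -- ε₃ is defined by c₃(0), so the derivative bound at the mode is applied with radius 0.
  have hsub0 : localRegion n v xhat 0 ⊆ Θ := fun x hx => hsub (by
    have hx' : wnorm (hess v xhat) (x - xhat) ≤ 0 * Real.sqrt (d / n) := hx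
    rw [zero_mul] at hx'
    exact hx'.trans (by positivity))
  refine
    { symm := isSymmTrilin_thirdForm ((he.contDiffAt_rescaled (h.contDiffAt hΘ hxhat)).of_le
        (by norm_num))
      finrank_pos := by rw [hfin]; exact hd
      ε₃_nonneg := mul_nonneg (cDeriv_nonneg _ _ _ _ _) (by positivity)
      ε₃_le := h3
      ε₄_sq_le := pow_le_pow_left₀ (mul_nonneg (Real.sqrt_nonneg _) (by positivity)) h4 2
      cubic_le := fun u => ?_
      -- The constant A enters only through the positivity of c₀; the final constant depends on B
      -- alone.
      c₀_pos := (div_pos hA (Real.sqrt_pos.2 hdpos)).trans hlin.lt_c₀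
      c₀_le_one := hlin.c₀_le_one
      radius_le := (le_max_right _ _).trans hs
      measurable := ?_
      near := fun y hy => ?_
      far := fun y hy => ?_ }
  · rw [thirdForm_apply, ← const_eq_cons, hfin]
    refine (he.abs_iteratedFDeriv_rescaled_le h hΘ hn hsub0 (by norm_num) (by norm_num)
      (by simp) u).trans_eq ?_
    rw [eps3, div_pow, show Real.sqrt n ^ 3 = n * Real.sqrt n by
      rw [pow_succ, hsn2]]
    field_simp
  · have h1 := measurable_indicator_exp (n := n) h hΘ
    unfold rescaledDensity
    exact (h1.comp (by fun_prop)).mul (by fun_prop)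
  · rw [hfin] at hy ⊢
    have hseg : ∀ t ∈ Set.Icc (0 : ℝ) 1, ‖t • y‖ ≤ ‖y‖ := fun t ht => by
      rw [norm_smul, Real.norm_eq_abs, abs_of_nonneg ht.1]
      exact mul_le_of_le_one_left (norm_nonneg _) ht.2
    have hmem : ∀ t ∈ Set.Icc (0 : ℝ) 1, xhat + e (t • y) ∈ Θ := fun t ht =>
      hsub ((he.mem_localRegion_iff hn _).2 ((hseg t ht).trans hy))
    have hT := abs_taylor_sub_le (W := rescaled n v xhat) (y := y)
      (fun t ht => he.contDiffAt_rescaled (h.contDiffAt hΘ (hmem t ht)))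
      (fun t ht => he.abs_iteratedFDeriv_rescaled_le h hΘ hn hsub (by norm_num) le_rfl
        ((hseg t ht).trans hy) y)
    rw [he.fderiv_rescaled_zero h hΘ hn, he.iteratedFDeriv_two_rescaled_zero h hΘ hn] at hT
    have hy1 : xhat + e y ∈ Θ := by simpa using hmem 1 (by simp)
    -- ρ is everything in log w beyond the cubic form. The linear term vanishes at the minimum, and
    -- the quadratic one cancels ‖y‖²/2 because the Hessian of W at 0 is the identity.
    refine ⟨-(rescaled n v xhat y - rescaled n v xhat 0) + ‖y‖ ^ 2 / 2 -
      cubicSkew (thirdForm (rescaled n v xhat)) y, ?_, ?_⟩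
    · rw [cubicSkew, thirdForm_apply, ← const_eq_cons, ← abs_neg]
      refine (le_of_eq ?_).trans (hT.trans_eq ?_)
      · congr 1
        simp only [zero_apply]
        ring
      · rw [eps4, mul_pow, Real.sq_sqrt (cDeriv_nonneg _ _ _ _ _), div_pow, div_pow,
          show Real.sqrt n ^ 4 = (Real.sqrt n ^ 2) ^ 2 by ring, hsn2]
        field_simp
    · rw [he.rescaledDensity_eq hy1]
      congr 1; ring
  · rw [hfin] at hy ⊢
    by_cases hy1 : xhat + e y ∈ Θ
    · rw [he.rescaledDensity_eq hy1]
      refine ⟨(Real.exp_pos _).le, Real.exp_le_exp.2 ?_⟩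
      have hnot : xhat + e y ∉ localRegion n v xhat s₀ := by
        rw [he.mem_localRegion_iff hn, not_le]
        exact (mul_le_mul_of_nonneg_right hs₀ (Real.sqrt_nonneg _)).trans_lt hy
      have hg := hlin.growth _ ⟨hy1, hnot⟩
      rw [add_sub_cancel_left, he.norm_hess, Real.sqrt_div hdpos.le] at hg
      have hg' := mul_le_mul_of_nonneg_left hg hn.le
      have e1 : n * (c₀ * (Real.sqrt d / Real.sqrt n) * (‖y‖ / Real.sqrt n)) =
          c₀ * Real.sqrt d * ‖y‖ := by
        nth_rw 1 [← hsn2]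
        field_simp
      rw [e1] at hg'
      rw [he.rescaled_eq]
      simp only [map_zero, add_zero, potential]
      linarith
    · rw [rescaledDensity, ← he.eq, Set.indicator_of_notMem hy1, zero_mul]
      exact ⟨le_rfl, (Real.exp_pos _).le⟩

end

section

/-! ### Standardized observables -/

/-- Cauchy–Schwarz, by Young's inequality with weight t for every t > σ; letting t decrease to σ
includes the case σ = 0. -/
lemma abs_integral_mul_le_of_sq {α : Type*} [MeasurableSpace α] {μ : Measure α} {f g : α → ℝ}
    {σ : ℝ} (hσ : 0 ≤ σ) (hf : Integrable (fun x => f x ^ 2) μ)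
    (hg : Integrable (fun x => g x ^ 2) μ) (hfg : Integrable (fun x => f x * g x) μ)
    (hf1 : ∫ x, f x ^ 2 ∂μ ≤ 1) (hg1 : ∫ x, g x ^ 2 ∂μ ≤ σ ^ 2) :
    |∫ x, f x * g x ∂μ| ≤ σ := by
  refine le_of_forall_gt_imp_ge_of_dense fun t ht => ?_
  have ht0 : 0 < t := hσ.trans_lt ht
  have i1 : Integrable (fun x => t / 2 * f x ^ 2) μ := hf.const_mul _
  have i2 : Integrable (fun x => 1 / (2 * t) * g x ^ 2) μ := hg.const_mul _
  have hpt : ∀ x, |f x * g x| ≤ t / 2 * f x ^ 2 + 1 / (2 * t) * g x ^ 2 := by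
    intro x
    rw [abs_mul, ← sq_abs (f x), ← sq_abs (g x)]
    have e1 : t / 2 * |f x| ^ 2 + 1 / (2 * t) * |g x| ^ 2 - |f x| * |g x| =
        (t * |f x| - |g x|) ^ 2 / (2 * t) := by
      field_simp; ring
    have e2 : 0 ≤ (t * |f x| - |g x|) ^ 2 / (2 * t) := by positivity
    linarith
  refine abs_integral_le_integral_abs.trans ((integral_mono hfg.abs (i1.add i2) hpt).trans ?_)
  simp only [Pi.add_apply]
  rw [integral_add i1 i2, integral_const_mul, integral_const_mul]
  have e3 := mul_le_mul_of_nonneg_left hf1 (by positivity : 0 ≤ t / 2)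
  have e4 := mul_le_mul_of_nonneg_left (hg1.trans (pow_le_pow_left₀ hσ ht.le 2))
    (by positivity : 0 ≤ 1 / (2 * t))
  have e5 : 1 / (2 * t) * t ^ 2 = t / 2 := by field_simp
  linarith

section

variable {d : ℕ} {γ : Measure (E d)} {G : E d → ℝ}

lemma measurable_standardize (hG : Measurable G) : Measurable (standardize γ G) :=
  (hG.sub_const _).div_const _

lemma integral_standardize [IsProbabilityMeasure γ] (hG : Integrable G γ) :
    ∫ x, standardize γ G x ∂γ = 0 := by
  simp only [standardize]
  rw [integral_div, integral_sub hG (integrable_const _)]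
  simp

lemma integral_standardize_sq (hG : AEMeasurable G γ) (hv : 0 < variance G γ) :
    ∫ x, standardize γ G x ^ 2 ∂γ = 1 := by
  simp only [standardize, div_pow, Real.sq_sqrt hv.le]
  rw [integral_div, ← variance_eq_integral hG, div_self hv.ne']

end

/-! ### The Laplace approximation in rescaled coordinates -/

variable {d : ℕ} {A B n s s₀ c₀ : ℝ} {Θ : Set (E d)} {v : E d → ℝ} {xhat : E d}
  {e : E d ≃L[ℝ] E d}

/-- `multivariateGaussian` is by definition the image of the standard Gaussian under the square root
of the covariance, which is the whitening map. -/
lemma IsWhitening.laplace_eq (he : IsWhitening n v xhat e) :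
    laplace n v xhat = (stdGaussian (E d)).map (fun y => xhat + e y) := by
  simp only [he.eq]
  rfl

lemma IsWhitening.integral_laplace (he : IsWhitening n v xhat e) {F : E d → ℝ}
    (hF : Measurable F) :
    ∫ x, F x ∂(laplace n v xhat) = ∫ y, F (xhat + e y) ∂(stdGaussian (E d)) := by
  rw [he.laplace_eq, integral_map (by fun_prop) hF.aestronglyMeasurable]

lemma IsWhitening.integrable_laplace_iff (he : IsWhitening n v xhat e) {F : E d → ℝ}
    (hF : Measurable F) : Integrable F (laplace n v xhat) ↔
      Integrable (fun y => F (xhat + e y)) (stdGaussian (E d)) := by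
  rw [he.laplace_eq, integrable_map_measure hF.aestronglyMeasurable (by fun_prop)]
  rfl

instance : IsProbabilityMeasure (laplace n v xhat) := by
  unfold laplace; infer_instance

lemma IsWhitening.skew_eq (he : IsWhitening n v xhat e) (y : E d) :
    skew n v xhat (xhat + e y) = cubicSkew (thirdForm (rescaled n v xhat)) y := by
  rw [cubicSkew, thirdForm_apply, ← const_eq_cons, he.rescaled_eq, iteratedFDeriv_comp_affine,
    map_zero, add_zero, skew, add_sub_cancel_left]

lemma measurable_skew : Measurable (skew n v xhat) := by
  have h : Continuous (skew n v xhat) := by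
    unfold skew
    exact continuous_const.mul
      ((iteratedFDeriv ℝ 3 (potential n v) xhat).cont.comp (by fun_prop))
  exact h.measurable

/-- The coefficients 1/6 and 1/4 in εbar₃² are 6/36 and 9/36, with 1/36 the square of the prefactor
of the cubic form. -/
lemma integral_cubicSkew_sq (hL : IsSymmTrilin (thirdForm (rescaled n v xhat))) :
    ∫ y, cubicSkew (thirdForm (rescaled n v xhat)) y ^ 2 ∂(stdGaussian (E d)) =
      epsBar3 n v xhat ^ 2 := by
  have h := integral_trilin_sq (EuclideanSpace.basisFun (Fin d) ℝ) hL
  have hb : ∀ i, EuclideanSpace.basisFun (Fin d) ℝ i = stdVec i := fun i => by simp [stdVec]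
  simp only [hb, thirdForm_apply] at h
  simp only [cubicSkew, mul_pow, thirdForm_apply]
  rw [integral_const_mul, h, epsBar3, Real.sq_sqrt (by positivity)]
  simp only [thirdW]
  ring

/-- Integrals against the target as normalized integrals against the standard Gaussian measure. -/
lemma IsWhitening.target_spec (he : IsWhitening n v xhat e) (hΘ : IsOpen Θ)
    (h : RegularUniqueMin Θ v xhat) (hw0 : ∀ y, 0 ≤ rescaledDensity n Θ v xhat y)
    (hwm : Measurable (rescaledDensity n Θ v xhat))
    (hwi : Integrable (rescaledDensity n Θ v xhat) (stdGaussian (E d)))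
    (hpos : 0 < ∫ y, rescaledDensity n Θ v xhat y ∂(stdGaussian (E d))) :
    IsProbabilityMeasure (target n Θ v) ∧ ∀ g : E d → ℝ, Measurable g →
      Integrable (fun y => g (xhat + e y) * rescaledDensity n Θ v xhat y) (stdGaussian (E d)) →
      Integrable g (target n Θ v) ∧ ∫ x, g x ∂(target n Θ v) =
        (∫ y, g (xhat + e y) * rescaledDensity n Θ v xhat y ∂(stdGaussian (E d))) /
          ∫ y, rescaledDensity n Θ v xhat y ∂(stdGaussian (E d)) := by
  obtain ⟨c, hc0, hct, hc⟩ := exists_withDensity_eq_smul_map xhat e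
    (measurable_indicator_exp (n := n) h hΘ) (Real.exp_pos (potential n v xhat))
  have hU : unnormalized n Θ v = (volume : Measure (E d)).withDensity (fun x =>
      ENNReal.ofReal (Θ.indicator (fun x => Real.exp (-potential n v x)) x)) := by
    rw [unnormalized, ← withDensity_indicator hΘ.measurableSet]
    congr 1
    ext x
    by_cases hx : x ∈ Θ <;> simp [hx]
  have hU' : unnormalized n Θ v = c • ((stdGaussian (E d)).withDensity (fun y =>
      ENNReal.ofReal (rescaledDensity n Θ v xhat y))).map (fun y => xhat + e y) := by
    rw [hU, hc]
    simp only [rescaledDensity, he.eq]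
  exact normalized_map_withDensity (by fun_prop) hwm hw0 hwi hpos hc0 hct hU'

end

end SkewLaplace

end

/-! ### The theorem, transported back from whitened coordinates -/

theorem theorem2p1 (A B : ℝ) (hA : 0 < A) (hB : 0 < B) :
    ∃ K : ℝ, 0 < K ∧
      ∀ (d : ℕ) (n : ℝ) (Θ : Set (SkewLaplace.E d)) (v : SkewLaplace.E d → ℝ)
        (xhat : SkewLaplace.E d) (s₀ c₀ s aG : ℝ) (G : SkewLaplace.E d → ℝ),
        0 < d → 0 < n → IsOpen Θ →
        SkewLaplace.RegularUniqueMin Θ v xhat →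
        SkewLaplace.LinearGrowth A n Θ v xhat s₀ c₀ →
        -- the observable
        Measurable G → 0 ≤ aG →
        (∀ x, |G x - ∫ y, G y ∂(SkewLaplace.laplace n v xhat)| ≤
          aG * Real.exp (c₀ * Real.sqrt d *
            SkewLaplace.wnorm (SkewLaplace.HV n v xhat) (x - xhat) / 2)) →
        0 < variance G (SkewLaplace.laplace n v xhat) →
        -- the radius
        SkewLaplace.sStar s₀ c₀ ≤ s →
        SkewLaplace.localRegion n v xhat s ⊆ Θ →
        SkewLaplace.eps3 n v xhat ≤ B → SkewLaplace.eps4 n v xhat s ≤ B →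
        let π := SkewLaplace.target n Θ v
        let γ := SkewLaplace.laplace n v xhat
        let g := SkewLaplace.standardize γ G
        let ag := aG / Real.sqrt (variance G γ)
        let R := SkewLaplace.errCorrected n Θ v xhat g
        let L := SkewLaplace.leading n v xhat g
        let Δ := SkewLaplace.errLaplace n Θ v xhat g
        -- all objects are well defined
        IsProbabilityMeasure π ∧ Integrable g π ∧ Integrable g γ ∧
        Integrable (fun x => g x * SkewLaplace.skew n v xhat x) γ ∧
        -- the error of the corrected approximation is the remainder, and its bound
        R = Δ - L ∧
        |R| ≤ K * (SkewLaplace.expFactor n v xhat s *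
            (SkewLaplace.eps3 n v xhat ^ 2 + SkewLaplace.eps4 n v xhat s ^ 2)
          + max ag 1 * SkewLaplace.tau d c₀ s) ∧
        -- the leading term and the uncorrected error
        |L| ≤ SkewLaplace.epsBar3 n v xhat ∧
        |Δ| ≤ |L| + |R| ∧ |L| + |R| ≤ SkewLaplace.epsBar3 n v xhat + |R| ∧
        -- observables that are even about the mode
        ((∀ x, g (xhat + x) = g (xhat - x)) → L = 0 ∧ Δ = R) := by
  obtain ⟨K, hK, hmain⟩ := SkewLaplace.exists_abs_ratio_sub_le hB.le
  refine ⟨K, hK, ?_⟩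
  intro d n Θ v xhat s₀ c₀ s aG G hd hn hΘ h hlin hG haG hGa hvar hs hsub h3 h4 π γ g ag R L Δ
  obtain ⟨e, he⟩ := h.exists_isWhitening hΘ hn
  have hexp := he.localExpansion hA hd hn hΘ h hlin hs hsub h3 h4
  have hfin : Module.finrank ℝ (SkewLaplace.E d) = d := finrank_euclideanSpace_fin
  have hsv : 0 < Real.sqrt (variance G γ) := Real.sqrt_pos.2 hvar
  have hgm : Measurable g := SkewLaplace.measurable_standardize hG
  have hfm : Measurable (fun y => g (xhat + e y)) := hgm.comp (by fun_prop)
  have hga : ∀ x, |g x| ≤ ag * Real.exp (c₀ * Real.sqrt d *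
      SkewLaplace.wnorm (SkewLaplace.HV n v xhat) (x - xhat) / 2) := by
    intro x
    change |(G x - ∫ y, G y ∂γ) / Real.sqrt (variance G γ)| ≤ aG / Real.sqrt (variance G γ) * _
    rw [abs_div, abs_of_pos hsv, div_mul_eq_mul_div]
    exact div_le_div_of_nonneg_right (hGa x) hsv.le
  have hfa : ∀ y, |g (xhat + e y)| ≤ ag * Real.exp (c₀ * Real.sqrt d * ‖y‖ / 2) := by
    intro y
    have := hga (xhat + e y)
    rwa [add_sub_cancel_left, he.norm_HV] at this
  have hag : 0 ≤ ag := div_nonneg haG hsv.le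
  have hfi : Integrable (fun y => g (xhat + e y)) (stdGaussian (SkewLaplace.E d)) := by
    refine ((SkewLaplace.integrable_exp_mul_norm (c₀ * Real.sqrt d / 2)).const_mul ag).mono'
      hfm.aestronglyMeasurable (Filter.Eventually.of_forall fun y => ?_)
    rw [Real.norm_eq_abs]
    exact (hfa y).trans_eq (by ring_nf)
  have hf2 : Integrable (fun y => g (xhat + e y) ^ 2) (stdGaussian (SkewLaplace.E d)) := by
    refine ((SkewLaplace.integrable_exp_mul_norm (c₀ * Real.sqrt d)).const_mul (ag ^ 2)).mono'
      (hfm.pow_const 2).aestronglyMeasurable (Filter.Eventually.of_forall fun y => ?_)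
    rw [Real.norm_eq_abs, abs_pow]
    refine (pow_le_pow_left₀ (abs_nonneg _) (hfa y) 2).trans_eq ?_
    rw [mul_pow, ← Real.exp_nat_mul]
    congr 2; push_cast; ring
  have hgi : Integrable g γ := (he.integrable_laplace_iff hgm).2 hfi
  -- The growth bound alone gives integrability of g, hence of G; thus the mean appearing in that
  -- bound is a true mean and not the default value 0.
  have hGi : Integrable G γ := by
    refine ((hgi.mul_const (Real.sqrt (variance G γ))).add
      (integrable_const (∫ y, G y ∂γ))).congr (Filter.Eventually.of_forall fun x => ?_)
    change (G x - ∫ y, G y ∂γ) / Real.sqrt (variance G γ) * Real.sqrt (variance G γ) +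
      ∫ y, G y ∂γ = G x
    rw [div_mul_cancel₀ _ hsv.ne', sub_add_cancel]
  have hg0 : ∫ x, g x ∂γ = 0 := SkewLaplace.integral_standardize hGi
  have hf0 : ∫ y, g (xhat + e y) ∂(stdGaussian (SkewLaplace.E d)) = 0 := by
    rw [← he.integral_laplace hgm]; exact hg0
  have hf1 : ∫ y, g (xhat + e y) ^ 2 ∂(stdGaussian (SkewLaplace.E d)) = 1 := by
    rw [← he.integral_laplace (hgm.pow_const 2)]
    exact SkewLaplace.integral_standardize_sq hG.aemeasurable hvar
  obtain ⟨hwi, hpos, hfw, hfS, hbound⟩ := hmain hexp hag hfm hf2 hf1.le hfi hf0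
    (by rw [hfin]; exact hfa)
  obtain ⟨hπ, hπg⟩ := he.target_spec hΘ h hexp.nonneg hexp.measurable hwi hpos
  obtain ⟨hgπ, hgπ'⟩ := hπg g hgm hfw
  have hgSm : Measurable (fun x => g x * SkewLaplace.skew n v xhat x) :=
    hgm.mul SkewLaplace.measurable_skew
  have hgS : Integrable (fun x => g x * SkewLaplace.skew n v xhat x) γ := by
    rw [he.integrable_laplace_iff hgSm]
    simpa only [he.skew_eq] using hfS
  have hL : L = ∫ y, g (xhat + e y) * SkewLaplace.cubicSkew
      (SkewLaplace.thirdForm (SkewLaplace.rescaled n v xhat)) y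
      ∂(stdGaussian (SkewLaplace.E d)) := by
    change ∫ x, g x * SkewLaplace.skew n v xhat x ∂γ = _
    rw [he.integral_laplace hgSm]
    simp only [he.skew_eq]
  have hR : R = Δ - L := by
    change (∫ x, g x ∂π) - ∫ x, g x * (1 + SkewLaplace.skew n v xhat x) ∂γ =
      ((∫ x, g x ∂π) - ∫ x, g x ∂γ) - ∫ x, g x * SkewLaplace.skew n v xhat x ∂γ
    simp only [mul_add, mul_one]
    rw [integral_add hgi hgS]
    ring
  have hΔ : Δ = ∫ x, g x ∂π := by
    change (∫ x, g x ∂π) - ∫ x, g x ∂γ = _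
    rw [hg0, sub_zero]
  have hS2 : Integrable (fun y => SkewLaplace.cubicSkew
      (SkewLaplace.thirdForm (SkewLaplace.rescaled n v xhat)) y ^ 2)
      (stdGaussian (SkewLaplace.E d)) :=
    ((SkewLaplace.PolyGrowth.cubicSkew _).mul (SkewLaplace.PolyGrowth.cubicSkew _)).integrable.congr
      (Filter.Eventually.of_forall fun y => by simp only; ring)
  have hLle : |L| ≤ SkewLaplace.epsBar3 n v xhat := by
    rw [hL]
    exact SkewLaplace.abs_integral_mul_le_of_sq (Real.sqrt_nonneg _) hf2 hS2 hfS hf1.le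
      (SkewLaplace.integral_cubicSkew_sq hexp.symm).le
  refine ⟨hπ, hgπ, hgi, hgS, hR, ?_, hLle, ?_, by linarith, fun heven => ?_⟩
  · rw [hR, hΔ, hgπ', hL]
    refine hbound.trans (mul_le_mul_of_nonneg_left ?_ hK.le)
    rw [SkewLaplace.expFactor, SkewLaplace.tau, hfin]
    have hd1 : (1 : ℝ) ≤ d := by exact_mod_cast hd
    have hm : 0 ≤ max ag 1 := hag.trans (le_max_left _ _)
    gcongr
    -- The tail estimate holds without the factor d of τ(s), which is inserted using d ≥ 1.
    exact le_mul_of_one_le_left (Real.exp_pos _).le hd1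
  · have : Δ = L + R := by rw [hR]; ring
    rw [this]
    exact abs_add_le _ _
  · have hL0 : L = 0 := by
      rw [hL]
      refine SkewLaplace.integral_eq_zero_of_odd fun y => ?_
      rw [SkewLaplace.cubicSkew_neg, map_neg, ← sub_eq_add_neg, ← heven, mul_neg]
    exact ⟨hL0, by rw [hR, hL0, sub_zero]⟩
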